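/- An overpartition of $n$ is a partition of $n$ in which the first occurrence of each distinct part may be overlined. For an overpartition $\lambda$ let $\ell(\lambda)$ be its largest part ($0$ if $\lambda$ is empty), $n(\lambda)$ its number of parts, and $\lambda_o$ the subpartition consisting of its odd non-overlined parts. Put $$\text{rank}(\lambda)=\ell(\lambda)-n(\lambda),\qquad M2\text{-rank}(\lambda)=\left\lceil \tfrac{\ell(\lambda)}{2}\right\rceil-n(\lambda)+n(\lambda_o)-\chi(\lambda),$$ where $\chi(\lambda)=1$ if $\ell(\lambda)$ is odd and its first occurrence is not overlined, and $\chi(\lambda)=0$ otherwise. Let $\overline{N}(m,n)$ (resp. $\overline{N2}(m,n)$) be the number of overpartitions of $n$ with rank (resp. $M2$-rank) equal to $m$. The crank of a partition is its largest part if $1$ does not occur in it ($0$ for the empty partition), and otherwise it is $\mu-\omega$, where $\omega$ is the number of ones and $\mu$ the number of parts larger than $\omega$. The first residual crank of an overpartition is the crank of the subpartition of its non-overlined parts; the second residual crank is the crank of the partition obtained by dividing its even non-overlined parts by two. Let $\overline{M}(m,n)$ (resp. $\overline{M2}(m,n)$) be the number of overpartitions of $n$ with first (resp. second) residual crank equal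 to $m$, with the following modification: whenever the partition whose crank is taken is the partition $1$ of $1$, the overpartition contributes $-1$ to the count for $m=0$, $+1$ to the counts for $m=1$ and $m=-1$, and $0$ to all others. Define the moments $$\overline{N}_k(n)=\sum_{m\in\mathbb Z}m^k\,\overline{N}(m,n),\quad \overline{N2}_k(n)=\sum_{m\in\mathbb Z}m^k\,\overline{N2}(m,n),\quad \overline{M}_k(n)=\sum_{m\in\mathbb Z}m^k\,\overline{M}(m,n),\quad \overline{M2}_k(n)=\sum_{m\in\mathbb Z}m^k\,\overline{M2}(m,n).$$ Then for every integer $n\ge 0$, $$\begin{aligned} \overline{N}_6(n) &= \left(3+20n+48n^2\right)\overline{N}_2(n) + \left(\frac{2192796}{274505} + \frac{123276n}{7595} - \frac{5185344n^2}{1921535}\right)\overline{M}_2(n) \\ &\quad+ \left(-\frac{445728}{54901} - \frac{5730048n}{384307}\right)\overline{M}_4(n) + \frac{5376}{3565}\,\overline{M}_6(n) \\ &\quad+ \left(-\frac{386988}{39215} - \frac{54556468n}{1921535} - \frac{30679392n^2}{1921535}\right)\overline{M2}_2(n) \\ &\quad+ \left(\frac{96204}{7843} + \frac{1412352n}{54901}\right)\overline{M2}_4(n)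 - \frac{9056}{3565}\,\overline{M2}_6(n) \end{aligned}$$ and $$\begin{aligned} \overline{N2}_6(n) &= \left(3+5n+3n^2\right)\overline{N2}_2(n) + \left(\frac{249003}{274505} + \frac{36273n}{83545} - \frac{162042n^2}{1921535}\right)\overline{M}_2(n) \\ &\quad+ \left(-\frac{46014}{54901} - \frac{179064n}{384307}\right)\overline{M}_4(n) + \frac{168}{3565}\,\overline{M}_6(n) \\ &\quad+ \left(-\frac{765123}{274505} + \frac{6826601n}{1921535} + \frac{4805874n^2}{1921535}\right)\overline{M2}_2(n) \\ &\quad+ \left(\frac{39102}{7843} + \frac{44136n}{54901}\right)\overline{M2}_4(n) - \frac{3848}{3565}\,\overline{M2}_6(n). \end{aligned}$$ -/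

import Mathlib

/-- An overpartition of `n`: a partition of `n` in which the first occurrence of each distinct
part may be overlined. It is recorded by the underlying partition and the set of those part sizes
whose first occurrence is overlined. -/
@[ext]
structure Overpartition (n : ℕ) where
  toPartition : n.Partition
  overlined : Finset ℕ
  overlined_subset : overlined ⊆ toPartition.parts.toFinset

namespace Overpartition

/-- Overpartitions as pairs of a partition and a subset of its set of part sizes. -/
def equivSigma (n : ℕ) :
    Overpartition n ≃ Σ p : n.Partition, {S : Finset ℕ // S ∈ p.parts.toFinset.powerset} where
  toFun l := ⟨l.toPartition, l.overlined, Finset.mem_powerset.2 l.overlined_subset⟩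
  invFun x := ⟨x.1, x.2.1, Finset.mem_powerset.1 x.2.2⟩
  left_inv _ := rfl
  right_inv _ := rfl

instance instFintype (n : ℕ) : Fintype (Overpartition n) :=
  Fintype.ofEquiv _ (equivSigma n).symm

/-- All parts, overlined or not, with multiplicity. -/
def parts {n : ℕ} (l : Overpartition n) : Multiset ℕ :=
  l.toPartition.parts

/-- The subpartition of the non-overlined parts: one copy of each overlined size is removed. -/
def nonOverlined {n : ℕ} (l : Overpartition n) : Multiset ℕ :=
  l.parts - l.overlined.val

/-- The subpartition of the odd non-overlined parts. -/
def oddNonOverlined {n : ℕ} (l : Overpartition n) : Multiset ℕ :=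
  l.nonOverlined.filter (fun i => Odd i)

/-- The even non-overlined parts, each divided by two. -/
def halvedEvenNonOverlined {n : ℕ} (l : Overpartition n) : Multiset ℕ :=
  (l.nonOverlined.filter (fun i => Even i)).map (fun i => i / 2)

/-- The size of the largest part (`0` for the empty overpartition). -/
def largest {n : ℕ} (l : Overpartition n) : ℕ :=
  l.parts.sup

/-- Dyson's rank: the largest part minus the number of parts. -/
def rank {n : ℕ} (l : Overpartition n) : ℤ :=
  (l.largest : ℤ) - (l.parts.card : ℤ)

/-- `1` if the largest part is odd and its first occurrence is not overlined, and `0` otherwise. -/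
def chi {n : ℕ} (l : Overpartition n) : ℤ :=
  if Odd l.largest ∧ l.largest ∉ l.overlined then 1 else 0

/-- The `M2`-rank `⌈ℓ(λ) / 2⌉ - n(λ) + n(λ_o) - χ(λ)`. -/
def m2Rank {n : ℕ} (l : Overpartition n) : ℤ :=
  ⌈(l.largest : ℚ) / 2⌉ - (l.parts.card : ℤ) + (l.oddNonOverlined.card : ℤ) - l.chi

/-- The number of overpartitions of `n` with rank `m`. -/
def rankCount (m : ℤ) (n : ℕ) : ℕ :=
  (Finset.univ.filter (fun l : Overpartition n => l.rank = m)).card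

/-- The number of overpartitions of `n` with `M2`-rank `m`. -/
def m2RankCount (m : ℤ) (n : ℕ) : ℕ :=
  (Finset.univ.filter (fun l : Overpartition n => l.m2Rank = m)).card

/-- The Andrews--Garvan crank of a partition given by its multiset of parts: the largest part if
`1` is not a part (`0` for the empty partition); otherwise the number of parts larger than `ω`
minus `ω`, where `ω` is the number of ones. -/
def crank (s : Multiset ℕ) : ℤ :=
  if s.count 1 = 0 then (s.sup : ℤ)
  else ((s.filter (fun i => s.count 1 < i)).card : ℤ) - (s.count 1 : ℤ)

/-- The contribution of a partition to the count of partitions of crank `m`: it is the indicator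
of `crank = m`, except that the partition `1` contributes `-1` for `m = 0` and `1` for `m = ± 1`
(so that `M(0,1) = -1` and `M(1,1) = M(-1,1) = 1`). -/
def crankWeight (s : Multiset ℕ) (m : ℤ) : ℤ :=
  if s = {1} then
    if m = 0 then -1 else if m = 1 ∨ m = -1 then 1 else 0
  else if crank s = m then 1 else 0

/-- The (modified) number of overpartitions of `n` with first residual crank `m`. -/
def firstCrankCount (m : ℤ) (n : ℕ) : ℤ :=
  ∑ l : Overpartition n, crankWeight l.nonOverlined m

/-- The (modified) number of overpartitions of `n` with second residual crank `m`. -/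
def secondCrankCount (m : ℤ) (n : ℕ) : ℤ :=
  ∑ l : Overpartition n, crankWeight l.halvedEvenNonOverlined m

/-- The moment `∑ m ∈ ℤ, m ^ k * c m` of a finitely supported function `c`. -/
noncomputable def moment (c : ℤ → ℤ) (k : ℕ) : ℤ :=
  ∑ᶠ m : ℤ, m ^ k * c m

/-- The `k`-th rank moment for overpartitions of `n`. -/
noncomputable def rankMoment (k n : ℕ) : ℤ :=
  moment (fun m => (rankCount m n : ℤ)) k

/-- The `k`-th `M2`-rank moment for overpartitions of `n`. -/
noncomputable def m2RankMoment (k n : ℕ) : ℤ :=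
  moment (fun m => (m2RankCount m n : ℤ)) k

/-- The `k`-th moment of the first residual crank for overpartitions of `n`. -/
noncomputable def firstCrankMoment (k n : ℕ) : ℤ :=
  moment (fun m => firstCrankCount m n) k

/-- The `k`-th moment of the second residual crank for overpartitions of `n`. -/
noncomputable def secondCrankMoment (k n : ℕ) : ℤ :=
  moment (fun m => secondCrankCount m n) k

/-! The four count functions are finitely supported in `m`, so the moments are genuine finite
sums. -/

theorem rankCount_support_finite (n : ℕ) :
    (Function.support (fun m : ℤ => (rankCount m n : ℤ))).Finite := by
  refine (Set.finite_range (fun l : Overpartition n => l.rank)).subset fun m hm => ?_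
  obtain ⟨l, hl⟩ := Finset.card_ne_zero.1 (Nat.cast_ne_zero.1 hm)
  exact ⟨l, (Finset.mem_filter.1 hl).2⟩

theorem m2RankCount_support_finite (n : ℕ) :
    (Function.support (fun m : ℤ => (m2RankCount m n : ℤ))).Finite := by
  refine (Set.finite_range (fun l : Overpartition n => l.m2Rank)).subset fun m hm => ?_
  obtain ⟨l, hl⟩ := Finset.card_ne_zero.1 (Nat.cast_ne_zero.1 hm)
  exact ⟨l, (Finset.mem_filter.1 hl).2⟩

theorem crankWeight_support_finite (s : Multiset ℕ) :
    (Function.support (crankWeight s)).Finite := by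
  refine (Set.toFinite ({0, 1, -1, crank s} : Set ℤ)).subset fun m hm => ?_
  by_contra h
  simp only [Set.mem_insert_iff, Set.mem_singleton_iff, not_or] at h
  obtain ⟨h0, h1, h2, h3⟩ := h
  exact hm (by simp [crankWeight, h0, h1, h2, Ne.symm h3])

theorem firstCrankCount_support_finite (n : ℕ) :
    (Function.support (fun m : ℤ => firstCrankCount m n)).Finite := by
  refine (Set.finite_iUnion fun l : Overpartition n =>
    crankWeight_support_finite l.nonOverlined).subset fun m hm => ?_
  obtain ⟨l, -, hl⟩ := Finset.exists_ne_zero_of_sum_ne_zero hm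
  exact Set.mem_iUnion.2 ⟨l, hl⟩

theorem secondCrankCount_support_finite (n : ℕ) :
    (Function.support (fun m : ℤ => secondCrankCount m n)).Finite := by
  refine (Set.finite_iUnion fun l : Overpartition n =>
    crankWeight_support_finite l.halvedEvenNonOverlined).subset fun m hm => ?_
  obtain ⟨l, -, hl⟩ := Finset.exists_ne_zero_of_sum_ne_zero hm
  exact Set.mem_iUnion.2 ⟨l, hl⟩

end Overpartition

/-! Each counting function is encoded as a series in z and q. The k-th moment is then (z∂z)^k
evaluated at z = 1, and multiplication of the n-th coefficient by n is q∂q. At z = 1 all four series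
reduce to P, the generating function of overpartitions.

Cranks. The first residual crank series times ∏ (1 - z q^i)(1 - q^i/z) does not involve z, and the
same holds for the second one with q² in the product (`exists_crankGF_mul`, `exists_residualCrank`).
Taking logarithmic derivatives, their even moments are P times polynomials in the Lambert series A_k
= ∑ m^k q^(im), respectively B_k = A_k(q²), with k = 1, 3, 5.

Ranks. A rank series R is not a theta quotient, but it satisfies a partial differential equation of
Atkin–Garvan type. Cutting overpartitions at their largest part writes R as a sum over l;
telescoping this sum and shifting z by a power of q give two functional equations. Eliminating an
auxiliary sum shows that R is invariant under z ↦ 1/z and that the coefficients of ψ = (1+z)/(1-z) R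
satisfy ψ(e-m) = q^(sm-1) ψ(m) + [m = e], where (s, e) = (1, 2) for the rank and (2, 1) for the
M2-rank. The operator e² q∂q + (z∂z)² kills the inhomogeneous term. After multiplication by the cube
of the theta function ∏ (1 - z q^(si))(1 - q^(s(i+1))/z), i ≥ 0, the coefficients have two
reflection symmetries, which fix them up to a scalar, and z ∏ (1 + z q^i)(1 + q^(i+1)/z) has the
same two. This is `exists_heatOp_mul_eq`, applied in `rank_pde` and `m2Rank_pde`.

Taking moments of orders 0, 2, 4, 6 of this equation (`mom_of_heatOp`) expresses the sixth rank
moment by the second one, its q-derivatives, P and the Lambert series.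

Conclusion. The heat equation satisfied by theta functions yields Ramanujan's differential equations
for A_k and for B_k, together with further relations between the two families coming from the theta
function with sign -1 (`lambert_relations`). Modulo these, the claimed formulas become polynomial
identities in A₁, A₃, A₅, B₁, B₃, B₅, settled by explicit certificates in `rank_six_field` and
`m2Rank_six_field`. -/

namespace OverpartitionMoments

open PowerSeries Filter

/-! ### Coefficientwise limits of power series -/

section Limits

variable {R : Type*} [CommRing R]

/-- `s N` tends to `f` coefficientwise, each coefficient being eventually constant. -/
def ConvTo (s : ℕ → R⟦X⟧) (f : R⟦X⟧) : Prop :=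
  ∀ n, ∀ᶠ N in atTop, coeff n (s N) = coeff n f

theorem ConvTo.const (f : R⟦X⟧) : ConvTo (fun _ => f) f :=
  fun _ => Eventually.of_forall fun _ => rfl

theorem ConvTo.unique {s : ℕ → R⟦X⟧} {f g : R⟦X⟧} (hf : ConvTo s f) (hg : ConvTo s g) : f = g := by
  ext n
  obtain ⟨N, h1, h2⟩ := ((hf n).and (hg n)).exists
  rw [← h1, h2]

theorem ConvTo.add {s t : ℕ → R⟦X⟧} {f g : R⟦X⟧} (hf : ConvTo s f) (hg : ConvTo t g) :
    ConvTo (fun N => s N + t N) (f + g) := fun n => by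
  filter_upwards [hf n, hg n] with N h1 h2
  simp [h1, h2]

theorem ConvTo.sub {s t : ℕ → R⟦X⟧} {f g : R⟦X⟧} (hf : ConvTo s f) (hg : ConvTo t g) :
    ConvTo (fun N => s N - t N) (f - g) := fun n => by
  filter_upwards [hf n, hg n] with N h1 h2
  simp [h1, h2]

theorem ConvTo.le {s : ℕ → R⟦X⟧} {f : R⟦X⟧} (hf : ConvTo s f) (n : ℕ) :
    ∀ᶠ N in atTop, ∀ i ≤ n, coeff i (s N) = coeff i f := by
  have : ∀ᶠ N in atTop, ∀ i ∈ Finset.range (n + 1), coeff i (s N) = coeff i f :=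
    (Finset.eventually_all _).2 fun i _ => hf i
  filter_upwards [this] with N h i hi
  exact h i (Finset.mem_range.2 (by omega))

theorem ConvTo.mul {s t : ℕ → R⟦X⟧} {f g : R⟦X⟧} (hf : ConvTo s f) (hg : ConvTo t g) :
    ConvTo (fun N => s N * t N) (f * g) := fun n => by
  filter_upwards [hf.le n, hg.le n] with N h1 h2
  rw [coeff_mul, coeff_mul]
  refine Finset.sum_congr rfl fun p hp => ?_
  have := Finset.HasAntidiagonal.mem_antidiagonal.1 hp
  rw [h1 _ (by omega), h2 _ (by omega)]

theorem ConvTo.map {S : Type*} [CommRing S] {s : ℕ → R⟦X⟧} {f : R⟦X⟧} (hf : ConvTo s f)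
    (φ : R →+* S) : ConvTo (fun N => PowerSeries.map φ (s N)) (PowerSeries.map φ f) := fun n => by
  filter_upwards [hf n] with N h1
  simp [h1]

theorem ConvTo.comp_tendsto {s : ℕ → R⟦X⟧} {f : R⟦X⟧} (hf : ConvTo s f) {u : ℕ → ℕ}
    (hu : Tendsto u atTop atTop) : ConvTo (fun N => s (u N)) f := fun n => hu.eventually (hf n)

theorem ConvTo.of_dvd_sub {s t : ℕ → R⟦X⟧} {f : R⟦X⟧} (hf : ConvTo s f)
    (h : ∀ N, X ^ N ∣ s N - t N) : ConvTo t f := fun n => by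
  filter_upwards [hf n, eventually_gt_atTop n] with N h1 h2
  have := (X_pow_dvd_iff.1 (h N)) n h2
  rw [map_sub, sub_eq_zero] at this
  rw [← this, h1]

theorem convTo_zero_of_dvd {s : ℕ → R⟦X⟧} (h : ∀ M, ∀ᶠ N in atTop, X ^ M ∣ s N) :
    ConvTo s 0 := fun n => by
  filter_upwards [h (n + 1)] with N h1
  simpa using (X_pow_dvd_iff.1 h1) n (Nat.lt_succ_self n)

theorem exists_convTo {s : ℕ → R⟦X⟧} (h : ∀ M, ∀ᶠ N in atTop, X ^ M ∣ s (N + 1) - s N) :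
    ∃ f, ConvTo s f := by
  have : ∀ n, ∃ N₀, ∀ N ≥ N₀, coeff n (s N) = coeff n (s N₀) := fun n => by
    obtain ⟨N₀, h0⟩ := eventually_atTop.1 (h (n + 1))
    refine ⟨N₀, fun N hN => ?_⟩
    induction N, hN using Nat.le_induction with
    | base => rfl
    | succ N hN ih =>
      have := (X_pow_dvd_iff.1 (h0 N hN)) n (Nat.lt_succ_self n)
      rw [map_sub, sub_eq_zero] at this
      rw [this, ih]
  choose N₀ hN₀ using this
  exact ⟨mk fun n => coeff n (s (N₀ n)), fun n => eventually_atTop.2 ⟨N₀ n, fun N hN => by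
    rw [coeff_mk]; exact hN₀ n N hN⟩⟩

theorem ConvTo.dvd {s : ℕ → R⟦X⟧} {f : R⟦X⟧} (hf : ConvTo s f) {k : ℕ}
    (h : ∀ N, X ^ k ∣ s N) : X ^ k ∣ f := by
  rw [X_pow_dvd_iff]
  intro m hm
  obtain ⟨N, hN⟩ := (hf m).exists
  rw [← hN]
  exact X_pow_dvd_iff.1 (h N) m hm

theorem eq_zero_of_forall_X_pow_dvd {f : R⟦X⟧} (h : ∀ n, X ^ n ∣ f) : f = 0 := by
  ext n
  simpa using X_pow_dvd_iff.1 (h (n + 1)) n (Nat.lt_succ_self n)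

/-- The inverse of a power series with constant coefficient `1`. -/
noncomputable def pinv (f : R⟦X⟧) : R⟦X⟧ := invOfUnit f 1

theorem mul_pinv {f : R⟦X⟧} (h : constantCoeff f = 1) : f * pinv f = 1 :=
  mul_invOfUnit f 1 (by simpa using h)

/-- The Euler operator `q d/dq`. -/
noncomputable def qD : Derivation R R⟦X⟧ R⟦X⟧ := (X : R⟦X⟧) • derivative R

theorem coeff_qD (f : R⟦X⟧) (n : ℕ) : coeff n (qD f) = n * coeff n f := by
  rw [qD, Derivation.smul_apply, smul_eq_mul]
  cases n with
  | zero => simp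
  | succ n => rw [coeff_succ_X_mul, coeff_derivative]; push_cast; ring

theorem qD_X_pow (m : ℕ) : qD (X ^ m : R⟦X⟧) = (m : R⟦X⟧) * (X : R⟦X⟧) ^ m := by
  ext n
  rw [coeff_qD, ← map_natCast (C : R →+* R⟦X⟧), coeff_C_mul, coeff_X_pow]
  split_ifs with h <;> simp [h]

end Limits

/-! ### Power series over Laurent polynomials -/

/-- Power series in `q`. -/
abbrev QSer := PowerSeries ℚ

instance instCharZeroQSer : CharZero QSer :=
  charZero_of_injective_algebraMap (algebraMap ℚ QSer).injective

/-- Power series in `q` whose coefficients are Laurent polynomials in `z`. -/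
abbrev BiSeries := PowerSeries (LaurentPolynomial ℚ)

open LaurentPolynomial (T T_add T_zero)

/-- The coefficient of `z ^ k`. -/
noncomputable def zc (k : ℤ) : BiSeries →+ QSer where
  toFun f := mk fun n => (coeff n f).coeff k
  map_zero' := by ext; simp
  map_add' f g := by ext; simp

theorem coeff_zc (k : ℤ) (f : BiSeries) (n : ℕ) : coeff n (zc k f) = (coeff n f).coeff k := by
  simp [zc]

theorem zc_ext {f g : BiSeries} (h : ∀ k, zc k f = zc k g) : f = g := by
  ext n k
  rw [← coeff_zc, h, coeff_zc]

/-- The inclusion of power series in `q` as series not involving `z`. -/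
noncomputable def kK : QSer →+* BiSeries := PowerSeries.map LaurentPolynomial.C

/-- The monomial `z ^ m`. -/
noncomputable def zT (m : ℤ) : BiSeries := PowerSeries.C (T m)

theorem zT_add (m n : ℤ) : zT (m + n) = zT m * zT n := by
  rw [zT, zT, zT, LaurentPolynomial.T_add, map_mul]

@[simp] theorem zT_zero : zT 0 = 1 := by simp [zT]

theorem zc_zT_mul (m k : ℤ) (f : BiSeries) : zc k (zT m * f) = zc (k - m) f := by
  ext n
  rw [coeff_zc, coeff_zc, zT, coeff_C_mul, LaurentPolynomial.T]
  have : k = m + (k - m) := by ring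
  rw [AddMonoidAlgebra.coeff_single_mul_eq_mul_coeff (m₂ := k - m)]
  · simp
  · intro a _; constructor <;> intro h <;> omega

theorem zc_kK_mul (k : ℤ) (a : QSer) (f : BiSeries) : zc k (kK a * f) = a * zc k f := by
  ext n
  rw [coeff_zc, coeff_mul, coeff_mul, AddMonoidAlgebra.coeff_sum, Finset.sum_apply']
  refine Finset.sum_congr rfl fun p _ => ?_
  rw [coeff_zc, kK, coeff_map, ← LaurentPolynomial.smul_eq_C_mul]
  simp

theorem zc_one (k : ℤ) : zc k 1 = if k = 0 then 1 else 0 := by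
  ext n
  rw [coeff_zc, coeff_one]
  have h : ((1 : LaurentPolynomial ℚ)).coeff k = if k = 0 then 1 else 0 := by
    rw [← LaurentPolynomial.T_zero, LaurentPolynomial.T_apply]; simp only [eq_comm]
  by_cases h1 : n = 0 <;> by_cases h2 : k = 0 <;> simp [h1, h2, h, coeff_one]

theorem zc_kK (k : ℤ) (a : QSer) : zc k (kK a) = if k = 0 then a else 0 := by
  have := zc_kK_mul k a 1
  rw [mul_one, zc_one] at this
  rw [this]; split_ifs <;> simp

theorem zc_zT (k m : ℤ) : zc k (zT m) = if k = m then 1 else 0 := by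
  have := zc_zT_mul m k 1
  rw [mul_one, zc_one] at this
  rw [this]; simp [sub_eq_zero]

@[simp] theorem kK_X : kK X = X := by simp [kK]

theorem ConvTo.zc {s : ℕ → BiSeries} {f : BiSeries} (hf : ConvTo s f) (k : ℤ) :
    ConvTo (fun N => zc k (s N)) (zc k f) := fun n => by
  filter_upwards [hf n] with N h1
  simp [coeff_zc, h1]

/-- The map on Laurent polynomials underlying `z d/dz`. -/
noncomputable def lauD : LaurentPolynomial ℚ →ₗ[ℚ] LaurentPolynomial ℚ where
  toFun f := .ofCoeff (Finsupp.onFinset f.coeff.support (fun n => (n : ℚ) * f.coeff n)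
    (fun n h => by simp only [Finsupp.mem_support_iff]; exact fun h0 => h (by simp [h0])))
  map_add' f g := by
    ext n; simp [mul_add]
  map_smul' c f := by
    ext n; simp; ring

@[simp] theorem coeff_lauD (f : LaurentPolynomial ℚ) (n : ℤ) :
    (lauD f).coeff n = n * f.coeff n := rfl

theorem lauD_T (m : ℤ) : lauD (T m) = (m : ℚ) • T m := by
  ext n
  rw [coeff_lauD, AddMonoidAlgebra.coeff_smul_apply, LaurentPolynomial.T_apply]
  split_ifs with h <;> simp [h]

theorem lauD_mul (f g : LaurentPolynomial ℚ) : lauD (f * g) = f * lauD g + g * lauD f := by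
  induction f using LaurentPolynomial.induction_on' with
  | add p q hp hq => rw [add_mul, map_add, hp, hq, map_add]; ring
  | C_mul_T n a =>
    rw [← LaurentPolynomial.smul_eq_C_mul, smul_mul_assoc, map_smul, map_smul]
    suffices h : lauD (T n * g) = T n * lauD g + g * lauD (T n) by
      rw [h, smul_add, smul_mul_assoc, mul_smul_comm]
    induction g using LaurentPolynomial.induction_on' with
    | add p q hp hq => rw [mul_add, map_add, hp, hq, map_add]; ring
    | C_mul_T m b =>
      rw [← LaurentPolynomial.smul_eq_C_mul, mul_smul_comm, map_smul, map_smul,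
        ← LaurentPolynomial.T_add, lauD_T, lauD_T, lauD_T, mul_smul_comm, smul_mul_assoc,
        mul_smul_comm, mul_smul_comm, ← LaurentPolynomial.T_add, ← LaurentPolynomial.T_add,
        add_comm m n, ← smul_add, ← add_smul]
      push_cast
      rw [add_comm (n : ℚ)]

/-- The Euler operator `z d/dz`. -/
noncomputable def zD : Derivation ℚ BiSeries BiSeries :=
  Derivation.mk'
    { toFun := fun f => mk fun n => lauD (coeff n f)
      map_add' := fun f g => by ext n; simp
      map_smul' := fun c f => by
        ext n
        have : ∀ (c : ℚ) (f : BiSeries) n, coeff n (c • f) = c • coeff n f := fun c f n => rfl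
        simp [this] }
    (fun f g => by
      ext1 n
      simp only [LinearMap.coe_mk, AddHom.coe_mk, smul_eq_mul, map_add, coeff_mul, coeff_mk,
        map_sum]
      rw [← Finset.Nat.sum_antidiagonal_swap (f := fun p => coeff p.1 g * lauD (coeff p.2 f)),
        ← Finset.sum_add_distrib]
      exact Finset.sum_congr rfl fun p _ => lauD_mul _ _)

theorem coeff_zD (f : BiSeries) (n : ℕ) : coeff n (zD f) = lauD (coeff n f) := by
  simp [zD]

theorem zc_zD (k : ℤ) (f : BiSeries) : zc k (zD f) = (k : QSer) * zc k f := by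
  ext n
  rw [coeff_zc, coeff_zD, coeff_lauD, ← map_intCast (PowerSeries.C : ℚ →+* QSer), coeff_C_mul,
    coeff_zc]

theorem zc_qD (k : ℤ) (f : BiSeries) : zc k (qD f) = qD (zc k f) := by
  ext n
  rw [coeff_zc, coeff_qD, coeff_qD, coeff_zc, ← nsmul_eq_mul, ← nsmul_eq_mul]
  rfl

theorem ConvTo.zD {s : ℕ → BiSeries} {f : BiSeries} (hf : ConvTo s f) :
    ConvTo (fun N => zD (s N)) (zD f) := fun n => by
  filter_upwards [hf n] with N h1
  simp [coeff_zD, h1]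

theorem zD_kK (a : QSer) : zD (kK a) = 0 := by
  refine zc_ext fun k => ?_
  rw [zc_zD, zc_kK]
  split_ifs with h <;> simp [h]

theorem zD_zT (m : ℤ) : zD (zT m) = (m : BiSeries) * zT m := by
  refine zc_ext fun k => ?_
  rw [zc_zD, zc_zT, ← map_intCast kK, zc_kK_mul, zc_zT]
  split_ifs with h <;> simp [h]

theorem zD_qD (f : BiSeries) : zD (qD f) = qD (zD f) := by
  refine zc_ext fun k => ?_
  rw [zc_zD, zc_qD, zc_qD, zc_zD, Derivation.leibniz]
  simp

/-- The substitution `z = 1`. -/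
noncomputable def ev : BiSeries →+* QSer :=
  PowerSeries.map (LaurentPolynomial.eval₂ (RingHom.id ℚ) 1)

@[simp] theorem ev_kK (a : QSer) : ev (kK a) = a := by
  ext n
  simp [ev, kK]

@[simp] theorem ev_zT (m : ℤ) : ev (zT m) = 1 := by
  simp [ev, zT]

theorem ev_qD (f : BiSeries) : ev (qD f) = qD (ev f) := by
  ext n
  simp [ev, coeff_qD]

theorem ConvTo.ev {s : ℕ → BiSeries} {f : BiSeries} (hf : ConvTo s f) :
    ConvTo (fun N => ev (s N)) (ev f) := hf.map _

/-- The substitution of `z⁻¹` for `z`. -/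
noncomputable def zInv : BiSeries →+* BiSeries :=
  PowerSeries.map (LaurentPolynomial.invert : LaurentPolynomial ℚ ≃ₐ[ℚ] _).toAlgHom.toRingHom

theorem zc_zInv (k : ℤ) (f : BiSeries) : zc k (zInv f) = zc (-k) f := by
  ext n
  rw [coeff_zc, coeff_zc, zInv, coeff_map]
  exact LaurentPolynomial.invert_apply _ _

@[simp] theorem zInv_kK (a : QSer) : zInv (kK a) = kK a := by
  refine zc_ext fun k => ?_
  simp [zc_zInv, zc_kK]

@[simp] theorem zInv_zT (m : ℤ) : zInv (zT m) = zT (-m) := by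
  refine zc_ext fun k => ?_
  simp [zc_zInv, zc_zT, neg_eq_iff_eq_neg]

theorem ConvTo.zInv {s : ℕ → BiSeries} {f : BiSeries} (hf : ConvTo s f) :
    ConvTo (fun N => zInv (s N)) (zInv f) := hf.map _

@[simp] theorem zInv_X : zInv X = X := by simp [zInv]

theorem zInv_zD (f : BiSeries) : zInv (zD f) = - zD (zInv f) := by
  refine zc_ext fun k => ?_
  rw [zc_zInv, zc_zD, map_neg, zc_zD, zc_zInv]
  push_cast; ring

theorem zInv_qD (f : BiSeries) : zInv (qD f) = qD (zInv f) := by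
  refine zc_ext fun k => ?_
  rw [zc_zInv, zc_qD, zc_qD, zc_zInv]

/-! ### Locally finite sums and the action of `BiSeries` on coefficient sequences -/

/-- Only finitely many members of the family contribute to each coefficient. -/
def LocFin (a : ℤ → QSer) : Prop := ∀ n, {j | coeff n (a j) ≠ 0}.Finite

/-- The sum of a locally finite family. -/
noncomputable def fsum (a : ℤ → QSer) : QSer := mk fun n => ∑ᶠ j, coeff n (a j)

theorem coeff_fsum (a : ℤ → QSer) (n : ℕ) : coeff n (fsum a) = ∑ᶠ j, coeff n (a j) := by
  simp [fsum]

theorem fsum_comp_equiv (a : ℤ → QSer) (e : ℤ ≃ ℤ) : fsum (fun j => a (e j)) = fsum a := by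
  ext n
  rw [coeff_fsum, coeff_fsum]
  exact finsum_comp_equiv e (f := fun j => coeff n (a j))

theorem fsum_add {a b : ℤ → QSer} (ha : LocFin a) (hb : LocFin b) :
    fsum (fun j => a j + b j) = fsum a + fsum b := by
  ext n
  simp only [map_add, coeff_fsum]
  exact finsum_add_distrib (ha n) (hb n)

theorem LocFin.mul_left {a : ℤ → QSer} (ha : LocFin a) (c : ℤ → QSer) :
    LocFin fun j => c j * a j := fun n => by
  refine ((Finset.range (n + 1)).finite_toSet.biUnion fun i _ => ha i).subset fun j hj => ?_
  rw [Set.mem_ofPred_eq, coeff_mul] at hj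
  obtain ⟨p, hp, hne⟩ := Finset.exists_ne_zero_of_sum_ne_zero hj
  have := Finset.HasAntidiagonal.mem_antidiagonal.1 hp
  exact Set.mem_biUnion (show p.2 ∈ _ by simp; omega) (right_ne_zero_of_mul hne)

theorem LocFin.comp_equiv {a : ℤ → QSer} (ha : LocFin a) (e : ℤ ≃ ℤ) :
    LocFin fun j => a (e j) := fun n => (ha n).preimage e.injective.injOn

theorem fsum_const_mul {a : ℤ → QSer} (ha : LocFin a) (c : QSer) :
    fsum (fun j => c * a j) = c * fsum a := by
  ext n
  rw [coeff_fsum, coeff_mul]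
  simp only [coeff_mul, coeff_fsum]
  rw [finsum_sum_comm]
  · refine Finset.sum_congr rfl fun p _ => ?_
    rw [mul_finsum' _ _ (ha _)]
  · intro p _
    refine (ha p.2).subset fun j hj => ?_
    exact right_ne_zero_of_mul hj

theorem locFin_zc (f : BiSeries) : LocFin fun j => zc j f := fun n => by
  refine ((coeff n f).coeff.support.finite_toSet).subset fun j hj => ?_
  rw [Set.mem_ofPred_eq, coeff_zc] at hj
  simpa using hj

/-- The convolution of a sequence of power series with the `z`-coefficients of `g`. -/
noncomputable def act (f : ℤ → QSer) (g : BiSeries) (k : ℤ) : QSer :=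
  fsum fun j => f j * zc (k - j) g

theorem locFin_act (f : ℤ → QSer) (g : BiSeries) (k : ℤ) :
    LocFin fun j => f j * zc (k - j) g :=
  ((locFin_zc g).comp_equiv (Equiv.subLeft k)).mul_left f

theorem act_add_right (f : ℤ → QSer) (g h : BiSeries) (k : ℤ) :
    act f (g + h) k = act f g k + act f h k := by
  rw [act, act, act, ← fsum_add (locFin_act f g k) (locFin_act f h k)]
  simp only [map_add, mul_add]

theorem act_add_left (f f' : ℤ → QSer) (g : BiSeries) (k : ℤ) :
    act (fun j => f j + f' j) g k = act f g k + act f' g k := by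
  rw [act, act, act, ← fsum_add (locFin_act f g k) (locFin_act f' g k)]
  simp only [add_mul]

theorem act_const_mul_left (c : QSer) (f : ℤ → QSer) (g : BiSeries) (k : ℤ) :
    act (fun j => c * f j) g k = c * act f g k := by
  rw [act, act, ← fsum_const_mul (locFin_act f g k)]
  simp only [mul_assoc]

theorem act_kK_mul (c : QSer) (f : ℤ → QSer) (g : BiSeries) (k : ℤ) :
    act f (kK c * g) k = c * act f g k := by
  rw [act, act, ← fsum_const_mul (locFin_act f g k)]
  simp only [zc_kK_mul, mul_left_comm]

theorem act_zT_mul (m : ℤ) (f : ℤ → QSer) (g : BiSeries) (k : ℤ) :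
    act f (zT m * g) k = act f g (k - m) := by
  rw [act, act]
  simp only [zc_zT_mul, sub_right_comm]

theorem act_shift (m : ℤ) (f : ℤ → QSer) (g : BiSeries) (k : ℤ) :
    act (fun j => f (j - m)) g k = act f g (k - m) := by
  rw [act, act, ← fsum_comp_equiv (fun j => f j * zc (k - m - j) g) (Equiv.subRight m)]
  simp only [Equiv.subRight_apply, sub_sub_sub_cancel_right]

theorem zc_mul (k : ℤ) (f g : BiSeries) : zc k (f * g) = act (fun j => zc j f) g k := by
  ext n
  rw [act, coeff_fsum, coeff_zc, coeff_mul, AddMonoidAlgebra.coeff_sum, Finset.sum_apply']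
  simp only [coeff_mul]
  rw [finsum_sum_comm]
  · refine Finset.sum_congr rfl fun p _ => ?_
    rw [AddMonoidAlgebra.coeff_mul,
      finsum_eq_sum_of_support_subset (s := (coeff p.1 f).coeff.support)]
    · rw [Finsupp.sum]
      refine Finset.sum_congr rfl fun j _ => ?_
      rw [coeff_zc, coeff_zc, Finsupp.sum]
      rw [Finset.sum_eq_single (k - j)]
      · simp
      · intro b _ hb
        rw [if_neg]; omega
      · intro h; simp only [Finsupp.mem_support_iff, not_not] at h; simp [h]
    · intro j hj
      rw [Function.mem_support, coeff_zc, coeff_zc] at hj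
      simpa using left_ne_zero_of_mul hj
  · intro p _
    refine (locFin_zc f p.1).subset fun j hj => ?_
    exact left_ne_zero_of_mul hj

/-! ### Reflection symmetries -/

/-- The functional equation `q ^ (a i - b) * f i = f (e - i)`, with denominators cleared. -/
def Refl (f : ℤ → QSer) (a b e : ℤ) : Prop :=
  ∀ (i : ℤ) (m p : ℕ), (m : ℤ) - p = a * i - b → X ^ p * f (e - i) = X ^ m * f i

/-- The map i ↦ e - i negates a i - b when a e = 2 b, so a negative exponent at i is a positive one
at e - i. -/
theorem refl_of_nonneg {f : ℤ → QSer} {a b e : ℤ} (hab : a * e = 2 * b)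
    (h : ∀ (i : ℤ) (m : ℕ), (m : ℤ) = a * i - b → f (e - i) = X ^ m * f i) : Refl f a b e := by
  intro i m p hmp
  rcases le_total p m with hle | hle
  · obtain ⟨d, rfl⟩ := Nat.exists_eq_add_of_le hle
    rw [h i d (by push_cast at hmp; linarith), pow_add]; ring
  · obtain ⟨d, rfl⟩ := Nat.exists_eq_add_of_le hle
    have := h (e - i) d (by push_cast at hmp; rw [mul_sub]; linarith)
    rw [sub_sub_cancel] at this
    rw [this, pow_add]; ring

/-- In terms of functions, g is invariant under z ↦ q^a/z and f is so up to a monomial, hence f g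
carries the same monomial as f. On coefficients, reindex the convolution by j ↦ e - j. -/
theorem Refl.act {f : ℤ → QSer} {g : BiSeries} {a b e : ℤ} (hf : Refl f a b e)
    (hg : Refl (fun k => zc k g) a 0 0) : Refl (act f g) a b e := by
  intro k m p hmp
  rw [OverpartitionMoments.act, OverpartitionMoments.act,
    ← fsum_comp_equiv _ (Equiv.subLeft e),
    ← fsum_const_mul, ← fsum_const_mul (locFin_act f g k)]
  · congr 1
    funext j
    simp only [Equiv.subLeft_apply]
    have h1 := hf j (a * j - b).toNat (-(a * j - b)).toNat (by omega)
    have h2 := hg (k - j) (a * (k - j)).toNat (-(a * (k - j))).toNat (by omega)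
    -- The exponents add up, (a j - b) + a (k - j) = a k - b; each of them is split into positive
    -- and negative parts to stay within natural powers of q.
    have hexp : p + ((a * j - b).toNat + (a * (k - j)).toNat) =
        m + ((-(a * j - b)).toNat + (-(a * (k - j))).toNat) := by
      have : a * (k - j) = a * k - a * j := by ring
      omega
    have hne : (X : QSer) ^ ((-(a * j - b)).toNat + (-(a * (k - j))).toNat) ≠ 0 :=
      pow_ne_zero _ X_ne_zero
    apply mul_left_cancel₀ hne
    simp only [zero_sub, neg_sub] at h2
    rw [show e - k - (e - j) = j - k by ring]
    generalize (-(a * j - b)).toNat = p1 at *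
    generalize (-(a * (k - j))).toNat = p2 at *
    generalize (a * j - b).toNat = m1 at *
    generalize (a * (k - j)).toNat = m2 at *
    calc X ^ (p1 + p2) * (X ^ p * (f (e - j) * zc (j - k) g))
        = X ^ p * ((X ^ p1 * f (e - j)) * (X ^ p2 * zc (j - k) g)) := by ring
      _ = X ^ p * ((X ^ m1 * f j) * (X ^ m2 * zc (k - j) g)) := by rw [h1, h2]
      _ = X ^ (p + (m1 + m2)) * (f j * zc (k - j) g) := by ring
      _ = _ := by rw [hexp]; ring
  · exact (locFin_act f g (e - k)).comp_equiv (Equiv.subLeft e)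

theorem Refl.mul {f g : BiSeries} {a : ℤ} (hf : Refl (fun k => zc k f) a 0 0)
    (hg : Refl (fun k => zc k g) a 0 0) : Refl (fun k => zc k (f * g)) a 0 0 := by
  have := hf.act hg
  intro i m p h
  simpa only [zc_mul] using this i m p h

theorem Refl.limit {s : ℕ → BiSeries} {f : BiSeries} (hs : ConvTo s f) {a b e : ℤ}
    (h : ∀ N, Refl (fun k => zc k (s N)) a b e) : Refl (fun k => zc k f) a b e := by
  intro i m p hmp
  refine ConvTo.unique ((ConvTo.const (X ^ p)).mul (hs.zc (e - i))) ?_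
  simp only [fun N => h N i m p hmp]
  exact (ConvTo.const (X ^ m)).mul (hs.zc i)

/-! ### Theta products -/

/-- The partial products of `∏ (1 - c z q ^ (s i)) (1 - c z⁻¹ q ^ (s i))`, `i ≥ 1`. -/
noncomputable def thetaPartial (c : ℚ) (s N : ℕ) : BiSeries :=
  ∏ i ∈ Finset.range N, ((1 - kK (C c) * zT 1 * X ^ (s * (i + 1))) *
    (1 - kK (C c) * zT (-1) * X ^ (s * (i + 1))))

theorem exists_convTo_thetaPartial (c : ℚ) {s : ℕ} (hs : 0 < s) :
    ∃ f, ConvTo (thetaPartial c s) f := by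
  refine exists_convTo fun M => ?_
  filter_upwards [eventually_ge_atTop M] with N hN
  have h : (X : BiSeries) ^ M ∣ X ^ (s * (N + 1)) := pow_dvd_pow _ (by nlinarith)
  obtain ⟨d, hd⟩ := h
  rw [thetaPartial, Finset.prod_range_succ, ← thetaPartial, hd]
  refine ⟨thetaPartial c s N * (-(kK (C c) * zT 1 * d) - kK (C c) * zT (-1) * d
    + (kK (C c) * zT 1 * d) * (kK (C c) * zT (-1) * d) * X ^ M), ?_⟩
  ring

/-- The product `∏ (1 - c z q ^ (s i)) (1 - c z⁻¹ q ^ (s i))` over `i ≥ 1` (for `s ≥ 1`). -/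
noncomputable def thetaProd (c : ℚ) (s : ℕ) : BiSeries :=
  if hs : 0 < s then (exists_convTo_thetaPartial c hs).choose else 1

theorem convTo_thetaProd (c : ℚ) {s : ℕ} (hs : 0 < s) :
    ConvTo (thetaPartial c s) (thetaProd c s) := by
  rw [thetaProd, dif_pos hs]
  exact (exists_convTo_thetaPartial c hs).choose_spec

theorem zInv_thetaPartial (c : ℚ) (s N : ℕ) : zInv (thetaPartial c s N) = thetaPartial c s N := by
  rw [thetaPartial, map_prod]
  refine Finset.prod_congr rfl fun i _ => ?_
  simp only [map_mul, map_sub, map_one, zInv_kK, zInv_zT, map_pow, zInv_X, neg_neg]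
  ring

theorem zInv_thetaProd (c : ℚ) {s : ℕ} (hs : 0 < s) : zInv (thetaProd c s) = thetaProd c s :=
  ConvTo.unique (by simpa only [zInv_thetaPartial] using (convTo_thetaProd c hs).zInv)
    (convTo_thetaProd c hs)

theorem constantCoeff_thetaProd (c : ℚ) {s : ℕ} (hs : 0 < s) :
    constantCoeff (thetaProd c s) = 1 := by
  obtain ⟨N, hN⟩ := (convTo_thetaProd c hs 0).exists
  rw [← coeff_zero_eq_constantCoeff_apply, ← hN, coeff_zero_eq_constantCoeff_apply, thetaPartial,
    map_prod]
  refine Finset.prod_eq_one fun i _ => ?_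
  have : s * (i + 1) ≠ 0 := by positivity
  simp [this]

theorem ev_thetaProd_ne_zero (c : ℚ) {s : ℕ} (hs : 0 < s) : ev (thetaProd c s) ≠ 0 := by
  intro h
  have h1 : constantCoeff (ev (thetaProd c s)) = 1 := by
    rw [ev, ← coeff_zero_eq_constantCoeff_apply, coeff_map, coeff_zero_eq_constantCoeff_apply,
      constantCoeff_thetaProd c hs, map_one]
  rw [h] at h1
  simp at h1

/-- The theta function `∏ (1 - c z q ^ (s i)) (1 - c z⁻¹ q ^ (s (i + 1)))`, `i ≥ 0`. -/
noncomputable def theta (c : ℚ) (s : ℕ) : BiSeries := (1 - kK (C c) * zT 1) * thetaProd c s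

/-- The substitution z ↦ q^s/z exchanges the two linear factors. -/
theorem refl_theta_factor (c : ℚ) (s i : ℕ) :
    Refl (fun k => zc k ((1 - kK (C c) * zT 1 * X ^ (s * i)) *
      (1 - kK (C c) * zT (-1) * X ^ (s * (i + 1))))) s 0 0 := by
  have h : ((1 - kK (C c) * zT 1 * X ^ (s * i)) * (1 - kK (C c) * zT (-1) * X ^ (s * (i + 1)))) =
      kK (1 + C c ^ 2 * X ^ (s * (2 * i + 1))) - kK (C c * X ^ (s * i)) * zT 1 -
        kK (C c * X ^ (s * (i + 1))) * zT (-1) := by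
    have h2 : zT 1 * zT (-1) = 1 := by rw [← zT_add]; simp
    simp only [map_add, map_mul, map_one, map_pow, kK_X]
    linear_combination kK (C c) ^ 2 * X ^ (s * i) * X ^ (s * (i + 1)) * h2
  rw [h]
  refine refl_of_nonneg (by ring) fun j m hm => ?_
  simp only [map_sub, zc_kK, zc_kK_mul, zc_zT]
  rcases eq_or_ne j 0 with rfl | h0
  · have : m = 0 := by simpa using hm
    subst this; simp
  rcases eq_or_ne j 1 with rfl | h1
  · have : m = s := by simpa using hm
    subst this
    simp [mul_add, pow_add]; ring
  rcases eq_or_ne j (-1) with rfl | h3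
  · have h4 : m = 0 := by omega
    have h5 : s = 0 := by omega
    subst h4 h5; simp
  · rw [if_neg (by omega), if_neg (by omega), if_neg (by omega), if_neg h0, if_neg h1, if_neg h3]
    simp

/-- Pairing 1 - c z q^(si) with 1 - c q^(s(i+1))/z makes every finite product exactly invariant
under z ↦ q^s/z, and the symmetry passes to the limit. -/
theorem refl_theta (c : ℚ) {s : ℕ} (hs : 0 < s) : Refl (fun k => zc k (theta c s)) s 0 0 := by
  set t : ℕ → BiSeries := fun N => ∏ i ∈ Finset.range N, ((1 - kK (C c) * zT 1 * X ^ (s * i)) *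
      (1 - kK (C c) * zT (-1) * X ^ (s * (i + 1)))) with ht
  -- The two ways of pairing the factors differ by a single factor that tends to 1.
  have h1 : ∀ N, t N * (1 - kK (C c) * zT 1 * X ^ (s * N)) =
      (1 - kK (C c) * zT 1) * thetaPartial c s N := fun N => by
    induction N with
    | zero => simp [ht, thetaPartial]
    | succ N ih =>
      rw [thetaPartial, Finset.prod_range_succ, ← thetaPartial, ← mul_assoc, ← ih]
      simp only [ht, Finset.prod_range_succ]
      ring
  have h2 : ConvTo t (theta c s) := by
    refine ((ConvTo.const _).mul (convTo_thetaProd c hs)).of_dvd_sub fun N => ?_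
    rw [← h1]
    refine (pow_dvd_pow X (show N ≤ s * N by nlinarith)).trans
      ⟨-(t N * kK (C c) * zT 1), ?_⟩
    ring
  refine Refl.limit h2 fun N => ?_
  induction N with
  | zero =>
    refine refl_of_nonneg (by ring) fun j m hm => ?_
    simp only [ht, Finset.range_zero, Finset.prod_empty, zc_one]
    by_cases hj : j = 0
    · subst hj; have : m = 0 := by simpa using hm
      simp [this]
    · rw [if_neg (by omega), if_neg hj, mul_zero]
  | succ N ih =>
    simp only [ht, Finset.prod_range_succ]
    exact ih.mul (refl_theta_factor c s N)

/-- The infinite product is symmetric under z ↦ 1/z, and 1 - c/z = -c z⁻¹ (1 - c z) because c² = 1.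
-/
theorem zc_theta_one_sub {c : ℚ} (hc : c ^ 2 = 1) {s : ℕ} (hs : 0 < s) (k : ℤ) :
    zc (1 - k) (theta c s) = - C c * zc k (theta c s) := by
  have h : zInv (theta c s) = - kK (C c) * (zT (-1) * theta c s) := by
    have h2 : zT (-1) * zT 1 = 1 := by rw [← zT_add]; simp
    have h3 : kK (C c) * kK (C c) = 1 := by rw [← map_mul, ← map_mul, ← sq, hc]; simp
    rw [theta, map_mul, zInv_thetaProd c hs]
    simp only [map_sub, map_one, map_mul, zInv_kK, zInv_zT]
    linear_combination (thetaProd c s) * (- h3 - kK (C c) * kK (C c) * h2 )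
  have h4 := zc_zInv (k - 1) (theta c s)
  rw [h, ← map_neg, zc_kK_mul, zc_zT_mul] at h4
  rw [show 1 - k = -(k - 1) by ring, ← h4]
  simp

/-- Jacobi's triple product identity, up to the constant term. -/
theorem zc_theta_succ {c : ℚ} (hc : c ^ 2 = 1) {s : ℕ} (hs : 0 < s) (k : ℕ) :
    zc (k + 1) (theta c s) = - C c * X ^ (s * k) * zc k (theta c s) := by
  -- Composing the reflections k ↦ 1 - k and k ↦ -k gives a shift by one.
  have h1 := zc_theta_one_sub hc hs (-k)
  have h2 := refl_theta c hs k (s * k) 0 (by push_cast; ring)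
  simp only [pow_zero, one_mul, zero_sub] at h2
  rw [sub_neg_eq_add, add_comm] at h1
  rw [h1, h2]; ring

/-! ### Rank-crank type partial differential equations -/

/-- The second order operator
`(1 - z)² (1 + z) (e² q∂q + (z∂z)²) + 4 z (1 - z) z∂z + 2 z (1 + z)`. -/
noncomputable def heatOp (e : ℕ) (R : BiSeries) : BiSeries :=
  ((e ^ 2 : BiSeries) * qD R + zD (zD R)) - zT 1 * ((e ^ 2 : BiSeries) * qD R + zD (zD R))
    - zT 2 * ((e ^ 2 : BiSeries) * qD R + zD (zD R))
    + zT 3 * ((e ^ 2 : BiSeries) * qD R + zD (zD R))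
    + 4 * (zT 1 * zD R - zT 2 * zD R) + 2 * (zT 1 * R + zT 2 * R)

theorem zc_natCast_mul (k : ℤ) (n : ℕ) (f : BiSeries) : zc k ((n : BiSeries) * f) = n * zc k f := by
  rw [← map_natCast kK, zc_kK_mul]

/-- Here ψ plays the role of (1+z)/(1-z) R, which need not have Laurent polynomial coefficients and
is therefore kept as a sequence. With this reading `heatOp e R` is (1-z)³ (e² q∂q + (z∂z)²) ψ,
whence the binomial coefficients 1, -3, 3, -1. -/
theorem zc_heatOp (e : ℕ) (R : BiSeries) (ψ : ℤ → QSer)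
    (h : ∀ m, ψ m - ψ (m - 1) = zc m R + zc (m - 1) R) (k : ℤ) :
    zc k (heatOp e R) =
      ((e ^ 2 : QSer) * qD (ψ k) + (k : QSer) ^ 2 * ψ k)
      + (-3) * ((e ^ 2 : QSer) * qD (ψ (k - 1)) + ((k - 1 : ℤ) : QSer) ^ 2 * ψ (k - 1))
      + 3 * ((e ^ 2 : QSer) * qD (ψ (k - 2)) + ((k - 2 : ℤ) : QSer) ^ 2 * ψ (k - 2))
      + (-1) * ((e ^ 2 : QSer) * qD (ψ (k - 3)) + ((k - 3 : ℤ) : QSer) ^ 2 * ψ (k - 3)) := by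
  have hE : ∀ j, zc j ((e ^ 2 : BiSeries) * qD R + zD (zD R)) =
      (e ^ 2 : QSer) * qD (zc j R) + (j : QSer) ^ 2 * zc j R := fun j => by
    have := zc_natCast_mul j (e ^ 2) (qD R)
    push_cast at this
    rw [map_add, this, zc_qD, zc_zD, zc_zD]; ring
  have h4 := fun j f => zc_natCast_mul j 4 f
  have h2 := fun j f => zc_natCast_mul j 2 f
  push_cast at h4 h2
  rw [heatOp]
  simp only [map_add, map_sub, h4, h2, zc_zT_mul, hE, zc_zD]
  -- Once everything is written through ψ (k - 3), that term cancels, since third differences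
  -- annihilate quadratic polynomials in k.
  have e1 : ψ (k - 2) = ψ (k - 3) + zc (k - 2) R + zc (k - 3) R := by
    have := h (k - 2); rw [show k - 2 - 1 = k - 3 by ring] at this; linear_combination this
  have e2 : ψ (k - 1) = ψ (k - 2) + zc (k - 1) R + zc (k - 2) R := by
    have := h (k - 1); rw [show k - 1 - 1 = k - 2 by ring] at this; linear_combination this
  have e3 : ψ k = ψ (k - 1) + zc k R + zc (k - 1) R := by linear_combination h k
  rw [e3, e2, e1]
  simp only [map_add]
  push_cast
  ring

/-- Under z ↦ 1/z the function (1+z)/(1-z) changes sign, the operator e² q∂q + (z∂z)² is unchanged,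
and (1-z)³ becomes -z⁻³ (1-z)³; the signs cancel. -/
theorem zInv_heatOp (e : ℕ) {R : BiSeries} (hR : zInv R = R) :
    zInv (heatOp e R) = zT (-3) * heatOp e R := by
  have a1 : zT (-3) * zT 1 = zT (-2) := by rw [← zT_add]; norm_num
  have a2 : zT (-3) * zT 2 = zT (-1) := by rw [← zT_add]; norm_num
  have a3 : zT (-3) * zT 3 = 1 := by rw [← zT_add]; simp
  simp only [heatOp, map_add, map_sub, map_mul, zInv_zT, zInv_qD, zInv_zD, map_pow, map_natCast,
    map_ofNat, hR, map_neg, neg_neg]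
  linear_combination (e ^ 2 * qD R + zD (zD R)) * a1 + (e ^ 2 * qD R + zD (zD R)) * a2
    - (e ^ 2 * qD R + zD (zD R)) * a3 - (4 * zD R + 2 * R) * a1 + (4 * zD R - 2 * R) * a2

/-- The factor (1-z)³ hidden in `heatOp` is moved onto the product, completing it to the cube of the
theta function, whose reflection symmetry is known. -/
theorem zc_heatOp_mul (e s : ℕ) (R : BiSeries) (ψ : ℤ → QSer)
    (h : ∀ m, ψ m - ψ (m - 1) = zc m R + zc (m - 1) R) (k : ℤ) :
    zc k (heatOp e R * thetaProd 1 s ^ 3) =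
      act (fun j => (e ^ 2 : QSer) * qD (ψ j) + (j : QSer) ^ 2 * ψ j) (theta 1 s ^ 3) k := by
  set f : ℤ → QSer := fun j => (e ^ 2 : QSer) * qD (ψ j) + (j : QSer) ^ 2 * ψ j with hf
  have h1 : (fun j => zc j (heatOp e R)) =
      fun j => f j + (-3) * f (j - 1) + 3 * f (j - 2) + (-1) * f (j - 3) := by
    funext j; rw [zc_heatOp e R ψ h]
  have z1 : zT 1 * zT 1 = zT 2 := by rw [← zT_add]; norm_num
  have z2 : zT 1 * zT 2 = zT 3 := by rw [← zT_add]; norm_num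
  have h2 : theta 1 s ^ 3 = thetaProd 1 s ^ 3 + kK (-3) * (zT 1 * thetaProd 1 s ^ 3)
      + kK 3 * (zT 2 * thetaProd 1 s ^ 3) + kK (-1) * (zT 3 * thetaProd 1 s ^ 3) := by
    rw [theta]
    simp only [map_one, map_neg, map_ofNat]
    linear_combination thetaProd 1 s ^ 3 * ((3 - zT 1) * z1 - z2)
  rw [zc_mul, h1, h2]
  simp only [act_add_left, act_add_right, act_const_mul_left, act_kK_mul, act_zT_mul]
  rw [act_shift, act_shift, act_shift]

/-- A series whose partial sums in `z` satisfy the functional equation of an Appell function is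
mapped by the heat operator to a quotient of theta functions. -/
theorem exists_heatOp_mul_eq {s e : ℕ} (hse : s * e = 2) {R : BiSeries} (hR : zInv R = R)
    (ψ : ℤ → QSer) (h : ∀ m, ψ m - ψ (m - 1) = zc m R + zc (m - 1) R)
    (hψ : ∀ m : ℕ, 1 ≤ m → ψ (e - m) = X ^ (s * m - 1) * ψ m + if m = e then 1 else 0) :
    ∃ u v : QSer, v ≠ 0 ∧
      kK v * (heatOp e R * thetaProd 1 s ^ 3) = kK u * (zT 1 * theta (-1) 1) := by
  have hs : 0 < s := by rcases Nat.eq_zero_or_pos s with h0 | h0 <;> [simp [h0] at hse; exact h0]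
  have hseZ : (s : ℤ) * e = 2 := by exact_mod_cast hse
  have hseQ : (s : QSer) * e = 2 := by exact_mod_cast congrArg (Nat.cast (R := QSer)) hse
  set f : ℤ → QSer := fun j => (e ^ 2 : QSer) * qD (ψ j) + (j : QSer) ^ 2 * ψ j with hf
  -- The inhomogeneous term is constant in q and sits at index 0, where the weight j² vanishes, so
  -- both parts of the operator kill it. Differentiating q^(si-1) contributes e² (s i - 1) = 2 e i -
  -- e², which turns (e - i)² into i².
  have hfr : Refl f s 1 e := by
    refine refl_of_nonneg (by linarith) fun i m hm => ?_
    have hi : 1 ≤ i := by nlinarith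
    obtain ⟨i, rfl⟩ := Int.eq_ofNat_of_zero_le (by omega : 0 ≤ i)
    have hi' : 1 ≤ i := by omega
    have hm' : m = s * i - 1 := by zify [show 1 ≤ s * i from Nat.mul_pos hs hi']; linarith
    have hmQ : (m : QSer) + 1 = s * i := by
      have : m + 1 = s * i := by have := Nat.mul_pos hs hi'; omega
      exact_mod_cast congrArg (Nat.cast (R := QSer)) this
    have h0 : (((e : ℤ) - (i : ℤ) : ℤ) : QSer) * (if i = e then 1 else 0) = 0 := by
      split_ifs with hie <;> simp [hie]
    have h1 : qD (if i = e then 1 else 0 : QSer) = 0 := by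
      split_ifs <;> simp
    simp only [hf, hψ i hi', ← hm']
    rw [map_add, h1, Derivation.leibniz, qD_X_pow, smul_eq_mul, smul_eq_mul]
    push_cast at h0 ⊢
    linear_combination ((e : QSer) - i) * h0 + (e ^ 2 : QSer) * X ^ m * ψ i * hmQ +
      (e : QSer) * i * X ^ m * ψ i * hseQ
  set c : ℤ → QSer := fun k => zc k (heatOp e R * thetaProd 1 s ^ 3) with hc
  have hc1 : c = act f (theta 1 s ^ 3) := by
    funext k; exact zc_heatOp_mul e s R ψ h k
  have hcr : Refl c s 1 e := by
    have h1 := refl_theta 1 hs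
    rw [hc1]
    refine hfr.act ?_
    rw [pow_succ, sq]
    exact (h1.mul h1).mul h1
  have hpal : ∀ k, c (3 - k) = c k := fun k => by
    have h1 : zInv (heatOp e R * thetaProd 1 s ^ 3) =
        zT (-3) * (heatOp e R * thetaProd 1 s ^ 3) := by
      rw [map_mul, map_pow, zInv_thetaProd 1 hs, zInv_heatOp e hR, mul_assoc]
    have h2 := zc_zInv (k - 3) (heatOp e R * thetaProd 1 s ^ 3)
    rw [h1, zc_zT_mul] at h2
    simp only [hc]
    rw [show 3 - k = -(k - 3) by ring, ← h2]
    congr 2; ring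
  -- The reflections i ↦ e - i and i ↦ 3 - i compose to a shift by 3 - e. For e = 2 this is already
  -- the recursion; for e = 1 it is a shift by two, and the palindrome c 2 = c 1 starts the
  -- induction.
  have hrec : ∀ k : ℕ, c (k + 2 : ℕ) = X ^ k * c (k + 1 : ℕ) := by
    have hs2 : (s = 1 ∧ e = 2) ∨ (s = 2 ∧ e = 1) := by
      have hle : s ≤ 2 := Nat.le_of_dvd (by norm_num) (Dvd.intro e hse)
      interval_cases s <;> omega
    rcases hs2 with ⟨rfl, rfl⟩ | ⟨rfl, rfl⟩
    · intro k
      have := hcr (k + 1 : ℕ) k 0 (by push_cast; ring)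
      rw [pow_zero, one_mul] at this
      rw [← this, ← hpal]
      congr 1; push_cast; ring
    · intro k
      induction k with
      | zero =>
        rw [pow_zero, one_mul, ← hpal]
        congr 1
      | succ k ih =>
        have := hcr (k + 1 : ℕ) (2 * k + 1) 0 (by push_cast; ring)
        rw [pow_zero, one_mul] at this
        rw [ih, ← hpal, show (3 : ℤ) - ((k + 1 + 2 : ℕ) : ℤ) = ((1 : ℕ) : ℤ) - ((k + 1 : ℕ) : ℤ) by
          push_cast; ring, this]
        ring
  set v : ℤ → QSer := fun k => zc k (theta (-1) 1) with hv
  have hvrec : ∀ k : ℕ, v (k + 1) = X ^ k * v k := fun k => by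
    simp only [hv]
    rw [zc_theta_succ (by norm_num) one_pos]
    simp
  have hvpal : ∀ k, v (1 - k) = v k := fun k => by
    simp only [hv]
    rw [zc_theta_one_sub (by norm_num) one_pos]
    simp
  -- Every coefficient is a multiple of v 1, and theta itself is nonzero: at z = 1 its first factor
  -- is 2.
  have hv1 : v 1 ≠ 0 := by
    intro h0
    have h1 : ∀ k : ℕ, v (k + 1 : ℕ) = 0 := fun k => by
      induction k with
      | zero => exact h0
      | succ k ih =>
        have := hvrec (k + 1)
        rw [ih, mul_zero] at this
        exact_mod_cast this
    have h2 : theta (-1) 1 = 0 := zc_ext fun k => by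
      rw [map_zero]
      change v k = 0
      rcases le_or_gt 1 k with hk | hk
      · obtain ⟨j, hj⟩ := Int.eq_ofNat_of_zero_le (by omega : 0 ≤ k - 1)
        rw [show k = ((j + 1 : ℕ) : ℤ) by push_cast; omega]
        exact h1 j
      · obtain ⟨j, hj⟩ := Int.eq_ofNat_of_zero_le (by omega : 0 ≤ -k)
        rw [← hvpal, show 1 - k = ((j + 1 : ℕ) : ℤ) by push_cast; omega]
        exact h1 j
    have h3 := congrArg ev h2
    rw [theta, map_mul, map_zero] at h3
    refine ev_thetaProd_ne_zero (-1) one_pos ((mul_eq_zero.1 h3).resolve_left ?_)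
    have h4 : ev (1 - kK (C (-1)) * zT 1) = 2 := by
      rw [map_sub, map_mul, ev_kK, ev_zT, map_neg, map_one, map_one]; ring
    rw [h4]
    exact two_ne_zero
  have hprop : ∀ k : ℕ, v 1 * c (k + 1 : ℕ) = c 1 * v k := fun k => by
    induction k with
    | zero =>
      have := hvpal 0
      rw [sub_zero] at this
      simp [this, mul_comm]
    | succ k ih =>
      rw [hrec k]
      have := hvrec k
      push_cast at ih ⊢
      rw [this]
      linear_combination X ^ k * ih
  refine ⟨c 1, v 1, hv1, zc_ext fun k => ?_⟩
  rw [zc_kK_mul, zc_kK_mul, zc_zT_mul]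
  change v 1 * c k = c 1 * v (k - 1)
  rcases le_or_gt 1 k with hk | hk
  · obtain ⟨j, hj⟩ := Int.eq_ofNat_of_zero_le (by omega : 0 ≤ k - 1)
    have := hprop j
    rw [hj]
    convert this using 3
    push_cast; omega
  · obtain ⟨j, hj⟩ := Int.eq_ofNat_of_zero_le (by omega : 0 ≤ 2 - k)
    have := hprop j
    rw [← hpal k, ← hvpal (k - 1)]
    convert this using 3
    · push_cast; omega
    · omega

/-! ### Moments -/

/-- The `j`-th moment `(z∂z) ^ j f` at `z = 1`. -/
noncomputable def mom (j : ℕ) (f : BiSeries) : QSer := ev (zD^[j] f)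

theorem iterate_zD_mul (n : ℕ) (f g : BiSeries) :
    zD^[n] (f * g) = ∑ p ∈ Finset.HasAntidiagonal.antidiagonal n,
      (n.choose p.1 : BiSeries) * (zD^[p.1] f * zD^[p.2] g) := by
  induction n with
  | zero => simp
  | succ n ih =>
    have h := Finset.sum_antidiagonal_choose_succ_mul (R := BiSeries)
      (fun i j => zD^[i] f * zD^[j] g) n
    rw [h, Function.iterate_succ_apply', ih, map_sum, ← Finset.sum_add_distrib]
    refine Finset.sum_congr rfl fun p hp => ?_
    have hp' := Finset.HasAntidiagonal.mem_antidiagonal.1 hp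
    have hch : n.choose p.2 = n.choose p.1 := by
      rw [← hp']; exact (Nat.choose_symm_add).symm
    rw [Derivation.leibniz, Derivation.map_natCast, smul_zero, add_zero, Derivation.leibniz, hch,
      Function.iterate_succ_apply', Function.iterate_succ_apply', smul_eq_mul, smul_eq_mul,
      smul_eq_mul]
    ring

theorem mom_mul (n : ℕ) (f g : BiSeries) :
    mom n (f * g) = ∑ p ∈ Finset.HasAntidiagonal.antidiagonal n,
      (n.choose p.1 : QSer) * (mom p.1 f * mom p.2 g) := by
  simp only [mom, iterate_zD_mul, map_sum, map_mul, map_natCast]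

theorem mom_add (n : ℕ) (f g : BiSeries) : mom n (f + g) = mom n f + mom n g := by
  simp only [mom, iterate_map_add, map_add]

theorem mom_sub (n : ℕ) (f g : BiSeries) : mom n (f - g) = mom n f - mom n g := by
  simp only [mom, iterate_map_sub, map_sub]

theorem mom_neg (n : ℕ) (f : BiSeries) : mom n (-f) = - mom n f := by
  simp only [mom, iterate_map_neg, map_neg]

theorem mom_zD (n : ℕ) (f : BiSeries) : mom n (zD f) = mom (n + 1) f := rfl

theorem iterate_zD_qD (n : ℕ) (f : BiSeries) : zD^[n] (qD f) = qD (zD^[n] f) := by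
  induction n with
  | zero => rfl
  | succ n ih => rw [Function.iterate_succ_apply', ih, zD_qD, Function.iterate_succ_apply']

theorem mom_qD (n : ℕ) (f : BiSeries) : mom n (qD f) = qD (mom n f) := by
  rw [mom, iterate_zD_qD, ev_qD, mom]

theorem iterate_zD_kK_mul (n : ℕ) (a : QSer) (f : BiSeries) :
    zD^[n] (kK a * f) = kK a * zD^[n] f := by
  induction n with
  | zero => rfl
  | succ n ih =>
    rw [Function.iterate_succ_apply', ih, Derivation.leibniz, zD_kK, smul_zero, add_zero,
      smul_eq_mul, Function.iterate_succ_apply']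

theorem mom_kK_mul (n : ℕ) (a : QSer) (f : BiSeries) : mom n (kK a * f) = a * mom n f := by
  rw [mom, iterate_zD_kK_mul, map_mul, ev_kK, mom]

theorem mom_natCast_mul (n m : ℕ) (f : BiSeries) : mom n ((m : BiSeries) * f) = m * mom n f := by
  rw [← map_natCast kK, mom_kK_mul]

theorem mom_zT (n : ℕ) (m : ℤ) : mom n (zT m) = (m : QSer) ^ n := by
  have : zD^[n] (zT m) = kK (m ^ n) * zT m := by
    induction n with
    | zero => simp
    | succ n ih =>
      rw [Function.iterate_succ_apply', ih, Derivation.leibniz, zD_kK, zD_zT]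
      simp [pow_succ]; ring
  rw [mom, this]; simp

theorem mom_zero (f : BiSeries) : mom 0 f = ev f := rfl

theorem ev_zInv (f : BiSeries) : ev (zInv f) = ev f := by
  have : ev.comp zInv = ev := by
    have h : (LaurentPolynomial.eval₂ (RingHom.id ℚ) 1).comp
        (LaurentPolynomial.invert : LaurentPolynomial ℚ ≃ₐ[ℚ] _).toAlgHom.toRingHom =
        LaurentPolynomial.eval₂ (RingHom.id ℚ) 1 := by
      refine RingHom.ext fun p => ?_
      induction p using LaurentPolynomial.induction_on' with
      | add p q hp hq => simp only [map_add, hp, hq]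
      | C_mul_T n a => simp
    ext f n
    simp only [ev, zInv, RingHom.comp_apply, coeff_map]
    exact RingHom.congr_fun h _
  exact RingHom.congr_fun this f

theorem iterate_zInv_zD (n : ℕ) (f : BiSeries) :
    zInv (zD^[n] f) = (-1) ^ n * zD^[n] (zInv f) := by
  induction n with
  | zero => simp
  | succ n ih =>
    rw [Function.iterate_succ_apply', zInv_zD, ih, Function.iterate_succ_apply', Derivation.leibniz]
    have : zD ((-1 : BiSeries) ^ n) = 0 := by simp [Derivation.leibniz_pow]
    rw [this, pow_succ]; simp

/-- The involution z ↦ 1/z fixes z = 1 and anticommutes with z∂z. -/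
theorem mom_odd {f : BiSeries} (hf : zInv f = f) {n : ℕ} (hn : Odd n) : mom n f = 0 := by
  have h := congrArg ev (iterate_zInv_zD n f)
  rw [hf, hn.neg_one_pow, ev_zInv] at h
  change mom n f = _ at h
  simp only [map_mul, map_neg, map_one] at h
  change mom n f = -1 * mom n f at h
  have h2 : (2 : QSer) * mom n f = 0 := by linear_combination h
  exact (mul_eq_zero.1 h2).resolve_left two_ne_zero

theorem ConvTo.iterate_zD {s : ℕ → BiSeries} {f : BiSeries} (hf : ConvTo s f) (n : ℕ) :
    ConvTo (fun N => OverpartitionMoments.zD^[n] (s N)) (OverpartitionMoments.zD^[n] f) := by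
  induction n with
  | zero => exact hf
  | succ n ih =>
    simp only [Function.iterate_succ_apply']
    exact ih.zD

theorem ConvTo.mom {s : ℕ → BiSeries} {f : BiSeries} (hf : ConvTo s f) (n : ℕ) :
    ConvTo (fun N => mom n (s N)) (mom n f) := (hf.iterate_zD n).ev

/-- The moments of a series with given logarithmic derivative. -/
theorem mom_of_zD_eq_mul {F G : BiSeries} (h : zD F = F * G)
    (h0 : mom 0 G = 0) (h2 : mom 2 G = 0) (h4 : mom 4 G = 0) :
    mom 1 F = 0 ∧ mom 3 F = 0 ∧ mom 5 F = 0 ∧ mom 2 F = ev F * mom 1 G ∧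
      mom 4 F = ev F * (mom 3 G + 3 * mom 1 G ^ 2) ∧
      mom 6 F = ev F * (mom 5 G + 15 * mom 1 G * mom 3 G + 15 * mom 1 G ^ 3) := by
  have hs : ∀ n, mom (n + 1) F =
      ∑ p ∈ Finset.HasAntidiagonal.antidiagonal n,
        (n.choose p.1 : QSer) * (mom p.1 F * mom p.2 G) := fun n => by
    rw [← mom_zD, h, mom_mul]
  have e1 : mom 1 F = 0 := by rw [hs 0]; simp [h0]
  have e2 : mom 2 F = ev F * mom 1 G := by
    rw [hs 1]; simp [Finset.Nat.antidiagonal_succ, h0, mom_zero]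
  have e3 : mom 3 F = 0 := by
    rw [hs 2]; simp [Finset.Nat.antidiagonal_succ, h0, h2, e1]
  have e4 : mom 4 F = ev F * (mom 3 G + 3 * mom 1 G ^ 2) := by
    rw [hs 3]; simp [Finset.Nat.antidiagonal_succ, h0, h2, e1, e2, mom_zero, Nat.choose]; ring
  have e5 : mom 5 F = 0 := by
    rw [hs 4]; simp [Finset.Nat.antidiagonal_succ, h0, h2, h4, e1, e3]
  have e6 : mom 6 F = ev F * (mom 5 G + 15 * mom 1 G * mom 3 G + 15 * mom 1 G ^ 3) := by
    rw [hs 5]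
    simp [Finset.Nat.antidiagonal_succ, h0, h2, h4, e1, e2, e3, e4, mom_zero, Nat.choose]; ring
  exact ⟨e1, e3, e5, e2, e4, e6⟩

/-! ### Logarithmic derivatives of theta products -/

/-- The geometric series `∑ c ^ m z ^ (ε m) q ^ (d m)`, `m ≥ 1`. -/
noncomputable def zGeom (c : ℚ) (ε : ℤ) (d : ℕ) : BiSeries :=
  mk fun n => if n ≠ 0 ∧ d ∣ n then LaurentPolynomial.C (c ^ (n / d)) * T (ε * (n / d : ℕ)) else 0

theorem one_sub_mul_zGeom (c : ℚ) (ε : ℤ) {d : ℕ} (hd : 0 < d) :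
    (1 - kK (C c) * zT ε * X ^ d) * zGeom c ε d = kK (C c) * zT ε * X ^ d := by
  have hk : kK (C c) * zT ε = PowerSeries.C (LaurentPolynomial.C c * T ε) := by
    simp [kK, zT]
  rw [sub_mul, one_mul, sub_eq_iff_eq_add, hk, mul_assoc]
  ext1 n
  rw [map_add, coeff_C_mul, coeff_C_mul, coeff_X_pow, coeff_X_pow_mul', zGeom, coeff_mk]
  rcases lt_trichotomy n d with h | h | h
  · rw [if_neg (fun h1 => absurd (Nat.le_of_dvd (Nat.pos_of_ne_zero h1.1) h1.2) (by omega)),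
      if_neg h.ne, if_neg (by omega)]
    simp
  · subst h
    simp [hd.ne', Nat.div_self hd]
  · rw [if_neg h.ne', if_pos h.le, coeff_mk]
    obtain ⟨m, rfl⟩ := Nat.exists_eq_add_of_lt h
    have h3 : d + m + 1 - d = m + 1 := by omega
    rw [h3]
    by_cases hdm : d ∣ m + 1
    · obtain ⟨a, ha⟩ := hdm
      have h4 : d + m + 1 = d * (a + 1) := by rw [mul_add, ← ha]; ring
      rw [h4, ha, Nat.mul_div_cancel_left _ hd, Nat.mul_div_cancel_left _ hd, if_pos, if_pos]
      · push_cast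
        rw [mul_add, LaurentPolynomial.T_add, pow_succ, map_mul, mul_one]
        ring
      · exact ⟨by omega, dvd_mul_right _ _⟩
      · exact ⟨by positivity, dvd_mul_right _ _⟩
    · rw [if_neg, if_neg]
      · simp
      · exact fun h => hdm h.2
      · exact fun h => hdm ((Nat.dvd_add_right (dvd_refl d)).1 (by rw [← add_assoc]; exact h.2))

theorem mom_zGeom (c : ℚ) (ε : ℤ) (d j : ℕ) :
    mom j (zGeom c ε d) =
      mk fun n => if n ≠ 0 ∧ d ∣ n then c ^ (n / d) * ((ε : ℚ) * (n / d : ℕ)) ^ j else 0 := by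
  have h : ∀ n, coeff n (zD^[j] (zGeom c ε d)) = if n ≠ 0 ∧ d ∣ n then
      LaurentPolynomial.C (c ^ (n / d) * ((ε : ℚ) * (n / d : ℕ)) ^ j) * T (ε * (n / d : ℕ))
      else 0 := fun n => by
    induction j with
    | zero => simp [zGeom]
    | succ j ih =>
      rw [Function.iterate_succ_apply', coeff_zD, ih]
      split_ifs
      · rw [← LaurentPolynomial.smul_eq_C_mul, map_smul, lauD_T, smul_smul,
          ← LaurentPolynomial.smul_eq_C_mul, Int.cast_mul, Int.cast_natCast, pow_succ, mul_assoc]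
      · simp
  ext n
  rw [mom, ev, coeff_map, h, coeff_mk]
  split_ifs
  · have : LaurentPolynomial.eval₂ (RingHom.id ℚ) 1 (T (ε * (n / d : ℕ))) = 1 := by simp
    rw [map_mul, this]
    simp
  · simp

/-- The Lambert series `∑ c ^ m m ^ j q ^ (s i m)`, `i, m ≥ 1`. -/
noncomputable def lambert (c : ℚ) (s j : ℕ) : QSer :=
  mk fun n => ∑ d ∈ n.divisors with s ∣ d, c ^ (n / d) * ((n / d : ℕ) : ℚ) ^ j

/-- Differentiate the product logarithmically: 1 - c z^ε q^d contributes -ε times a geometric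
series. Its j-th moment carries ε^j, so the factors with ε = 1 and ε = -1 cancel for even j and
double for odd j. -/
theorem exists_zD_thetaProd (c : ℚ) {s : ℕ} (hs : 0 < s) :
    ∃ Λ, zD (thetaProd c s) = thetaProd c s * Λ ∧
      ∀ j, mom j Λ = ((-1) ^ j - 1) * lambert c s j := by
  set L : ℕ → BiSeries := fun N => ∑ i ∈ Finset.range N,
    (zGeom c (-1) (s * (i + 1)) - zGeom c 1 (s * (i + 1))) with hL
  have hdvd : ∀ ε d, X ^ d ∣ zGeom c ε d := fun ε d => by
    rw [X_pow_dvd_iff]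
    intro m hm
    rw [zGeom, coeff_mk, if_neg]
    exact fun h => absurd (Nat.le_of_dvd (Nat.pos_of_ne_zero h.1) h.2) (by omega)
  obtain ⟨Λ, hΛ⟩ := exists_convTo (s := L) fun M => by
    filter_upwards [eventually_ge_atTop M] with N hN
    simp only [hL]
    rw [Finset.sum_range_succ, add_sub_cancel_left]
    have h : (X : BiSeries) ^ M ∣ X ^ (s * (N + 1)) := pow_dvd_pow _ (by nlinarith)
    exact dvd_sub (h.trans (hdvd _ _)) (h.trans (hdvd _ _))
  refine ⟨Λ, ?_, fun j => ?_⟩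
  · refine ConvTo.unique (convTo_thetaProd c hs).zD ?_
    have : ∀ N, zD (thetaPartial c s N) = thetaPartial c s N * L N := fun N => by
      induction N with
      | zero => simp [thetaPartial, hL]
      | succ N ih =>
        have h1 := one_sub_mul_zGeom c 1 (d := s * (N + 1)) (by positivity)
        have h2 := one_sub_mul_zGeom c (-1) (d := s * (N + 1)) (by positivity)
        rw [thetaPartial, Finset.prod_range_succ, ← thetaPartial]
        have h0 : L (N + 1) = L N + (zGeom c (-1) (s * (N + 1)) - zGeom c 1 (s * (N + 1))) :=
          Finset.sum_range_succ _ _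
        rw [h0]
        have h3 : ∀ ε : ℤ, zD (1 - kK (C c) * zT ε * X ^ (s * (N + 1))) =
            - ((ε : BiSeries) * (kK (C c) * zT ε * X ^ (s * (N + 1)))) := fun ε => by
          have h4 : zD ((X : BiSeries) ^ (s * (N + 1))) = 0 := by
            rw [← kK_X, ← map_pow, zD_kK]
          rw [map_sub, Derivation.leibniz, Derivation.leibniz, zD_kK, zD_zT, h4]
          simp; ring
        rw [Derivation.leibniz, ih, Derivation.leibniz, h3, h3]
        simp only [smul_eq_mul]
        push_cast
        linear_combination thetaPartial c s N * (-(1 - kK (C c) * zT 1 * X ^ (s * (N + 1))) * h2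
          + (1 - kK (C c) * zT (-1) * X ^ (s * (N + 1))) * h1)
    simp only [this]
    exact (convTo_thetaProd c hs).mul hΛ
  · refine ConvTo.unique (hΛ.mom j) fun n => ?_
    filter_upwards [eventually_ge_atTop n] with N hN
    have h1 : mom j (L N) = ∑ i ∈ Finset.range N,
        (mom j (zGeom c (-1) (s * (i + 1))) - mom j (zGeom c 1 (s * (i + 1)))) := by
      clear hN
      induction N with
      | zero => simp [hL, mom]
      | succ N ih =>
        rw [Finset.sum_range_succ, ← ih, ← mom_sub, ← mom_add]
        exact congrArg _ (Finset.sum_range_succ _ _)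
    have h2 : ((-1 : QSer) ^ j - 1) = C ((-1) ^ j - 1) := by simp
    rw [h1, h2, coeff_C_mul, lambert, coeff_mk, map_sum, Finset.mul_sum]
    symm
    rcases Nat.eq_zero_or_pos n with rfl | hn
    · simp [mom_zGeom]
    rw [← Finset.sum_filter_add_sum_filter_not (Finset.range N) (fun i => s * (i + 1) ∣ n),
      Finset.sum_eq_zero (s := (Finset.range N).filter fun i => ¬ s * (i + 1) ∣ n), add_zero]
    -- The factors that contribute to q^n are indexed by the divisors of n that are multiples of s.
    · refine (Finset.sum_nbij' (fun i => s * (i + 1)) (fun d => d / s - 1) ?_ ?_ ?_ ?_ ?_).symm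
      · intro i hi
        simp only [Finset.mem_filter, Nat.mem_divisors] at hi ⊢
        exact ⟨⟨hi.2, hn.ne'⟩, dvd_mul_right _ _⟩
      · intro d hd
        simp only [Finset.mem_filter, Nat.mem_divisors, Finset.mem_range] at hd ⊢
        obtain ⟨⟨h3, h4⟩, a, rfl⟩ := hd
        rw [Nat.mul_div_cancel_left _ hs]
        have h5 := Nat.le_of_dvd hn h3
        have h6 : a ≠ 0 := by rintro rfl; simp at h3; omega
        have h7 : a ≤ s * a := Nat.le_mul_of_pos_left a hs
        rw [Nat.sub_add_cancel (by omega)]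
        exact ⟨by omega, h3⟩
      · intro i _
        rw [Nat.mul_div_cancel_left _ hs]; omega
      · intro d hd
        simp only [Finset.mem_filter, Nat.mem_divisors] at hd
        obtain ⟨⟨h3, h4⟩, a, rfl⟩ := hd
        have h6 : a ≠ 0 := by rintro rfl; simp at h3; omega
        rw [Nat.mul_div_cancel_left _ hs, Nat.sub_add_cancel (by omega)]
      · intro i hi
        simp only [Finset.mem_filter] at hi
        rw [map_sub, mom_zGeom, mom_zGeom, coeff_mk, coeff_mk, if_pos ⟨hn.ne', hi.2⟩,
          if_pos ⟨hn.ne', hi.2⟩]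
        push_cast
        rw [one_mul, mul_pow]
        ring
    · intro i hi
      simp only [Finset.mem_filter] at hi
      rw [map_sub, mom_zGeom, mom_zGeom, coeff_mk, coeff_mk, if_neg fun h => hi.2 h.2,
        if_neg fun h => hi.2 h.2, sub_zero]

/-- Write (-1)^m = 2 [m even] - 1. For even m dividing n, the number d = 2 n / m is again an even
divisor and m = 2 (n / d), which produces the power of 2. -/
theorem lambert_neg_one (j : ℕ) :
    lambert (-1) 1 j = 2 ^ (j + 1) * lambert 1 2 j - lambert 1 1 j := by
  have h2 : (2 : QSer) ^ (j + 1) = C (2 ^ (j + 1)) := by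
    rw [map_pow, map_ofNat]
  ext n
  rw [h2, map_sub, coeff_C_mul]
  simp only [lambert, coeff_mk, one_dvd, Finset.filter_true, one_pow, one_mul]
  rcases Nat.eq_zero_or_pos n with rfl | hn
  · simp
  have hsw : ∀ f : ℕ → ℚ, ∑ d ∈ n.divisors, f (n / d) = ∑ d ∈ n.divisors, f d := fun f =>
    Nat.sum_div_divisors n f
  rw [hsw (fun m => (-1) ^ m * (m : ℚ) ^ j), hsw (fun m => (m : ℚ) ^ j)]
  have h3 : ∑ d ∈ n.divisors with 2 ∣ d, ((n / d : ℕ) : ℚ) ^ j * 2 ^ j =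
      ∑ m ∈ n.divisors with 2 ∣ m, (m : ℚ) ^ j := by
    refine Finset.sum_nbij' (fun d => 2 * (n / d)) (fun m => n / (m / 2)) ?_ ?_ ?_ ?_ ?_
    · intro d hd
      simp only [Finset.mem_filter, Nat.mem_divisors] at hd ⊢
      obtain ⟨⟨⟨b, rfl⟩, h0⟩, a, rfl⟩ := hd
      have ha : 0 < 2 * a := Nat.pos_of_ne_zero (left_ne_zero_of_mul h0)
      rw [Nat.mul_div_cancel_left _ ha]
      exact ⟨⟨⟨a, by ring⟩, h0⟩, dvd_mul_right _ _⟩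
    · intro m hm
      simp only [Finset.mem_filter, Nat.mem_divisors] at hm ⊢
      obtain ⟨⟨⟨b, rfl⟩, h0⟩, a, rfl⟩ := hm
      have ha : 0 < a := by
        rcases Nat.eq_zero_or_pos a with rfl | h
        · simp at h0
        · exact h
      rw [Nat.mul_div_cancel_left _ two_pos, show 2 * a * b = a * (2 * b) by ring,
        Nat.mul_div_cancel_left _ ha]
      exact ⟨⟨⟨a, by ring⟩, by rwa [show a * (2 * b) = 2 * a * b by ring]⟩, dvd_mul_right _ _⟩
    · intro d hd
      simp only [Finset.mem_filter, Nat.mem_divisors] at hd ⊢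
      rw [Nat.mul_div_cancel_left _ two_pos]
      exact Nat.div_div_self hd.1.1 hd.1.2
    · intro m hm
      simp only [Finset.mem_filter, Nat.mem_divisors] at hm ⊢
      obtain ⟨⟨h1, h0⟩, a, rfl⟩ := hm
      rw [Nat.mul_div_cancel_left _ two_pos, Nat.div_div_self ((dvd_mul_left a 2).trans h1) h0]
    · intro d _
      push_cast; ring
  have h4 : ∑ m ∈ n.divisors, (-1 : ℚ) ^ m * (m : ℚ) ^ j + ∑ m ∈ n.divisors, (m : ℚ) ^ j =
      2 * ∑ m ∈ n.divisors with 2 ∣ m, (m : ℚ) ^ j := by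
    rw [← Finset.sum_add_distrib, Finset.sum_filter, Finset.mul_sum]
    refine Finset.sum_congr rfl fun m _ => ?_
    split_ifs with hm
    · rw [(even_iff_two_dvd.2 hm).neg_one_pow]; ring
    · rw [(Nat.not_even_iff_odd.1 fun h => hm (even_iff_two_dvd.1 h)).neg_one_pow]; ring
  rw [← h3, ← Finset.sum_mul] at h4
  rw [pow_succ]
  linear_combination h4

/-! ### The heat equation for theta functions -/

theorem qD_C_mul (c : ℚ) (f : QSer) : qD (C c * f) = C c * qD f := by
  ext n
  rw [coeff_qD, coeff_C_mul, coeff_C_mul, coeff_qD]; ring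

/-- The heat operator applied to the coefficient of `z ^ k` of a theta function. -/
theorem zc_theta_heat {c : ℚ} (hc : c ^ 2 = 1) {s : ℕ} (hs : 0 < s) (k : ℤ) :
    zc 0 (theta c s) * (2 * qD (zc k (theta c s)) -
      s * ((k : QSer) ^ 2 - k) * zc k (theta c s)) =
      2 * qD (zc 0 (theta c s)) * zc k (theta c s) := by
  have hnat : ∀ k : ℕ, zc 0 (theta c s) * (2 * qD (zc k (theta c s)) -
      s * ((k : QSer) ^ 2 - k) * zc k (theta c s)) =
      2 * qD (zc 0 (theta c s)) * zc k (theta c s) := fun k => by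
    induction k with
    | zero => simp; ring
    | succ k ih =>
      have h := zc_theta_succ hc hs k
      push_cast at h ih ⊢
      have h2 : qD (zc (k + 1) (theta c s)) =
          -C c * ((s : QSer) * (k : QSer) * X ^ (s * k) * zc k (theta c s)
          + X ^ (s * k) * qD (zc k (theta c s))) := by
        rw [h, neg_mul, neg_mul, map_neg, mul_assoc, qD_C_mul, Derivation.leibniz, qD_X_pow,
          smul_eq_mul, smul_eq_mul]
        push_cast; ring
      rw [h2, h]
      linear_combination -C c * X ^ (s * k) * ih
  rcases le_or_gt 0 k with hk | hk
  · obtain ⟨j, rfl⟩ := Int.eq_ofNat_of_zero_le hk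
    exact_mod_cast hnat j
  · obtain ⟨j, hj⟩ := Int.eq_ofNat_of_zero_le (by omega : 0 ≤ 1 - k)
    have h := zc_theta_one_sub hc hs (j : ℤ)
    rw [← hj, sub_sub_cancel, hj] at h
    have h3 : (k : QSer) = 1 - (j : QSer) := by
      have : k = 1 - (j : ℤ) := by omega
      rw [this]; push_cast; ring
    have h4 := hnat j
    rw [h, neg_mul, map_neg, qD_C_mul, h3]
    linear_combination -C c * h4

/-- The coefficient of z^k is (-c)^k q^(s k(k-1)/2) times the coefficient of z^0, so 2 q∂q acts as s
(k² - k) up to the logarithmic derivative of that constant term. The constant term is never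
computed. -/
theorem theta_heat {c : ℚ} (hc : c ^ 2 = 1) {s : ℕ} (hs : 0 < s) :
    kK (zc 0 (theta c s)) * (((2 : ℕ) : BiSeries) * qD (theta c s) -
      (s : BiSeries) * (zD (zD (theta c s)) - zD (theta c s))) =
      kK (2 * qD (zc 0 (theta c s))) * theta c s := by
  refine zc_ext fun k => ?_
  rw [zc_kK_mul, zc_kK_mul, ← zc_theta_heat hc hs, map_sub, ← map_natCast kK, ← map_natCast kK,
    zc_kK_mul, zc_kK_mul, zc_qD, map_sub, zc_zD, zc_zD]
  push_cast
  ring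

/-- Elimination of the constant term from the moments of the heat equation. -/
theorem theta_heat_mom {c : ℚ} (hc : c ^ 2 = 1) {s : ℕ} (hs : 0 < s) {w : QSer} {τ : ℕ → QSer}
    (hw : w ≠ 0) {i M : ℕ} (hi : τ i ≠ 0) (hτ : ∀ j ≤ M + 2, mom j (theta c s) = w * τ j)
    {j k : ℕ} (hiM : i ≤ M) (hj : j ≤ M) (hk : k ≤ M) :
    τ k * (2 * qD (τ j) - s * (τ (j + 2) - τ (j + 1))) =
      τ j * (2 * qD (τ k) - s * (τ (k + 2) - τ (k + 1))) := by
  -- The logarithmic derivatives of w and of the constant term enter every order in the same way, so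
  -- cross-multiplying orders j and k removes both.
  have hm : ∀ j ≤ M, zc 0 (theta c s) * (2 * (w * qD (τ j) + τ j * qD w) -
      s * (w * τ (j + 2) - w * τ (j + 1))) = 2 * qD (zc 0 (theta c s)) * (w * τ j) := fun j hj => by
    have h := congrArg (mom j) (theta_heat hc hs)
    rwa [mom_kK_mul, mom_kK_mul, mom_sub, mom_natCast_mul, mom_natCast_mul, mom_qD, mom_sub,
      mom_zD, mom_zD, mom_zD, hτ j (by omega), hτ (j + 1) (by omega), hτ (j + 1 + 1) (by omega),
      Derivation.leibniz, smul_eq_mul, smul_eq_mul] at h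
  -- The constant term generates all coefficients; were it zero, every moment would vanish,
  -- including the one of order i.
  have h0 : zc 0 (theta c s) ≠ 0 := by
    intro h0
    have h1 : ∀ k : ℕ, zc k (theta c s) = 0 := fun k => by
      induction k with
      | zero => exact h0
      | succ k ih =>
        have := zc_theta_succ hc hs k
        rw [ih, mul_zero] at this
        exact_mod_cast this
    have h2 : theta c s = 0 := zc_ext fun k => by
      rw [map_zero]
      rcases le_or_gt 0 k with hk | hk
      · obtain ⟨j, rfl⟩ := Int.eq_ofNat_of_zero_le hk
        exact h1 j
      · obtain ⟨j, hj⟩ := Int.eq_ofNat_of_zero_le (by omega : 0 ≤ 1 - k)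
        rw [show k = 1 - (j : ℤ) by omega, zc_theta_one_sub hc hs, h1, mul_zero]
    have h3 := hτ i (by omega)
    have h4 : mom i (0 : BiSeries) = 0 := by simp [mom]
    rw [h2, h4] at h3
    exact mul_ne_zero hw hi h3.symm
  apply mul_left_cancel₀ h0
  apply mul_left_cancel₀ (mul_ne_zero hw hw)
  linear_combination w * τ k * hm j hj - w * τ j * hm k hk

/-! ### Differential equations of Ramanujan type for the Lambert series -/

/-- The even moments of `exp (∑ 2 X_{2k-1} t ^ (2k) / (2k)!)`. -/
noncomputable def expMom (x₁ x₃ x₅ : QSer) : ℕ → QSer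
  | 0 => 1
  | 2 => 2 * x₁
  | 4 => 2 * x₃ + 12 * x₁ ^ 2
  | 6 => 2 * x₅ + 60 * x₁ * x₃ + 120 * x₁ ^ 3
  | _ => 0

theorem mom_thetaProd (c : ℚ) {s : ℕ} (hs : 0 < s) {j : ℕ} (hj : j ≤ 6) :
    mom j (thetaProd c s) = ev (thetaProd c s) *
      expMom (-lambert c s 1) (-lambert c s 3) (-lambert c s 5) j := by
  obtain ⟨Λ, h, hΛ⟩ := exists_zD_thetaProd c hs
  obtain ⟨h1, h3, h5, h2, h4, h6⟩ := mom_of_zD_eq_mul h (by simp [hΛ]) (by simp [hΛ])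
    (by rw [hΛ]; norm_num)
  rw [hΛ] at h2
  rw [hΛ, hΛ] at h4
  rw [hΛ, hΛ, hΛ] at h6
  interval_cases j
  · simp [mom_zero, expMom]
  · simp [h1, expMom]
  · rw [h2, expMom]; ring
  · simp [h3, expMom]
  · rw [h4, expMom]; ring
  · simp [h5, expMom]
  · rw [h6, expMom]; ring

theorem mom_zT_mul (n : ℕ) (f : BiSeries) :
    mom n (zT 1 * f) = ∑ i ∈ Finset.range (n + 1), (n.choose i : QSer) * mom i f := by
  rw [mul_comm, mom_mul, Finset.Nat.sum_antidiagonal_eq_sum_range_succ_mk]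
  simp [mom_zT]

theorem mom_theta (c : ℚ) (s n : ℕ) : mom n (theta c s) = mom n (thetaProd c s) -
    C c * ∑ i ∈ Finset.range (n + 1), (n.choose i : QSer) * mom i (thetaProd c s) := by
  rw [theta, sub_mul, one_mul, mom_sub, mul_assoc, mom_kK_mul, mom_zT_mul]

theorem qD_natCast_mul (n : ℕ) (f : QSer) : qD ((n : QSer) * f) = n * qD f := by
  rw [Derivation.leibniz, Derivation.map_natCast]; simp

/-- These are Ramanujan's equations for the derivatives of E₂ and E₄ in the variable q^s. Since
`theta 1 s` vanishes at z = 1, its first moment is the leading one; the heat equation in orders 3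
and 5 is compared with order 1. -/
theorem qD_lambert {s : ℕ} (hs : 0 < s) :
    6 * qD (lambert 1 s 1) = s * (5 * lambert 1 s 3 + lambert 1 s 1 - 12 * lambert 1 s 1 ^ 2) ∧
    30 * qD (lambert 1 s 3) = s * (21 * lambert 1 s 5 + 10 * lambert 1 s 3 - lambert 1 s 1
      - 240 * lambert 1 s 1 * lambert 1 s 3) := by
  have hw := ev_thetaProd_ne_zero 1 hs
  have hm := fun j hj => mom_thetaProd 1 hs (j := j) hj
  set X₁ := lambert 1 s 1
  set X₃ := lambert 1 s 3
  set X₅ := lambert 1 s 5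
  set μ := expMom (-X₁) (-X₃) (-X₅) with hμ
  set τ : ℕ → QSer := fun n => - ∑ i ∈ Finset.range n, (n.choose i : QSer) * μ i with hτ
  have ht : ∀ j ≤ 7, mom j (theta 1 s) = ev (thetaProd 1 s) * τ j := fun j hj => by
    rw [mom_theta, Finset.sum_range_succ, hτ, map_one]
    simp only
    rw [Finset.sum_congr rfl fun i hi => by
      rw [hm i (by have := Finset.mem_range.1 hi; omega)]]
    simp only [mul_left_comm _ (ev _), ← Finset.mul_sum]
    simp
  have t1 : τ 1 = -1 := by simp [hτ, hμ, expMom]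
  have t2 : τ 2 = -1 := by simp [hτ, hμ, expMom, Finset.sum_range_succ]
  have t3 : τ 3 = -(1 - 6 * X₁) := by
    simp [hτ, hμ, expMom, Finset.sum_range_succ, Nat.choose]; ring
  have t4 : τ 4 = -(1 - 12 * X₁) := by
    simp [hτ, hμ, expMom, Finset.sum_range_succ, Nat.choose]; ring
  have t5 : τ 5 = -(1 - 20 * X₁ - 10 * X₃ + 60 * X₁ ^ 2) := by
    simp [hτ, hμ, expMom, Finset.sum_range_succ, Nat.choose]; ring
  have t6 : τ 6 = -(1 - 30 * X₁ - 30 * X₃ + 180 * X₁ ^ 2) := by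
    simp [hτ, hμ, expMom, Finset.sum_range_succ, Nat.choose]; ring
  have t7 : τ 7 = -(1 - 42 * X₁ - 70 * X₃ + 420 * X₁ ^ 2
      - 14 * X₅ + 420 * X₁ * X₃ - 840 * X₁ ^ 3) := by
    simp [hτ, hμ, expMom, Finset.sum_range_succ, Nat.choose]; ring
  have hi : τ 1 ≠ 0 := by rw [t1]; simp
  have e3 := theta_heat_mom (by norm_num) hs hw hi ht (j := 3) (k := 1) (by norm_num)
    (by norm_num) (by norm_num)
  have e5 := theta_heat_mom (by norm_num) hs hw hi ht (j := 5) (k := 1) (by norm_num)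
    (by norm_num) (by norm_num)
  have q1 : qD (τ 1) = 0 := by rw [t1]; simp
  have q3 : qD (τ 3) = 6 * qD X₁ := by
    have : τ 3 = ((6 : ℕ) : QSer) * X₁ - 1 := by rw [t3]; push_cast; ring
    rw [this, map_sub, qD_natCast_mul]; simp
  have q5 : qD (τ 5) = 20 * qD X₁ + 10 * qD X₃ - 120 * X₁ * qD X₁ := by
    have : τ 5 = ((20 : ℕ) : QSer) * X₁ + ((10 : ℕ) : QSer) * X₃ - ((60 : ℕ) : QSer) * (X₁ * X₁)
        - 1 := by rw [t5]; push_cast; ring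
    rw [this, map_sub, map_sub, map_add, qD_natCast_mul, qD_natCast_mul, qD_natCast_mul,
      Derivation.leibniz]
    simp; ring
  rw [q1, q3] at e3
  rw [q1, q5] at e5
  simp only [Nat.reduceAdd, t1, t2, t3, t4, t5, t6, t7] at e3 e5
  have r1 : 6 * qD X₁ = s * (5 * X₃ + X₁ - 12 * X₁ ^ 2) := by
    have h2 : (2 : QSer) * (6 * qD X₁) = 2 * (s * (5 * X₃ + X₁ - 12 * X₁ ^ 2)) := by
      linear_combination -e3
    exact mul_left_cancel₀ two_ne_zero h2
  refine ⟨r1, ?_⟩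
  have h2 : (2 : QSer) * (30 * qD X₃) = 2 * (s * (21 * X₅ + 10 * X₃ - X₁ - 240 * X₁ * X₃)) := by
    linear_combination -3 * e5 + (-20 + 120 * X₁) * r1
  exact mul_left_cancel₀ two_ne_zero h2

/-- The same comparison for a theta function that does not vanish at z = 1: orders 2 and 4 against
order 0. -/
theorem qD_lambert_neg_one :
    -2 * qD (lambert (-1) 1 1) = -lambert (-1) 1 3 - lambert (-1) 1 1
      + 4 * lambert (-1) 1 1 ^ 2 ∧
    -2 * qD (lambert (-1) 1 3) = -lambert (-1) 1 5 - 2 * lambert (-1) 1 3 + lambert (-1) 1 1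
      + 16 * lambert (-1) 1 1 * lambert (-1) 1 3 := by
  have hw := ev_thetaProd_ne_zero (-1) one_pos
  have hm := fun j hj => mom_thetaProd (-1) one_pos (j := j) hj
  set X₁ := lambert (-1) 1 1
  set X₃ := lambert (-1) 1 3
  set X₅ := lambert (-1) 1 5
  set μ := expMom (-X₁) (-X₃) (-X₅) with hμ
  set τ : ℕ → QSer := fun n => μ n + ∑ i ∈ Finset.range (n + 1), (n.choose i : QSer) * μ i with hτ
  have ht : ∀ j ≤ 4 + 2, mom j (theta (-1) 1) = ev (thetaProd (-1) 1) * τ j := fun j hj => by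
    rw [mom_theta, hτ, map_neg, map_one]
    simp only
    rw [Finset.sum_congr rfl fun i hi => by
      rw [hm i (by have := Finset.mem_range.1 hi; omega)], hm j hj]
    simp only [mul_left_comm _ (ev _), ← Finset.mul_sum]
    ring
  have t0 : τ 0 = 2 := by simp [hτ, hμ, expMom]; norm_num
  have t1 : τ 1 = 1 := by simp [hτ, hμ, expMom, Finset.sum_range_succ]
  have t2 : τ 2 = 1 - 4 * X₁ := by simp [hτ, hμ, expMom, Finset.sum_range_succ]; ring
  have t3 : τ 3 = 1 - 6 * X₁ := by
    simp [hτ, hμ, expMom, Finset.sum_range_succ, Nat.choose]; ring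
  have t4 : τ 4 = 1 - 12 * X₁ - 4 * X₃ + 24 * X₁ ^ 2 := by
    simp [hτ, hμ, expMom, Finset.sum_range_succ, Nat.choose]; ring
  have t5 : τ 5 = 1 - 20 * X₁ - 10 * X₃ + 60 * X₁ ^ 2 := by
    simp [hτ, hμ, expMom, Finset.sum_range_succ, Nat.choose]; ring
  have t6 : τ 6 = 1 - 30 * X₁ - 30 * X₃ + 180 * X₁ ^ 2 - 4 * X₅ + 120 * X₁ * X₃
      - 240 * X₁ ^ 3 := by
    simp [hτ, hμ, expMom, Finset.sum_range_succ, Nat.choose]; ring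
  have hi : τ 1 ≠ 0 := by rw [t1]; simp
  have e2 := theta_heat_mom (by norm_num) one_pos hw hi ht (j := 2) (k := 0) (by norm_num)
    (by norm_num) (by norm_num)
  have e4 := theta_heat_mom (by norm_num) one_pos hw hi ht (j := 4) (k := 0) (by norm_num)
    (by norm_num) (by norm_num)
  have q0 : qD (τ 0) = 0 := by
    have : τ 0 = ((2 : ℕ) : QSer) := by rw [t0]; norm_num
    rw [this, Derivation.map_natCast]
  have q2 : qD (τ 2) = -4 * qD X₁ := by
    have : τ 2 = 1 - ((4 : ℕ) : QSer) * X₁ := by rw [t2]; push_cast; ring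
    rw [this, map_sub, qD_natCast_mul]; simp
  have q4 : qD (τ 4) = -12 * qD X₁ - 4 * qD X₃ + 48 * X₁ * qD X₁ := by
    have : τ 4 = 1 - ((12 : ℕ) : QSer) * X₁ - ((4 : ℕ) : QSer) * X₃
        + ((24 : ℕ) : QSer) * (X₁ * X₁) := by rw [t4]; push_cast; ring
    rw [this, map_add, map_sub, map_sub, qD_natCast_mul, qD_natCast_mul, qD_natCast_mul,
      Derivation.leibniz]
    simp; ring
  rw [q0, q2] at e2
  rw [q0, q4] at e4
  simp only [Nat.reduceAdd, t0, t1, t2, t3, t4, t5, t6] at e2 e4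
  have r1 : -2 * qD X₁ = -X₃ - X₁ + 4 * X₁ ^ 2 := by
    have h2 : (8 : QSer) * (-2 * qD X₁) = 8 * (-X₃ - X₁ + 4 * X₁ ^ 2) := by
      linear_combination e2
    exact mul_left_cancel₀ (by norm_num) h2
  refine ⟨r1, ?_⟩
  have h2 : (8 : QSer) * (-2 * qD X₃) = 8 * (-X₅ - 2 * X₃ + X₁ + 16 * X₁ * X₃) := by
    linear_combination e4 + (-24 + 96 * X₁) * r1
  exact mul_left_cancel₀ (by norm_num) h2

/-! ### Moments of the partial differential equation -/

theorem mom_zT_mul' (n : ℕ) (m : ℤ) (f : BiSeries) :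
    mom n (zT m * f) =
      ∑ i ∈ Finset.range (n + 1), (n.choose i : QSer) * ((m : QSer) ^ (n - i) * mom i f) := by
  rw [mul_comm, mom_mul, Finset.Nat.sum_antidiagonal_eq_sum_range_succ_mk]
  simp [mom_zT, mul_comm]

/-- The quotient `thetaProd (-1) 1 / thetaProd 1 s ^ 3` and its moments. -/
theorem exists_thetaQuot {s : ℕ} (hs : 0 < s) : ∃ Q : BiSeries,
    Q * thetaProd 1 s ^ 3 = thetaProd (-1) 1 ∧ ev Q ≠ 0 ∧
    ∀ j ≤ 6, mom j Q = ev Q * expMom (3 * lambert 1 s 1 - lambert (-1) 1 1)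
      (3 * lambert 1 s 3 - lambert (-1) 1 3) (3 * lambert 1 s 5 - lambert (-1) 1 5) j := by
  obtain ⟨Λ, h, hΛ⟩ := exists_zD_thetaProd 1 hs
  obtain ⟨Λ', h', hΛ'⟩ := exists_zD_thetaProd (-1) one_pos
  set W := thetaProd 1 s
  set V := thetaProd (-1) 1 with hV
  have hc : constantCoeff (W ^ 3) = 1 := by
    rw [map_pow, constantCoeff_thetaProd 1 hs, one_pow]
  have hinv : W ^ 3 * pinv (W ^ 3) = 1 := mul_pinv hc
  set Q := V * pinv (W ^ 3) with hQ
  have hQW : Q * W ^ 3 = V := by rw [hQ]; linear_combination V * hinv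
  have hev : ev Q ≠ 0 := by
    intro h0
    have := congrArg ev hQW
    rw [map_mul, h0, zero_mul] at this
    exact ev_thetaProd_ne_zero (-1) one_pos this.symm
  have hD : zD Q = Q * (Λ' - 3 * Λ) := by
    have h1 := congrArg zD hQW
    rw [Derivation.leibniz, Derivation.leibniz_pow, h', h, smul_eq_mul, smul_eq_mul,
      smul_eq_mul, nsmul_eq_mul] at h1
    push_cast at h1
    have h2 : (W ^ 3 * pinv (W ^ 3)) * zD Q = (W ^ 3 * pinv (W ^ 3)) * (Q * (Λ' - 3 * Λ)) := by
      rw [← hQW] at h1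
      linear_combination pinv (W ^ 3) * h1
    rwa [hinv, one_mul, one_mul] at h2
  have hm : ∀ j, mom j (Λ' - 3 * Λ) =
      ((-1) ^ j - 1) * (lambert (-1) 1 j - 3 * lambert 1 s j) := fun j => by
    have := mom_natCast_mul j 3 Λ
    push_cast at this
    rw [mom_sub, this, hΛ, hΛ']; ring
  refine ⟨Q, hQW, hev, fun j hj => ?_⟩
  obtain ⟨h1, h3, h5, h2, h4, h6⟩ := mom_of_zD_eq_mul hD (by simp [hm]) (by simp [hm])
    (by rw [hm]; norm_num)
  rw [hm] at h2
  rw [hm, hm] at h4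
  rw [hm, hm, hm] at h6
  interval_cases j
  · simp [mom_zero, expMom]
  · simp [h1, expMom]
  · rw [h2, expMom]; ring
  · simp [h3, expMom]
  · rw [h4, expMom]; ring
  · simp [h5, expMom]
  · rw [h6, expMom]; ring

theorem mom_heatOp (e : ℕ) (R : BiSeries) (n : ℕ) : mom n (heatOp e R) =
    (∑ i ∈ Finset.range (n + 1), (n.choose i : QSer) * ((3 ^ (n - i) - 2 ^ (n - i) - 1) *
      ((e ^ 2 : QSer) * qD (mom i R) + mom (i + 2) R)))
    + ((e ^ 2 : QSer) * qD (mom n R) + mom (n + 2) R)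
    + 4 * (∑ i ∈ Finset.range (n + 1), (n.choose i : QSer) * ((1 - 2 ^ (n - i)) * mom (i + 1) R))
    + 2 * (∑ i ∈ Finset.range (n + 1), (n.choose i : QSer) * ((1 + 2 ^ (n - i)) * mom i R)) := by
  have hE : ∀ j, mom j ((e ^ 2 : BiSeries) * qD R + zD (zD R)) =
      (e ^ 2 : QSer) * qD (mom j R) + mom (j + 2) R := fun j => by
    have := mom_natCast_mul j (e ^ 2) (qD R)
    push_cast at this
    rw [mom_add, this, mom_qD, mom_zD, mom_zD]
  have h4 := fun f => mom_natCast_mul n 4 f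
  have h2 := fun f => mom_natCast_mul n 2 f
  push_cast at h4 h2
  rw [heatOp]
  simp only [mom_add, mom_sub, h4, h2, mom_zT_mul', hE, mom_zD]
  push_cast
  simp only [one_pow, mul_add, mul_sub, sub_mul, add_mul, Finset.sum_add_distrib,
    Finset.sum_sub_distrib]
  ring

/-- Cancelling the cube of the product turns the equation into `heatOp e R` = (u/v)(z + z²) Q with
all moments of Q known. The leading coefficient (1-z)²(1+z) vanishes doubly at z = 1, so order j
involves no moment of R beyond j. In order 2 the second moment cancels as well, leaving an equation
for q∂q of the zeroth; orders 4 and 6 give the fourth and sixth moments. -/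
theorem mom_of_heatOp {e s : ℕ} (hs : 0 < s) {R : BiSeries} (hR : zInv R = R) {u v : QSer}
    (hv : v ≠ 0)
    (h : kK v * (heatOp e R * thetaProd 1 s ^ 3) = kK u * (zT 1 * theta (-1) 1))
    {x₁ x₃ x₅ : QSer} (hx₁ : x₁ = 3 * lambert 1 s 1 - lambert (-1) 1 1)
    (hx₃ : x₃ = 3 * lambert 1 s 3 - lambert (-1) 1 3)
    (hx₅ : x₅ = 3 * lambert 1 s 5 - lambert (-1) 1 5) :
    (e ^ 2 : QSer) * qD (mom 0 R) = mom 0 R * (2 * x₁) ∧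
    3 * mom 4 R = -6 * (e ^ 2 : QSer) * qD (mom 2 R) - 3 * mom 2 R
      + mom 0 R * (2 * x₃ + 12 * x₁ ^ 2 - 2 * x₁) ∧
    20 * mom 6 R = -30 * (e ^ 2 : QSer) * qD (mom 4 R) - 275 * mom 4 R
      - 480 * (e ^ 2 : QSer) * qD (mom 2 R) - 215 * mom 2 R
      + mom 0 R * (-154 * x₁ + 75 * (2 * x₃ + 12 * x₁ ^ 2)
        + 2 * (2 * x₅ + 60 * x₁ * x₃ + 120 * x₁ ^ 3)) := by
  obtain ⟨Q, hQ, hQ0, hm⟩ := exists_thetaQuot hs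
  rw [← hx₁, ← hx₃, ← hx₅] at hm
  have hW : thetaProd 1 s ^ 3 ≠ 0 := by
    refine pow_ne_zero _ fun h0 => ev_thetaProd_ne_zero 1 hs ?_
    rw [h0, map_zero]
  have h1 : kK v * heatOp e R = kK u * (zT 1 * Q + zT 2 * Q) := by
    apply mul_right_cancel₀ hW
    have h2 : zT 2 = zT 1 * zT 1 := by rw [← zT_add]; norm_num
    rw [mul_assoc, h, theta, ← hQ, h2, map_neg, map_neg, map_one, map_one]
    ring
  have hj : ∀ j ≤ 6, v * mom j (heatOp e R) = u * ev Q * ∑ i ∈ Finset.range (j + 1),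
      (j.choose i : QSer) * ((1 + 2 ^ (j - i)) * expMom x₁ x₃ x₅ i) := fun j hj => by
    have h2 := congrArg (mom j) h1
    rw [mom_kK_mul, mom_kK_mul, mom_add, mom_zT_mul', mom_zT_mul'] at h2
    rw [h2, mul_assoc, ← Finset.sum_add_distrib, Finset.mul_sum (a := ev Q)]
    congr 1
    refine Finset.sum_congr rfl fun i hi => ?_
    rw [hm i (by have := Finset.mem_range.1 hi; omega)]
    push_cast; ring
  have o1 := mom_odd hR (n := 1) (by decide)
  have o3 := mom_odd hR (n := 3) (by decide)
  have o5 := mom_odd hR (n := 5) (by decide)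
  have o7 := mom_odd hR (n := 7) (by decide)
  -- Order zero determines the unknown scalar: at z = 1 the left side is 4 R and z + z² is 2.
  have h0 : u * ev Q = 2 * v * mom 0 R := by
    have := hj 0 (by norm_num)
    rw [mom_heatOp] at this
    simp [expMom] at this
    have h2 : (2 : QSer) * (u * ev Q) = 2 * (2 * v * mom 0 R) := by linear_combination -this
    exact mul_left_cancel₀ two_ne_zero h2
  have hj' : ∀ j ≤ 6, mom j (heatOp e R) = 2 * mom 0 R * ∑ i ∈ Finset.range (j + 1),
      (j.choose i : QSer) * ((1 + 2 ^ (j - i)) * expMom x₁ x₃ x₅ i) := fun j h6 => by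
    apply mul_left_cancel₀ hv
    rw [hj j h6, h0]; ring
  have e2 := hj' 2 (by norm_num)
  have e4 := hj' 4 (by norm_num)
  have e6 := hj' 6 (by norm_num)
  rw [mom_heatOp] at e2 e4 e6
  simp only [Finset.sum_range_succ, Finset.range_zero, Finset.sum_empty, Nat.choose, expMom,
    Nat.reduceAdd, Nat.reduceSub, o1, o3, o5, o7, map_zero] at e2 e4 e6
  push_cast at e2 e4 e6
  have r2 : (e ^ 2 : QSer) * qD (mom 0 R) = mom 0 R * (2 * x₁) := by
    have : (4 : QSer) * ((e ^ 2 : QSer) * qD (mom 0 R)) = 4 * (mom 0 R * (2 * x₁)) := by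
      linear_combination e2
    exact mul_left_cancel₀ (by norm_num) this
  refine ⟨r2, ?_, ?_⟩
  · have : (4 : QSer) * (3 * mom 4 R) = 4 * (-6 * (e ^ 2 : QSer) * qD (mom 2 R) - 3 * mom 2 R
      + mom 0 R * (2 * x₃ + 12 * x₁ ^ 2 - 2 * x₁)) := by
      linear_combination e4 - 64 * r2
    exact mul_left_cancel₀ (by norm_num) this
  · have : (2 : QSer) * (20 * mom 6 R) = 2 * (-30 * (e ^ 2 : QSer) * qD (mom 4 R) - 275 * mom 4 R
      - 480 * (e ^ 2 : QSer) * qD (mom 2 R) - 215 * mom 2 R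
      + mom 0 R * (-154 * x₁ + 75 * (2 * x₃ + 12 * x₁ ^ 2)
        + 2 * (2 * x₅ + 60 * x₁ * x₃ + 120 * x₁ ^ 3))) := by
      linear_combination e6 - 664 * r2
    exact mul_left_cancel₀ (by norm_num) this

/-! ### The linear relations between moments -/

section Algebra

variable {F : Type*} [Field F] [CharZero F]

/-- The prefix d stands for q∂q. Substituting the fourth moment into the equation for the sixth
makes y, dy, ddy appear with the coefficients 3, 20, 48 of the claim. What is left is P times a
polynomial in the Lambert series, which is not zero but lies in the ideal of the relations `hZ₁`,
`hZ₂`, `hZ₃`. -/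
theorem rank_six_field {P dP ddP A₁ A₃ A₅ dA₁ dA₃ ddA₁ B₁ B₃ B₅ dB₁ dB₃ ddB₁ y dy ddy r₄ dr₄ r₆ : F}
    (hP : dP = P * (2 * A₁ - 2 * B₁)) (hP2 : ddP = dP * (2 * A₁ - 2 * B₁) + P * (2 * dA₁ - 2 * dB₁))
    (hA₁ : 6 * dA₁ = 5 * A₃ + A₁ - 12 * A₁ ^ 2) (hA₂ : 6 * ddA₁ = 5 * dA₃ + dA₁ - 24 * A₁ * dA₁)
    (hA₃ : 30 * dA₃ = 21 * A₅ + 10 * A₃ - A₁ - 240 * A₁ * A₃)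
    (hB₁ : 6 * dB₁ = 2 * (5 * B₃ + B₁ - 12 * B₁ ^ 2))
    (hB₂ : 6 * ddB₁ = 2 * (5 * dB₃ + dB₁ - 24 * B₁ * dB₁))
    (hB₃ : 30 * dB₃ = 2 * (21 * B₅ + 10 * B₃ - B₁ - 240 * B₁ * B₃))
    (hZ₁ : 2 * (dA₁ - 4 * dB₁) = A₃ - 16 * B₃ + (A₁ - 4 * B₁) + 4 * (A₁ - 4 * B₁) ^ 2)
    (hZ₂ : 2 * (ddA₁ - 4 * ddB₁) = dA₃ - 16 * dB₃ + (dA₁ - 4 * dB₁)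
      + 8 * (A₁ - 4 * B₁) * (dA₁ - 4 * dB₁))
    (hZ₃ : 2 * (dA₃ - 16 * dB₃) = A₅ - 64 * B₅ + 2 * (A₃ - 16 * B₃) - (A₁ - 4 * B₁)
      + 16 * (A₁ - 4 * B₁) * (A₃ - 16 * B₃))
    (hr₄ : 3 * r₄ = -24 * dy - 3 * y + P * (2 * (4 * A₃ - 16 * B₃) + 12 * (4 * A₁ - 4 * B₁) ^ 2
      - 2 * (4 * A₁ - 4 * B₁)))
    (hdr₄ : 3 * dr₄ = -24 * ddy - 3 * dy + dP * (2 * (4 * A₃ - 16 * B₃)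
      + 12 * (4 * A₁ - 4 * B₁) ^ 2 - 2 * (4 * A₁ - 4 * B₁)) + P * (2 * (4 * dA₃ - 16 * dB₃)
      + 24 * (4 * A₁ - 4 * B₁) * (4 * dA₁ - 4 * dB₁) - 2 * (4 * dA₁ - 4 * dB₁)))
    (hr₆ : 20 * r₆ = -120 * dr₄ - 275 * r₄ - 1920 * dy - 215 * y
      + P * (-154 * (4 * A₁ - 4 * B₁) + 75 * (2 * (4 * A₃ - 16 * B₃) + 12 * (4 * A₁ - 4 * B₁) ^ 2)
        + 2 * (2 * (4 * A₅ - 64 * B₅) + 60 * (4 * A₁ - 4 * B₁) * (4 * A₃ - 16 * B₃)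
        + 120 * (4 * A₁ - 4 * B₁) ^ 3))) :
    r₆ = 3 * y + 20 * dy + 48 * ddy
      + (2192796 / 274505 * (P * (2 * A₁)) + 123276 / 7595 * (2 * (dP * A₁ + P * dA₁))
        - 5185344 / 1921535 * (2 * (ddP * A₁ + 2 * dP * dA₁ + P * ddA₁)))
      + (-445728 / 54901 * (P * (2 * A₃ + 12 * A₁ ^ 2)) - 5730048 / 384307 *
        (dP * (2 * A₃ + 12 * A₁ ^ 2) + P * (2 * dA₃ + 24 * A₁ * dA₁)))
      + 5376 / 3565 * (P * (2 * A₅ + 60 * A₁ * A₃ + 120 * A₁ ^ 3))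
      + (-386988 / 39215 * (P * (2 * B₁)) - 54556468 / 1921535 * (2 * (dP * B₁ + P * dB₁))
        - 30679392 / 1921535 * (2 * (ddP * B₁ + 2 * dP * dB₁ + P * ddB₁)))
      + (96204 / 7843 * (P * (2 * B₃ + 12 * B₁ ^ 2)) + 1412352 / 54901 *
        (dP * (2 * B₃ + 12 * B₁ ^ 2) + P * (2 * dB₃ + 24 * B₁ * dB₁)))
      - 9056 / 3565 * (P * (2 * B₅ + 60 * B₁ * B₃ + 120 * B₁ ^ 3)) := by
  have e1 : dA₁ = (5 * A₃ + A₁ - 12 * A₁ ^ 2) / 6 := by linear_combination hA₁ / 6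
  have e3 : dA₃ = (21 * A₅ + 10 * A₃ - A₁ - 240 * A₁ * A₃) / 30 := by linear_combination hA₃ / 30
  have e2 : ddA₁ = (5 * dA₃ + dA₁ - 24 * A₁ * dA₁) / 6 := by linear_combination hA₂ / 6
  have f1 : dB₁ = (5 * B₃ + B₁ - 12 * B₁ ^ 2) / 3 := by linear_combination hB₁ / 6
  have f3 : dB₃ = (21 * B₅ + 10 * B₃ - B₁ - 240 * B₁ * B₃) / 15 := by linear_combination hB₃ / 30
  have f2 : ddB₁ = (5 * dB₃ + dB₁ - 24 * B₁ * dB₁) / 3 := by linear_combination hB₂ / 6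
  have g4 : r₄ = (-24 * dy - 3 * y + P * (2 * (4 * A₃ - 16 * B₃) + 12 * (4 * A₁ - 4 * B₁) ^ 2
      - 2 * (4 * A₁ - 4 * B₁))) / 3 := by linear_combination hr₄ / 3
  have g5 : dr₄ = (-24 * ddy - 3 * dy + dP * (2 * (4 * A₃ - 16 * B₃)
      + 12 * (4 * A₁ - 4 * B₁) ^ 2 - 2 * (4 * A₁ - 4 * B₁)) + P * (2 * (4 * dA₃ - 16 * dB₃)
      + 24 * (4 * A₁ - 4 * B₁) * (4 * dA₁ - 4 * dB₁) - 2 * (4 * dA₁ - 4 * dB₁))) / 3 := by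
    linear_combination hdr₄ / 3
  rw [g4, g5] at hr₆
  subst hP2 hP e2 e1 e3 f2 f1 f3
  -- The multipliers solve the linear system obtained by comparing monomials. By weight, the
  -- relation `hZ₁` of weight at most 4 may be multiplied by A₁ and B₁, while the other two, of
  -- weight at most 6, take only constants.
  linear_combination hr₆ / 20 + P / 2 * ((1688432/54901 - 25849920/384307 * A₁
    - 61360896/384307 * B₁) * hZ₁ - 44/713 * hZ₃ + 17489424/384307 * hZ₂)

/-- The same elimination for e = 1, s = 2: now y, dy, ddy acquire the coefficients 3, 5, 3, and the
remainder is a different combination of the same three relations. -/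
theorem m2Rank_six_field
    {P dP ddP A₁ A₃ A₅ dA₁ dA₃ ddA₁ B₁ B₃ B₅ dB₁ dB₃ ddB₁ y dy ddy r₄ dr₄ r₆ : F}
    (hP : dP = P * (2 * A₁ - 2 * B₁)) (hP2 : ddP = dP * (2 * A₁ - 2 * B₁) + P * (2 * dA₁ - 2 * dB₁))
    (hA₁ : 6 * dA₁ = 5 * A₃ + A₁ - 12 * A₁ ^ 2) (hA₂ : 6 * ddA₁ = 5 * dA₃ + dA₁ - 24 * A₁ * dA₁)
    (hA₃ : 30 * dA₃ = 21 * A₅ + 10 * A₃ - A₁ - 240 * A₁ * A₃)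
    (hB₁ : 6 * dB₁ = 2 * (5 * B₃ + B₁ - 12 * B₁ ^ 2))
    (hB₂ : 6 * ddB₁ = 2 * (5 * dB₃ + dB₁ - 24 * B₁ * dB₁))
    (hB₃ : 30 * dB₃ = 2 * (21 * B₅ + 10 * B₃ - B₁ - 240 * B₁ * B₃))
    (hZ₁ : 2 * (dA₁ - 4 * dB₁) = A₃ - 16 * B₃ + (A₁ - 4 * B₁) + 4 * (A₁ - 4 * B₁) ^ 2)
    (hZ₂ : 2 * (ddA₁ - 4 * ddB₁) = dA₃ - 16 * dB₃ + (dA₁ - 4 * dB₁)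
      + 8 * (A₁ - 4 * B₁) * (dA₁ - 4 * dB₁))
    (hZ₃ : 2 * (dA₃ - 16 * dB₃) = A₅ - 64 * B₅ + 2 * (A₃ - 16 * B₃) - (A₁ - 4 * B₁)
      + 16 * (A₁ - 4 * B₁) * (A₃ - 16 * B₃))
    (hr₄ : 3 * r₄ = -6 * dy - 3 * y + P * (2 * (A₃ - 13 * B₃) + 12 * (A₁ - B₁) ^ 2
      - 2 * (A₁ - B₁)))
    (hdr₄ : 3 * dr₄ = -6 * ddy - 3 * dy + dP * (2 * (A₃ - 13 * B₃)
      + 12 * (A₁ - B₁) ^ 2 - 2 * (A₁ - B₁)) + P * (2 * (dA₃ - 13 * dB₃)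
      + 24 * (A₁ - B₁) * (dA₁ - dB₁) - 2 * (dA₁ - dB₁)))
    (hr₆ : 20 * r₆ = -30 * dr₄ - 275 * r₄ - 480 * dy - 215 * y
      + P * (-154 * (A₁ - B₁) + 75 * (2 * (A₃ - 13 * B₃) + 12 * (A₁ - B₁) ^ 2)
        + 2 * (2 * (A₅ - 61 * B₅) + 60 * (A₁ - B₁) * (A₃ - 13 * B₃)
        + 120 * (A₁ - B₁) ^ 3))) :
    r₆ = 3 * y + 5 * dy + 3 * ddy
      + (249003 / 274505 * (P * (2 * A₁)) + 36273 / 83545 * (2 * (dP * A₁ + P * dA₁))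
        - 162042 / 1921535 * (2 * (ddP * A₁ + 2 * dP * dA₁ + P * ddA₁)))
      + (-46014 / 54901 * (P * (2 * A₃ + 12 * A₁ ^ 2)) - 179064 / 384307 *
        (dP * (2 * A₃ + 12 * A₁ ^ 2) + P * (2 * dA₃ + 24 * A₁ * dA₁)))
      + 168 / 3565 * (P * (2 * A₅ + 60 * A₁ * A₃ + 120 * A₁ ^ 3))
      + (-765123 / 274505 * (P * (2 * B₁)) + 6826601 / 1921535 * (2 * (dP * B₁ + P * dB₁))
        + 4805874 / 1921535 * (2 * (ddP * B₁ + 2 * dP * dB₁ + P * ddB₁)))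
      + (39102 / 7843 * (P * (2 * B₃ + 12 * B₁ ^ 2)) + 44136 / 54901 *
        (dP * (2 * B₃ + 12 * B₁ ^ 2) + P * (2 * dB₃ + 24 * B₁ * dB₁)))
      - 3848 / 3565 * (P * (2 * B₅ + 60 * B₁ * B₃ + 120 * B₁ ^ 3)) := by
  have e1 : dA₁ = (5 * A₃ + A₁ - 12 * A₁ ^ 2) / 6 := by linear_combination hA₁ / 6
  have e3 : dA₃ = (21 * A₅ + 10 * A₃ - A₁ - 240 * A₁ * A₃) / 30 := by linear_combination hA₃ / 30
  have e2 : ddA₁ = (5 * dA₃ + dA₁ - 24 * A₁ * dA₁) / 6 := by linear_combination hA₂ / 6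
  have f1 : dB₁ = (5 * B₃ + B₁ - 12 * B₁ ^ 2) / 3 := by linear_combination hB₁ / 6
  have f3 : dB₃ = (21 * B₅ + 10 * B₃ - B₁ - 240 * B₁ * B₃) / 15 := by linear_combination hB₃ / 30
  have f2 : ddB₁ = (5 * dB₃ + dB₁ - 24 * B₁ * dB₁) / 3 := by linear_combination hB₂ / 6
  have g4 : r₄ = (-6 * dy - 3 * y + P * (2 * (A₃ - 13 * B₃) + 12 * (A₁ - B₁) ^ 2
      - 2 * (A₁ - B₁))) / 3 := by linear_combination hr₄ / 3
  have g5 : dr₄ = (-6 * ddy - 3 * dy + dP * (2 * (A₃ - 13 * B₃)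
      + 12 * (A₁ - B₁) ^ 2 - 2 * (A₁ - B₁)) + P * (2 * (dA₃ - 13 * dB₃)
      + 24 * (A₁ - B₁) * (dA₁ - dB₁) - 2 * (dA₁ - dB₁))) / 3 := by
    linear_combination hdr₄ / 3
  rw [g4, g5] at hr₆
  subst hP2 hP e2 e1 e3 f2 f1 f3
  linear_combination hr₆ / 20 + P / 2 * ((-119065/219604 + 1498032/384307 * A₁
    + 4999998/384307 * B₁) * hZ₁ - 2501/2852 * hZ₃ + 1093089/768614 * hZ₂)

end Algebra

/-! ### Sixth moments for series with the required differential equation and crank-type moments -/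

theorem qD_ofNat_mul (n : ℕ) [n.AtLeastTwo] (f : QSer) :
    qD ((ofNat(n) : QSer) * f) = ofNat(n) * qD f := qD_natCast_mul n f

theorem qD_ofNat (n : ℕ) [n.AtLeastTwo] : qD (ofNat(n) : QSer) = 0 := by
  have := Derivation.map_natCast qD (R := ℚ) (A := QSer) (M := QSer) n
  exact_mod_cast this

/-- The Lambert series relations needed for the moments, as a package. -/
theorem lambert_relations :
    (6 * qD (lambert 1 1 1) = 5 * lambert 1 1 3 + lambert 1 1 1 - 12 * lambert 1 1 1 ^ 2 ∧
    6 * qD (qD (lambert 1 1 1)) = 5 * qD (lambert 1 1 3) + qD (lambert 1 1 1)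
      - 24 * lambert 1 1 1 * qD (lambert 1 1 1) ∧
    30 * qD (lambert 1 1 3) = 21 * lambert 1 1 5 + 10 * lambert 1 1 3 - lambert 1 1 1
      - 240 * lambert 1 1 1 * lambert 1 1 3) ∧
    (6 * qD (lambert 1 2 1) = 2 * (5 * lambert 1 2 3 + lambert 1 2 1 - 12 * lambert 1 2 1 ^ 2) ∧
    6 * qD (qD (lambert 1 2 1)) = 2 * (5 * qD (lambert 1 2 3) + qD (lambert 1 2 1)
      - 24 * lambert 1 2 1 * qD (lambert 1 2 1)) ∧
    30 * qD (lambert 1 2 3) = 2 * (21 * lambert 1 2 5 + 10 * lambert 1 2 3 - lambert 1 2 1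
      - 240 * lambert 1 2 1 * lambert 1 2 3)) ∧
    (2 * (qD (lambert 1 1 1) - 4 * qD (lambert 1 2 1)) = lambert 1 1 3 - 16 * lambert 1 2 3
      + (lambert 1 1 1 - 4 * lambert 1 2 1) + 4 * (lambert 1 1 1 - 4 * lambert 1 2 1) ^ 2 ∧
    2 * (qD (qD (lambert 1 1 1)) - 4 * qD (qD (lambert 1 2 1))) = qD (lambert 1 1 3)
      - 16 * qD (lambert 1 2 3) + (qD (lambert 1 1 1) - 4 * qD (lambert 1 2 1))
      + 8 * (lambert 1 1 1 - 4 * lambert 1 2 1) * (qD (lambert 1 1 1) - 4 * qD (lambert 1 2 1)) ∧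
    2 * (qD (lambert 1 1 3) - 16 * qD (lambert 1 2 3)) = lambert 1 1 5 - 64 * lambert 1 2 5
      + 2 * (lambert 1 1 3 - 16 * lambert 1 2 3) - (lambert 1 1 1 - 4 * lambert 1 2 1)
      + 16 * (lambert 1 1 1 - 4 * lambert 1 2 1) * (lambert 1 1 3 - 16 * lambert 1 2 3)) := by
  obtain ⟨a1, a3⟩ := qD_lambert one_pos
  obtain ⟨b1, b3⟩ := qD_lambert two_pos
  obtain ⟨z1, z3⟩ := qD_lambert_neg_one
  have l1 := lambert_neg_one 1
  have l3 := lambert_neg_one 3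
  have l5 := lambert_neg_one 5
  norm_num at l1 l3 l5
  -- Rewriting the series with sign -1 as 2^(k+1) B_k - A_k turns the third theta function's
  -- equations into relations linking the A's and the B's.
  rw [l1, l3, map_sub, qD_ofNat_mul] at z1
  rw [l1, l3, l5, map_sub, qD_ofNat_mul] at z3
  push_cast at a1 a3 b1 b3
  rw [one_mul] at a1 a3
  have z1' : 2 * (qD (lambert 1 1 1) - 4 * qD (lambert 1 2 1)) = lambert 1 1 3 - 16 * lambert 1 2 3
      + (lambert 1 1 1 - 4 * lambert 1 2 1) + 4 * (lambert 1 1 1 - 4 * lambert 1 2 1) ^ 2 := by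
    linear_combination z1
  have a2 := congrArg qD a1
  have b2 := congrArg qD b1
  have z2 := congrArg qD z1'
  simp only [sq, map_add, map_sub, qD_ofNat, Derivation.leibniz, smul_eq_mul, mul_zero,
    add_zero] at a2 b2 z2
  refine ⟨⟨a1, ?_, a3⟩, ⟨b1, ?_, b3⟩, z1', ?_, ?_⟩
  · linear_combination a2
  · linear_combination b2
  · linear_combination z2
  · linear_combination z3

theorem qD_qD_mul (f g : QSer) :
    qD (qD (f * g)) = qD (qD f) * g + 2 * qD f * qD g + f * qD (qD g) := by
  simp only [Derivation.leibniz, map_add, smul_eq_mul]; ring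

-- Here M and S stand for the two crank series, R for the rank series, with the same value at z = 1.
-- The identity is proved with q∂q in place of the factor n, and coefficients are taken only at the
-- end.
set_option linter.unusedSimpArgs false in
theorem rank_mom_six {R M S : BiSeries} (hR : zInv R = R)
    (hM : ∀ j ≤ 6, mom j M = mom 0 R * expMom (lambert 1 1 1) (lambert 1 1 3) (lambert 1 1 5) j)
    (hS : ∀ j ≤ 6, mom j S = mom 0 R * expMom (lambert 1 2 1) (lambert 1 2 3) (lambert 1 2 5) j)
    (h : ∃ u v, v ≠ 0 ∧
      kK v * (heatOp 2 R * thetaProd 1 1 ^ 3) = kK u * (zT 1 * theta (-1) 1)) (n : ℕ) :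
    coeff n (mom 6 R) =
        (3 + 20 * (n : ℚ) + 48 * (n : ℚ) ^ 2) * coeff n (mom 2 R)
        + (2192796 / 274505 + 123276 / 7595 * (n : ℚ) + (-5185344) / 1921535 * (n : ℚ) ^ 2)
          * coeff n (mom 2 M)
        + ((-445728) / 54901 + (-5730048) / 384307 * (n : ℚ)) * coeff n (mom 4 M)
        + 5376 / 3565 * coeff n (mom 6 M)
        + ((-386988) / 39215 + (-54556468) / 1921535 * (n : ℚ)
            + (-30679392) / 1921535 * (n : ℚ) ^ 2) * coeff n (mom 2 S)
        + (96204 / 7843 + 1412352 / 54901 * (n : ℚ)) * coeff n (mom 4 S)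
        + (-9056) / 3565 * coeff n (mom 6 S) := by
  obtain ⟨u, v, hv, h⟩ := h
  obtain ⟨⟨a1, a2, a3⟩, ⟨b1, b2, b3⟩, z1, z2, z3⟩ := lambert_relations
  have l1 := lambert_neg_one 1
  have l3 := lambert_neg_one 3
  have l5 := lambert_neg_one 5
  norm_num at l1 l3 l5
  -- The arguments are 3 A_k - (2^(k+1) B_k - A_k) for k = 1, 3, 5.
  obtain ⟨r2, r4, r6⟩ := mom_of_heatOp one_pos hR hv h
    (x₁ := 4 * lambert 1 1 1 - 4 * lambert 1 2 1)
    (x₃ := 4 * lambert 1 1 3 - 16 * lambert 1 2 3)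
    (x₅ := 4 * lambert 1 1 5 - 64 * lambert 1 2 5)
    (by rw [l1]; ring) (by rw [l3]; ring) (by rw [l5]; ring)
  have hM2 := hM 2 (by norm_num)
  have hM4 := hM 4 (by norm_num)
  have hM6 := hM 6 (by norm_num)
  have hS2 := hS 2 (by norm_num)
  have hS4 := hS 4 (by norm_num)
  have hS6 := hS 6 (by norm_num)
  simp only [expMom] at hM2 hM4 hM6 hS2 hS4 hS6
  push_cast at r2 r4 r6
  set P := mom 0 R
  set y := mom 2 R
  set r₄ := mom 4 R
  set r₆ := mom 6 R
  have hP : qD P = P * (2 * lambert 1 1 1 - 2 * lambert 1 2 1) := by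
    have : (4 : QSer) * qD P = 4 * (P * (2 * lambert 1 1 1 - 2 * lambert 1 2 1)) := by
      linear_combination r2
    exact mul_left_cancel₀ (by norm_num) this
  have hP2 := congrArg qD hP
  have hr4 : 3 * r₄ = P * (2 * (4 * lambert 1 1 3 - 16 * lambert 1 2 3)
      + 12 * (4 * lambert 1 1 1 - 4 * lambert 1 2 1) ^ 2
      - 2 * (4 * lambert 1 1 1 - 4 * lambert 1 2 1)) - 24 * qD y - 3 * y := by
    linear_combination r4
  have hdr4 := congrArg qD hr4
  have key : r₆ = 3 * y + 20 * qD y + 48 * qD (qD y)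
      + (C (2192796 / 274505) * mom 2 M + C (123276 / 7595) * qD (mom 2 M)
        - C (5185344 / 1921535) * qD (qD (mom 2 M)))
      + (C (-445728 / 54901) * mom 4 M - C (5730048 / 384307) * qD (mom 4 M))
      + C (5376 / 3565) * mom 6 M
      + (C (-386988 / 39215) * mom 2 S - C (54556468 / 1921535) * qD (mom 2 S)
        - C (30679392 / 1921535) * qD (qD (mom 2 S)))
      + (C (96204 / 7843) * mom 4 S + C (1412352 / 54901) * qD (mom 4 S))
      - C (9056 / 3565) * mom 6 S := by
    rw [hM2, hM4, hM6, hS2, hS4, hS6, qD_qD_mul, qD_qD_mul]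
    simp only [sq, map_add, map_sub, qD_ofNat, Derivation.leibniz, smul_eq_mul, mul_zero, add_zero,
    zero_mul, zero_add, map_zero] at hP2 hdr4 ⊢
    -- The elimination divides by integers and is stated over a field, so it is carried out in the
    -- fraction field and pulled back by injectivity.
    let ι := algebraMap QSer (FractionRing QSer)
    have hι : Function.Injective ι := IsFractionRing.injective QSer (FractionRing QSer)
    have hC : ∀ c : ℚ, ι (C c) = (c : FractionRing QSer) := fun c => eq_ratCast (ι.comp C) c
    have : CharZero (FractionRing QSer) := charZero_of_injective_algebraMap hι
    apply hι
    have key := rank_six_field (F := FractionRing QSer) (P := ι P) (dP := ι (qD P))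
      (ddP := ι (qD (qD P)))
      (A₁ := ι (lambert 1 1 1)) (A₃ := ι (lambert 1 1 3)) (A₅ := ι (lambert 1 1 5))
      (dA₁ := ι (qD (lambert 1 1 1))) (ddA₁ := ι (qD (qD (lambert 1 1 1))))
      (dA₃ := ι (qD (lambert 1 1 3)))
      (B₁ := ι (lambert 1 2 1)) (B₃ := ι (lambert 1 2 3)) (B₅ := ι (lambert 1 2 5))
      (dB₁ := ι (qD (lambert 1 2 1))) (ddB₁ := ι (qD (qD (lambert 1 2 1))))
      (dB₃ := ι (qD (lambert 1 2 3)))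
      (y := ι y) (dy := ι (qD y)) (ddy := ι (qD (qD y))) (r₄ := ι r₄) (dr₄ := ι (qD r₄))
      (r₆ := ι r₆)
      (by simpa only [map_add, map_sub, map_mul, map_pow, map_neg, map_ofNat, map_one] using
        congrArg ι hP) (by
        have := congrArg ι hP2
        simp only [map_add, map_sub, map_mul, map_pow, map_neg, map_ofNat, map_one] at this
        linear_combination this)
      (by
        have := congrArg ι a1
        simp only [map_add, map_sub, map_mul, map_pow, map_neg, map_ofNat, map_one] at this
        exact this) (by
        have := congrArg ι a2
        simp only [map_add, map_sub, map_mul, map_pow, map_neg, map_ofNat, map_one] at this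
        exact this) (by
        have := congrArg ι a3
        simp only [map_add, map_sub, map_mul, map_pow, map_neg, map_ofNat, map_one] at this
        exact this)
      (by
        have := congrArg ι b1
        simp only [map_add, map_sub, map_mul, map_pow, map_neg, map_ofNat, map_one] at this
        exact this) (by
        have := congrArg ι b2
        simp only [map_add, map_sub, map_mul, map_pow, map_neg, map_ofNat, map_one] at this
        exact this) (by
        have := congrArg ι b3
        simp only [map_add, map_sub, map_mul, map_pow, map_neg, map_ofNat, map_one] at this
        exact this)
      (by
        have := congrArg ι z1
        simp only [map_add, map_sub, map_mul, map_pow, map_neg, map_ofNat, map_one] at this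
        exact this) (by
        have := congrArg ι z2
        simp only [map_add, map_sub, map_mul, map_pow, map_neg, map_ofNat, map_one] at this
        exact this) (by
        have := congrArg ι z3
        simp only [map_add, map_sub, map_mul, map_pow, map_neg, map_ofNat, map_one] at this
        exact this)
      (by
        have := congrArg ι hr4
        simp only [map_add, map_sub, map_mul, map_pow, map_neg, map_ofNat, map_one] at this
        linear_combination this)
      (by
        have := congrArg ι hdr4
        simp only [map_add, map_sub, map_mul, map_pow, map_neg, map_ofNat, map_one] at this
        linear_combination this)
      (by
        have := congrArg ι r6
        simp only [map_add, map_sub, map_mul, map_pow, map_neg, map_ofNat, map_one] at this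
        linear_combination this)
    simp only [map_add, map_sub, map_mul, map_pow, hC, map_ofNat]
    push_cast
    linear_combination key
  rw [key]
  have hn : ∀ (k : ℕ) [k.AtLeastTwo] (f : QSer), coeff n ((ofNat(k) : QSer) * f) =
      ofNat(k) * coeff n f := fun k _ f => by
    rw [← map_ofNat (C : ℚ →+* QSer), coeff_C_mul]
  simp only [map_add, map_sub, coeff_C_mul, coeff_qD, hn]
  ring

set_option linter.unusedSimpArgs false in
theorem m2Rank_mom_six {R M S : BiSeries} (hR : zInv R = R)
    (hM : ∀ j ≤ 6, mom j M = mom 0 R * expMom (lambert 1 1 1) (lambert 1 1 3) (lambert 1 1 5) j)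
    (hS : ∀ j ≤ 6, mom j S = mom 0 R * expMom (lambert 1 2 1) (lambert 1 2 3) (lambert 1 2 5) j)
    (h : ∃ u v, v ≠ 0 ∧
      kK v * (heatOp 1 R * thetaProd 1 2 ^ 3) = kK u * (zT 1 * theta (-1) 1)) (n : ℕ) :
    coeff n (mom 6 R) =
        (3 + 5 * (n : ℚ) + 3 * (n : ℚ) ^ 2) * coeff n (mom 2 R)
        + (249003 / 274505 + 36273 / 83545 * (n : ℚ) + (-162042) / 1921535 * (n : ℚ) ^ 2)
          * coeff n (mom 2 M)
        + ((-46014) / 54901 + (-179064) / 384307 * (n : ℚ)) * coeff n (mom 4 M)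
        + 168 / 3565 * coeff n (mom 6 M)
        + ((-765123) / 274505 + 6826601 / 1921535 * (n : ℚ)
            + 4805874 / 1921535 * (n : ℚ) ^ 2) * coeff n (mom 2 S)
        + (39102 / 7843 + 44136 / 54901 * (n : ℚ)) * coeff n (mom 4 S)
        + (-3848) / 3565 * coeff n (mom 6 S) := by
  obtain ⟨u, v, hv, h⟩ := h
  obtain ⟨⟨a1, a2, a3⟩, ⟨b1, b2, b3⟩, z1, z2, z3⟩ := lambert_relations
  have l1 := lambert_neg_one 1
  have l3 := lambert_neg_one 3
  have l5 := lambert_neg_one 5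
  norm_num at l1 l3 l5
  -- Now the cubed product is in q², so the arguments are 3 B_k - (2^(k+1) B_k - A_k).
  obtain ⟨r2, r4, r6⟩ := mom_of_heatOp two_pos hR hv h
    (x₁ := lambert 1 1 1 - lambert 1 2 1)
    (x₃ := lambert 1 1 3 - 13 * lambert 1 2 3)
    (x₅ := lambert 1 1 5 - 61 * lambert 1 2 5)
    (by rw [l1]; ring) (by rw [l3]; ring) (by rw [l5]; ring)
  have hM2 := hM 2 (by norm_num)
  have hM4 := hM 4 (by norm_num)
  have hM6 := hM 6 (by norm_num)
  have hS2 := hS 2 (by norm_num)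
  have hS4 := hS 4 (by norm_num)
  have hS6 := hS 6 (by norm_num)
  simp only [expMom] at hM2 hM4 hM6 hS2 hS4 hS6
  push_cast at r2 r4 r6
  set P := mom 0 R
  set y := mom 2 R
  set r₄ := mom 4 R
  set r₆ := mom 6 R
  have hP : qD P = P * (2 * lambert 1 1 1 - 2 * lambert 1 2 1) := by linear_combination r2
  have hP2 := congrArg qD hP
  have hr4 : 3 * r₄ = P * (2 * (lambert 1 1 3 - 13 * lambert 1 2 3)
      + 12 * (lambert 1 1 1 - lambert 1 2 1) ^ 2
      - 2 * (lambert 1 1 1 - lambert 1 2 1)) - 6 * qD y - 3 * y := by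
    linear_combination r4
  have hdr4 := congrArg qD hr4
  have key : r₆ = 3 * y + 5 * qD y + 3 * qD (qD y)
      + (C (249003 / 274505) * mom 2 M + C (36273 / 83545) * qD (mom 2 M)
        - C (162042 / 1921535) * qD (qD (mom 2 M)))
      + (C (-46014 / 54901) * mom 4 M - C (179064 / 384307) * qD (mom 4 M))
      + C (168 / 3565) * mom 6 M
      + (C (-765123 / 274505) * mom 2 S + C (6826601 / 1921535) * qD (mom 2 S)
        + C (4805874 / 1921535) * qD (qD (mom 2 S)))
      + (C (39102 / 7843) * mom 4 S + C (44136 / 54901) * qD (mom 4 S))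
      - C (3848 / 3565) * mom 6 S := by
    rw [hM2, hM4, hM6, hS2, hS4, hS6, qD_qD_mul, qD_qD_mul]
    simp only [sq, map_add, map_sub, qD_ofNat, Derivation.leibniz, smul_eq_mul, mul_zero, add_zero,
    zero_mul, zero_add, map_zero] at hP2 hdr4 ⊢
    let ι := algebraMap QSer (FractionRing QSer)
    have hι : Function.Injective ι := IsFractionRing.injective QSer (FractionRing QSer)
    have hC : ∀ c : ℚ, ι (C c) = (c : FractionRing QSer) := fun c => eq_ratCast (ι.comp C) c
    have : CharZero (FractionRing QSer) := charZero_of_injective_algebraMap hι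
    apply hι
    have key := m2Rank_six_field (F := FractionRing QSer) (P := ι P) (dP := ι (qD P))
      (ddP := ι (qD (qD P)))
      (A₁ := ι (lambert 1 1 1)) (A₃ := ι (lambert 1 1 3)) (A₅ := ι (lambert 1 1 5))
      (dA₁ := ι (qD (lambert 1 1 1))) (ddA₁ := ι (qD (qD (lambert 1 1 1))))
      (dA₃ := ι (qD (lambert 1 1 3)))
      (B₁ := ι (lambert 1 2 1)) (B₃ := ι (lambert 1 2 3)) (B₅ := ι (lambert 1 2 5))
      (dB₁ := ι (qD (lambert 1 2 1))) (ddB₁ := ι (qD (qD (lambert 1 2 1))))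
      (dB₃ := ι (qD (lambert 1 2 3)))
      (y := ι y) (dy := ι (qD y)) (ddy := ι (qD (qD y))) (r₄ := ι r₄) (dr₄ := ι (qD r₄))
      (r₆ := ι r₆)
      (by simpa only [map_add, map_sub, map_mul, map_pow, map_neg, map_ofNat, map_one] using
        congrArg ι hP) (by
        have := congrArg ι hP2
        simp only [map_add, map_sub, map_mul, map_pow, map_neg, map_ofNat, map_one] at this
        linear_combination this)
      (by
        have := congrArg ι a1
        simp only [map_add, map_sub, map_mul, map_pow, map_neg, map_ofNat, map_one] at this
        exact this) (by
        have := congrArg ι a2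
        simp only [map_add, map_sub, map_mul, map_pow, map_neg, map_ofNat, map_one] at this
        exact this) (by
        have := congrArg ι a3
        simp only [map_add, map_sub, map_mul, map_pow, map_neg, map_ofNat, map_one] at this
        exact this)
      (by
        have := congrArg ι b1
        simp only [map_add, map_sub, map_mul, map_pow, map_neg, map_ofNat, map_one] at this
        exact this) (by
        have := congrArg ι b2
        simp only [map_add, map_sub, map_mul, map_pow, map_neg, map_ofNat, map_one] at this
        exact this) (by
        have := congrArg ι b3
        simp only [map_add, map_sub, map_mul, map_pow, map_neg, map_ofNat, map_one] at this
        exact this)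
      (by
        have := congrArg ι z1
        simp only [map_add, map_sub, map_mul, map_pow, map_neg, map_ofNat, map_one] at this
        exact this) (by
        have := congrArg ι z2
        simp only [map_add, map_sub, map_mul, map_pow, map_neg, map_ofNat, map_one] at this
        exact this) (by
        have := congrArg ι z3
        simp only [map_add, map_sub, map_mul, map_pow, map_neg, map_ofNat, map_one] at this
        exact this)
      (by
        have := congrArg ι hr4
        simp only [map_add, map_sub, map_mul, map_pow, map_neg, map_ofNat, map_one] at this
        linear_combination this)
      (by
        have := congrArg ι hdr4
        simp only [map_add, map_sub, map_mul, map_pow, map_neg, map_ofNat, map_one] at this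
        linear_combination this)
      (by
        have := congrArg ι r6
        simp only [map_add, map_sub, map_mul, map_pow, map_neg, map_ofNat, map_one] at this
        linear_combination this)
    simp only [map_add, map_sub, map_mul, map_pow, hC, map_ofNat]
    push_cast
    linear_combination key
  rw [key]
  have hn : ∀ (k : ℕ) [k.AtLeastTwo] (f : QSer), coeff n ((ofNat(k) : QSer) * f) =
      ofNat(k) * coeff n f := fun k _ f => by
    rw [← map_ofNat (C : ℚ →+* QSer), coeff_C_mul]
  simp only [map_add, map_sub, coeff_C_mul, coeff_qD, hn]
  ring

/-! ### Functional equations of rank sequences -/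

/-- Two complementary recursions for `S` force `S (-m) = C - S m`, hence the symmetry of `r`. -/
theorem symm_of_recursion {S r : ℤ → QSer} {C : QSer} {s e : ℕ} (hse : s * e = 2)
    (h1 : ∀ m : ℕ, 1 ≤ m → S (m - e) = X ^ (s * m - 1) * (C - S m) + if m = e then 1 else 0)
    (h2 : ∀ M : ℕ, S (-M) = C - (if M = 0 then 1 else 0) - X ^ (s * (M + e) - 1) * S (-M - e))
    (h3 : ∀ m, S m - S (m - 1) = -(r m + r (m - 1))) :
    (∀ m, r (-m) = r m) ∧ (∀ m, S (-m) - S (-(m - 1)) = r m + r (m - 1)) ∧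
      ∀ m : ℕ, 1 ≤ m → S (-(e - m)) = X ^ (s * m - 1) * S (-m) + if m = e then 1 else 0 := by
  have he : 0 < e := Nat.pos_of_ne_zero fun h => by simp [h] at hse
  have hs : 0 < s := Nat.pos_of_ne_zero fun h => by simp [h] at hse
  -- The defect of antisymmetry at M is a positive power of q times the negative of the defect at M
  -- + e; iterating, it is divisible by every power of q and hence zero.
  have hd : ∀ M : ℕ, S (-M) - C + S M =
      -(X ^ (s * (M + e) - 1) * (S (-(M + e : ℕ)) - C + S (M + e : ℕ))) := fun M => by
    have a := h1 (M + e) (by omega)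
    have b := h2 M
    rw [show ((M + e : ℕ) : ℤ) - e = M by push_cast; ring] at a
    rw [show -(M : ℤ) - e = -((M + e : ℕ) : ℤ) by push_cast; ring] at b
    have c : (if M + e = e then (1 : QSer) else 0) = if M = 0 then 1 else 0 := by
      simp
    rw [c] at a
    linear_combination a + b
  have hdvd : ∀ k M : ℕ, X ^ k ∣ S (-M) - C + S M := fun k => by
    induction k with
    | zero => simp
    | succ k ih =>
      intro M
      rw [hd, dvd_neg, pow_succ']
      refine mul_dvd_mul (dvd_pow_self X ?_) (ih _)
      have : s * (M + e) = s * M + 2 := by rw [mul_add, hse]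
      omega
  have hN : ∀ M : ℕ, S (-M) = C - S M := fun M => by
    have := eq_zero_of_forall_X_pow_dvd fun k => hdvd k M
    linear_combination this
  have hS : ∀ m, S (-m) = C - S m := fun m => by
    rcases Int.natAbs_eq m with h | h
    · rw [h]; exact hN _
    · rw [h, neg_neg, hN]; ring
  have hdiff : ∀ m, S (-m) - S (-(m - 1)) = r m + r (m - 1) := fun m => by
    rw [hS, hS]; linear_combination -h3 m
  refine ⟨?_, hdiff, fun m hm => ?_⟩
  · have hk : ∀ m, r m + r (m - 1) = r (-m) + r (-(m - 1)) := fun m => by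
      have := h3 (1 - m)
      rw [show (1 - m - 1 : ℤ) = -m by ring, show (1 - m : ℤ) = -(m - 1) by ring] at this
      rw [← hdiff]; linear_combination -this
    have hn : ∀ m : ℕ, r (-m) = r m := fun m => by
      induction m with
      | zero => simp
      | succ m ih =>
        have := hk (m + 1 : ℕ)
        rw [show ((m + 1 : ℕ) : ℤ) - 1 = m by push_cast; ring] at this
        linear_combination -this - ih
    intro m
    rcases Int.natAbs_eq m with h | h
    · rw [h]; exact hn _
    · rw [h, neg_neg]; exact (hn _).symm
  · rw [neg_sub, h1 m hm, hS]

/-- As series in z the hypotheses read (1+z) f + (1/z - 1) U = -1 and (1+zq) fh = q (z - z²q) U -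
qz, with fh(z) = f(zq). Since (1+zq) f(zq) is the first combination (1+z) f taken at zq, f can be
eliminated, leaving a recursion for U alone. -/
theorem rank_recursion {f fh U : ℤ → QSer}
    (e1 : ∀ m, f m + f (m - 1) + U (m + 1) - U m = -if m = 0 then 1 else 0)
    (e2 : ∀ m, fh m + X * fh (m - 1) =
      X * (U (m - 1) - X * U (m - 2) - if m = 1 then 1 else 0))
    (hp : ∀ m : ℕ, fh m = X ^ m * f m) (hn : ∀ M : ℕ, f (-M) = X ^ M * fh (-M)) :
    ∃ (S : ℤ → QSer) (C : QSer),
    (∀ m : ℕ, 1 ≤ m → S (m - 2) = X ^ (m - 1) * (C - S m) + if m = 2 then 1 else 0) ∧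
    (∀ M : ℕ, S (-M) = C - (if M = 0 then 1 else 0) - X ^ (M + 2 - 1) * S (-M - 2)) ∧
    (∀ m, S m - S (m - 1) = -((2 * f m + if m = 0 then 1 else 0) +
      (2 * f (m - 1) + if m - 1 = 0 then 1 else 0))) := by
  set c := U 1 + X * U (-1) + 1 with hc
  -- Elimination of f shows that the left side is multiplied by q when m increases by one; the
  -- exceptional index m = 1 of the second equation enters the base case and fixes the constant.
  have hV : ∀ m : ℕ, X ^ (m + 1) * U (m + 2) + X * U m = X ^ (m + 1) * c := fun m => by
    induction m with
    | zero =>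
      have a := e1 1
      have b := e2 1
      have p1 := hp 1
      have p0 := hp 0
      simp only [Nat.cast_zero, Nat.cast_one, pow_zero, pow_one] at p1 p0
      norm_num at a b ⊢
      rw [hc]
      rw [p1, p0] at b
      linear_combination X * a - b
    | succ m ih =>
      have a := e1 (m + 2 : ℕ)
      have b := e2 (m + 2 : ℕ)
      have p1 := hp (m + 2)
      have p0 := hp (m + 1)
      rw [show ((m + 2 : ℕ) : ℤ) - 1 = (m + 1 : ℕ) by push_cast; ring,
        if_neg (by omega)] at a b
      rw [p1, p0] at b
      push_cast at a b ⊢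
      rw [show (m : ℤ) + 2 - 2 = m by ring] at b
      rw [show (m : ℤ) + 1 + 2 = m + 2 + 1 by ring]
      linear_combination X ^ (m + 2) * a - b + X * ih
  have hV' : ∀ M : ℕ, U (-M) + X ^ (M + 2) * U (-M - 2) = c := fun M => by
    induction M with
    | zero =>
      have a := e1 0
      have b := e2 0
      have p1 := hn 1
      have p0 := hn 0
      simp only [Nat.cast_zero, Nat.cast_one, pow_zero, pow_one, neg_zero] at p1 p0
      norm_num at a b ⊢
      rw [p1, p0] at a
      rw [hc]
      linear_combination -a + b
    | succ M ih =>
      have a := e1 (-(M + 1 : ℕ))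
      have b := e2 (-(M + 1 : ℕ))
      have p1 := hn (M + 1)
      have p0 := hn (M + 2)
      rw [show (-((M + 1 : ℕ) : ℤ)) - 1 = -(M + 2 : ℕ) by push_cast; ring,
        if_neg (by omega)] at a b
      rw [p1, p0] at a
      push_cast at a b ⊢
      rw [show (-((M : ℤ) + 1) + 1) = -M by ring] at a
      rw [show -((M : ℤ) + 2) = -M - 2 by ring] at a b
      linear_combination -a + ih + X ^ (M + 1) * b
  -- The shift and the Kronecker delta make the first equation become (1-z) S = -(1+z)(1 + 2f), and
  -- 1 + 2f will be the rank series.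
  refine ⟨fun m => 2 * U (m + 1) + if m = 0 then 1 else 0, 2 * c, fun m hm => ?_, fun M => ?_,
    fun m => ?_⟩
  · obtain ⟨k, rfl⟩ := Nat.exists_eq_add_of_le' hm
    have := hV k
    apply mul_left_cancel₀ (X_ne_zero (R := ℚ))
    push_cast
    rw [show (k : ℤ) + 1 - 2 + 1 = k by ring, show (k : ℤ) + 1 + 1 = k + 2 by ring,
      if_neg (by omega : ¬ ((k : ℤ) + 1 = 0))]
    have h : (if (k : ℤ) + 1 - 2 = 0 then (1 : QSer) else 0) = if k = 1 then 1 else 0 := by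
      congr 1; simp only [eq_iff_iff]; omega
    rw [h]
    linear_combination 2 * this
  · have h : (if -(M : ℤ) = 0 then (1 : QSer) else 0) = if M = 0 then 1 else 0 := by simp
    simp only [h]
    rw [if_neg (by omega : ¬ (-(M : ℤ) - 2 = 0))]
    rcases M with _ | M
    · simp; rw [hc]; ring
    · have := hV' M
      rw [if_neg (by omega)]
      push_cast
      rw [show (-((M : ℤ) + 1) + 1) = -M by ring, show (-((M : ℤ) + 1) - 2 + 1) = -M - 2 by ring]
      linear_combination 2 * this
  · have := e1 m
    have h : (if m - 1 = 0 then (1 : QSer) else 0) = if m = 1 then 1 else 0 := by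
      simp [sub_eq_zero]
    simp only
    rw [sub_add_cancel]
    linear_combination 2 * this

/-- A factor 1 + z q^a can annihilate a nonzero two-sided sequence, but such a sequence is a
multiple of (-q^a)^m, whose pole at m = -M grows like a M. The hypothesis bounds the pole by b M + c
with b < a, so the factor may be cancelled. -/
theorem eq_zero_of_geometric {L : Type*} [Field L] {ι : QSer →+* L} (hι : Function.Injective ι)
    {a b c : ℕ} (hab : b < a) {Y : ℤ → L} (h : ∀ m, Y m = -(ι X) ^ a * Y (m - 1))
    (hb : ∀ M : ℕ, ∃ y, (ι X) ^ (b * M + c) * Y (-M) = ι y) (m : ℤ) : Y m = 0 := by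
  have hq : ι X ≠ 0 := (map_ne_zero_iff ι hι).2 X_ne_zero
  have hM : ∀ M : ℕ, Y 0 = (-(ι X) ^ a) ^ M * Y (-M) := fun M => by
    induction M with
    | zero => simp
    | succ M ih =>
      rw [ih, h (-M), pow_succ, mul_assoc]
      push_cast
      rw [neg_add]
      rfl
  obtain ⟨y₀, hy₀⟩ := hb 0
  have h0 : y₀ = 0 := eq_zero_of_forall_X_pow_dvd fun M => by
    obtain ⟨y, hy⟩ := hb M
    refine ⟨(-1) ^ M * X ^ ((a - b - 1) * M) * y, ?_⟩
    have h1 : X ^ (b * M) * y₀ =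
        X ^ (b * M) * (X ^ M * ((-1) ^ M * X ^ ((a - b - 1) * M) * y)) := by
      apply hι
      have hexp : a * M = b * M + M + (a - b - 1) * M := by
        obtain ⟨d, rfl⟩ := Nat.exists_eq_add_of_lt hab
        rw [show b + d + 1 - b - 1 = d by omega]; ring
      have h2 : (-(ι X) ^ a) ^ M = (-1) ^ M * ((ι X) ^ (b * M) * (ι X) ^ M *
          (ι X) ^ ((a - b - 1) * M)) := by
        rw [neg_pow, ← pow_mul, hexp, pow_add, pow_add]
      simp only [map_mul, map_pow, map_neg, map_one]
      rw [← hy₀, ← hy]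
      simp only [mul_zero, zero_add, Nat.cast_zero, neg_zero]
      rw [hM M, h2]
      ring
    exact mul_left_cancel₀ (pow_ne_zero _ X_ne_zero) h1
  have hY0 : Y 0 = 0 := by
    rw [h0, map_zero] at hy₀
    simpa [hq] using hy₀
  have hnat : ∀ k : ℕ, Y k = 0 := fun k => by
    induction k with
    | zero => exact hY0
    | succ k ih => rw [h]; simp [ih]
  rcases Int.natAbs_eq m with h1 | h1
  · rw [h1]; exact hnat _
  · rw [h1]
    have := hM m.natAbs
    rw [hY0] at this
    exact (mul_eq_zero.1 this.symm).resolve_left (pow_ne_zero _ (neg_ne_zero.2 (pow_ne_zero _ hq)))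

/-- Division by 1 + zq: the expansion ∑ (-zq)^k converges q-adically even on two-sided sequences. -/
theorem exists_add_X_mul_shift (t : ℤ → QSer) : ∃ S : ℤ → QSer, ∀ m, S m + X * S (m - 1) = t m := by
  refine ⟨fun m => mk fun n => ∑ k ∈ Finset.range (n + 1), (-1) ^ k * coeff (n - k) (t (m - k)),
    fun m => ?_⟩
  ext n
  rw [map_add, coeff_mk]
  cases n with
  | zero => simp
  | succ n =>
    rw [coeff_succ_X_mul, coeff_mk, Finset.sum_range_succ']
    simp only [pow_zero, one_mul, Nat.cast_zero, sub_zero, Nat.sub_zero]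
    rw [add_right_comm, ← Finset.sum_add_distrib, Finset.sum_eq_zero, zero_add]
    intro k _
    rw [Nat.succ_sub_succ, sub_sub, pow_succ]
    push_cast
    rw [add_comm (1 : ℤ)]
    ring

/-- The hypotheses read (1+z)(1+zq) f + (1-z) U = -(1+q) z and (1+zq)(1+zq²) fh = q (z - z²q²) U -
q(1+q) z, with fh(z) = f(zq²). Compared with the rank there are extra factors 1 + zq and 1 + zq³,
which have to be cancelled by growth arguments before the recursion appears. -/
theorem m2Rank_recursion {f fh U : ℤ → QSer}
    (e1 : ∀ m, f m + (1 + X) * f (m - 1) + X * f (m - 2) - U (m - 1) + U m =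
      -((1 + X) * if m = 1 then 1 else 0))
    (e2 : ∀ m, fh m + (X + X ^ 2) * fh (m - 1) + X ^ 3 * fh (m - 2) =
      X * (U (m - 1) - X ^ 2 * U (m - 2) - (1 + X) * if m = 1 then 1 else 0))
    (hp : ∀ m : ℕ, fh m = X ^ (2 * m) * f m) (hn : ∀ M : ℕ, f (-M) = X ^ (2 * M) * fh (-M)) :
    ∃ (S : ℤ → QSer) (C : QSer),
    (∀ m : ℕ, 1 ≤ m → S (m - 1) = X ^ (2 * m - 1) * (C - S m) + if m = 1 then 1 else 0) ∧
    (∀ M : ℕ, S (-M) = C - (if M = 0 then 1 else 0) - X ^ (2 * (M + 1) - 1) * S (-M - 1)) ∧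
    (∀ m, S m - S (m - 1) = -((2 * f m + if m = 0 then 1 else 0) +
      (2 * f (m - 1) + if m - 1 = 0 then 1 else 0))) := by
  set δ : ℤ → QSer := fun m => if m = 0 then 1 else 0 with hδ
  have hif : ∀ m j : ℤ, (if m = j then (1 : QSer) else 0) = δ (m - j) := fun m j => by
    simp [hδ, sub_eq_zero]
  have hif0 : ∀ m : ℤ, (if m = 0 then (1 : QSer) else 0) = δ m := fun m => rfl
  simp only [hif _ 1] at e1 e2
  -- S is defined by (1+zq) S = 2U - 1 + zq, chosen so that the first equation becomes (1+zq) times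
  -- (1+z)(1+2f) + (1-z) S = 0.
  obtain ⟨S, hS⟩ := exists_add_X_mul_shift fun m => 2 * U m - δ m + X * δ (m - 1)
  let ι : QSer →+* FractionRing QSer := algebraMap QSer (FractionRing QSer)
  have hι : Function.Injective ι := IsFractionRing.injective QSer (FractionRing QSer)
  set q := ι X with hqdef
  have hq : q ≠ 0 := (map_ne_zero_iff ι hι).2 X_ne_zero
  have hSdiff : ∀ m, S m - S (m - 1) = -((2 * f m + δ m) + (2 * f (m - 1) + δ (m - 1))) := by
    have := eq_zero_of_geometric hι (a := 1) (b := 0) (c := 0) one_pos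
      (Y := fun m => ι (S m - S (m - 1) + ((2 * f m + δ m) + (2 * f (m - 1) + δ (m - 1)))))
      (fun m => by
        rw [← map_pow, ← map_neg, ← map_mul]
        congr 1
        have a := hS m
        have b := hS (m - 1)
        have c := e1 m
        simp only [sub_sub, Int.reduceAdd] at b ⊢
        linear_combination a - b + 2 * c)
      (fun M => ⟨S (-M) - S (-M - 1) + ((2 * f (-M) + δ (-M)) + (2 * f (-M - 1) + δ (-M - 1))),
        by simp⟩)
    intro m
    have h0 := (map_eq_zero_iff ι hι).1 (this m)
    linear_combination h0
  have hF : ∀ m, q ^ (2 * m) * ι (f m) = ι (fh m) := fun m => by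
    rcases Int.natAbs_eq m with h | h
    · rw [h, hp, map_mul, map_pow]
      norm_cast
    · rw [h, hn, map_mul, map_pow, ← mul_assoc, mul_neg, zpow_neg]
      norm_cast
      rw [inv_mul_cancel₀ (pow_ne_zero _ hq), one_mul]
  have hz : ∀ (m : ℤ) (k : ℕ), q ^ (2 * m) = q ^ (2 * k) * q ^ (2 * (m - k)) := fun m k => by
    rw [← zpow_natCast, ← zpow_add₀ hq]; congr 1; push_cast; ring
  have hwδ : ∀ (m : ℤ) (k : ℕ), q ^ (2 * m) * ι (δ (m - k)) = q ^ (2 * k) * ι (δ (m - k)) :=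
    fun m k => by
      rw [hz m k]
      by_cases h : m - k = 0
      · rw [h]; simp
      · simp [hδ, h]
  -- This is S(zq²). Its negative coefficients involve negative powers of q, which is why the
  -- fraction field is needed.
  set Sh : ℤ → FractionRing QSer := fun m => q ^ (2 * m) * ι (S m) with hSh
  have hSh' : ∀ (m : ℤ) (k : ℕ), q ^ (2 * m) * ι (S (m - k)) = q ^ (2 * k) * Sh (m - k) :=
    fun m k => by rw [hz m k]; simp only [hSh]; ring
  have hF' : ∀ (m : ℤ) (k : ℕ), q ^ (2 * m) * ι (f (m - k)) = q ^ (2 * k) * ι (fh (m - k)) :=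
    fun m k => by rw [hz m k, mul_assoc, hF]
  have hA : ∀ m, 2 * ι (fh m) + 2 * (q ^ 2 + q ^ 3) * ι (fh (m - 1)) + 2 * q ^ 5 * ι (fh (m - 2)) +
      (Sh m + (q ^ 3 - q ^ 2) * Sh (m - 1) - q ^ 5 * Sh (m - 2)) +
      (ι (δ m) + (q ^ 2 + q ^ 3) * ι (δ (m - 1)) + q ^ 5 * ι (δ (m - 2))) = 0 := fun m => by
    have a := congrArg ι (e1 m)
    have b := congrArg ι (hS m)
    have c := congrArg ι (hS (m - 1))
    simp only [map_add, map_sub, map_mul, map_neg, map_one, map_ofNat, sub_sub, Int.reduceAdd,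
      ← hqdef] at a b c
    have f0 := hF m
    have f1 := hF' m 1
    have f2 := hF' m 2
    have s1 := hSh' m 1
    have s2 := hSh' m 2
    have d0 := hwδ m 0
    have d1 := hwδ m 1
    have d2 := hwδ m 2
    have s0 : q ^ (2 * m) * ι (S m) = Sh m := rfl
    push_cast at f1 f2 s1 s2 d0 d1 d2
    simp only [sub_zero, pow_zero, one_mul] at f1 s1 d0 d1
    generalize q ^ (2 * m) = w at *
    linear_combination 2 * w * a - 2 * f0 - 2 * (1 + q) * f1 - 2 * q * f2 + w * b - w * c
      - s0 - (q - 1) * s1 + q * s2 - d0 - (1 + q) * d1 - q * d2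
  have hB : ∀ m, 2 * ι (fh m) + 2 * (q + q ^ 2) * ι (fh (m - 1)) + 2 * q ^ 3 * ι (fh (m - 2)) =
      q * (ι (S (m - 1)) + (q - q ^ 2) * ι (S (m - 2)) - q ^ 3 * ι (S (m - 3))) +
      (q * (ι (δ (m - 1)) - (q + q ^ 2) * ι (δ (m - 2)) + q ^ 3 * ι (δ (m - 3)))
        - 2 * (q + q ^ 2) * ι (δ (m - 1))) := fun m => by
    have a := congrArg ι (e2 m)
    have b := congrArg ι (hS (m - 1))
    have c := congrArg ι (hS (m - 2))
    simp only [map_add, map_sub, map_mul, map_pow, map_one, map_ofNat, sub_sub, Int.reduceAdd,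
      ← hqdef] at a b c
    linear_combination 2 * a - q * b + q ^ 3 * c
  -- D = S(zq²) + qz S(z) - qz + 1; the recursion sought says exactly that D is a multiple of the
  -- sequence q^(2m).
  set D : ℤ → FractionRing QSer := fun m => Sh m + q * ι (S (m - 1)) - q * ι (δ (m - 1)) + ι (δ m)
    with hD
  have hDint : ∀ M : ℕ, q ^ (2 * M) * D (-M) =
      ι (S (-M) + X ^ (2 * M + 1) * S (-M - 1) + if M = 0 then 1 else 0) := fun M => by
    have h1 : δ (-(M : ℤ) - 1) = 0 := if_neg (by omega)
    have h2 : q ^ (2 * M) * ι (δ (-M)) = ι (if M = 0 then 1 else 0) := by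
      rcases M with _ | M
      · simp [hδ]
      · rw [if_neg (by omega), show δ (-((M + 1 : ℕ) : ℤ)) = 0 from if_neg (by omega)]; simp
    have h3 : q ^ (2 * M) * Sh (-M) = ι (S (-M)) := by
      simp only [hSh]
      rw [← mul_assoc, mul_neg, zpow_neg]
      norm_cast
      rw [mul_inv_cancel₀ (pow_ne_zero _ hq), one_mul]
    simp only [hD, map_add, map_mul, map_pow, h1, map_zero, ← h2, ← h3, ← hqdef]
    ring
  -- Eliminating fh gives (1+zq³)(1+zq)(1-zq²) D = 0. The pole of D at -M is at most 2M, and 2 < 3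
  -- allows the cancellation of 1 + zq³.
  have hY := eq_zero_of_geometric hι (a := 3) (b := 2) (c := 4) (by norm_num)
    (Y := fun m => D m + (q - q ^ 2) * D (m - 1) - q ^ 3 * D (m - 2))
    (fun m => by
      have a := hA m
      have b := hB m
      have a' := hA (m - 1)
      have b' := hB (m - 1)
      simp only [hD, sub_sub, Int.reduceAdd, ← hqdef] at a b a' b' ⊢
      linear_combination a - b + q * a' - q ^ 3 * b')
    (fun M => by
      have h0 := hDint M
      have h1 := hDint (M + 1)
      have h2 := hDint (M + 2)
      refine ⟨X ^ 4 * (S (-M) + X ^ (2 * M + 1) * S (-M - 1) + if M = 0 then 1 else 0) +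
        (X ^ 3 - X ^ 4) * (S (-(M + 1 : ℕ)) + X ^ (2 * (M + 1) + 1) * S (-(M + 1 : ℕ) - 1)
          + if M + 1 = 0 then 1 else 0) - X ^ 3 * (S (-(M + 2 : ℕ)) + X ^ (2 * (M + 2) + 1) *
          S (-(M + 2 : ℕ) - 1) + if M + 2 = 0 then 1 else 0), ?_⟩
      rw [map_sub, map_add, map_mul, map_mul, map_mul, ← h0, ← h1, ← h2]
      simp only [map_sub, map_pow, ← hqdef]
      push_cast
      rw [show -((M : ℤ) + 1) = -M - 1 by ring, show -((M : ℤ) + 2) = -M - 2 by ring]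
      ring)
  -- Cancelling 1 + zq needs (1-zq²) D to have no pole at all; this follows from the difference
  -- relation for S together with f (-M) = q^(2M) fh (-M).
  have hE := eq_zero_of_geometric hι (a := 1) (b := 0) (c := 0) one_pos
    (Y := fun m => D m - q ^ 2 * D (m - 1))
    (fun m => by
      have a := hY m
      simp only [sub_sub, Int.reduceAdd, ← hqdef] at a ⊢
      linear_combination a)
    (fun M => by
      have h0 := hDint M
      have h1 := hDint (M + 1)
      have h3 := hSdiff (-M)
      refine ⟨X * S (-M - 1) - X ^ 3 * S (-M - 2) - 2 * fh (-M) - 2 * X ^ 2 * fh (-M - 1), ?_⟩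
      have h4 := hn M
      have h5 := hn (M + 1)
      have h6 : δ (-M - 1) = 0 := if_neg (by omega)
      have h7 : δ (-M) = if M = 0 then 1 else 0 := by simp [hδ]
      rw [if_neg (by omega : ¬ (M + 1 = 0))] at h1
      push_cast at h1 h5
      rw [show -((M : ℤ) + 1) = -M - 1 by ring] at h1 h5
      rw [sub_sub, one_add_one_eq_two] at h1
      rw [h6, h7, h4, h5] at h3
      apply mul_left_cancel₀ (pow_ne_zero (2 * M) hq)
      have h8 := congrArg ι h3
      simp only [map_add, map_sub, map_neg, map_mul, map_pow, map_ofNat, ← hqdef, map_zero]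
        at h0 h1 h8 ⊢
      linear_combination h0 - h1 + h8)
  have hD0 : D 0 = ι (S 0 + X * S (-1) + 1) := by simpa using hDint 0
  -- The factor 1 - zq² is not cancelled: its kernel is spanned by q^(2m), and D 0 supplies the
  -- constant.
  refine ⟨S, S 0 + X * S (-1) + 1, ?_, ?_, ?_⟩
  · have hnat : ∀ m : ℕ, D m = q ^ (2 * m) * D 0 := fun m => by
      induction m with
      | zero => simp
      | succ m ih =>
        have := hE (m + 1 : ℕ)
        push_cast at this ⊢
        rw [add_sub_cancel_right, ih] at this
        linear_combination this
    intro m hm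
    obtain ⟨k, rfl⟩ := Nat.exists_eq_add_of_le' hm
    have := hnat (k + 1)
    rw [hD0] at this
    apply mul_left_cancel₀ (X_ne_zero (R := ℚ))
    apply hι
    have h1 : (if k + 1 = 1 then (1 : QSer) else 0) = δ (k + 1 - 1) := by simp [hδ]
    have h2 : δ (k + 1) = 0 := if_neg (by omega)
    have h3 : q ^ (2 * ((k : ℤ) + 1)) = q ^ (2 * k + 2) := by norm_cast
    rw [h1, show 2 * (k + 1) - 1 = 2 * k + 1 by omega]
    simp only [hD, hSh] at this
    push_cast at this ⊢
    rw [h2, h3] at this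
    simp only [map_add, map_sub, map_mul, map_pow, map_one, map_zero, ← hqdef] at this ⊢
    linear_combination this
  · have hneg : ∀ M : ℕ, q ^ (2 * M) * D (-M) = D 0 := fun M => by
      induction M with
      | zero => simp
      | succ M ih =>
        have := hE (-M)
        push_cast
        rw [show -((M : ℤ) + 1) = -M - 1 by ring]
        rw [← ih]
        linear_combination -q ^ (2 * M) * this
    intro M
    have := hneg M
    rw [hDint, hD0] at this
    have h1 := hι this
    rw [show 2 * (M + 1) - 1 = 2 * M + 1 by omega]
    linear_combination h1
  · intro m
    rw [hif _ 0, hif _ 0, sub_zero, sub_zero]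
    exact hSdiff m

/-! ### Series in nonnegative powers of `z` and their rescalings -/

theorem zc_X_pow_mul (k : ℤ) (a : ℕ) (f : BiSeries) : zc k (X ^ a * f) = X ^ a * zc k f := by
  rw [← kK_X, ← map_pow, zc_kK_mul]

/-- The series `1 / (1 - z q ^ d)`. -/
noncomputable def geo (d : ℕ) : BiSeries := 1 + zGeom 1 1 d

theorem one_sub_mul_geo {d : ℕ} (hd : 0 < d) : (1 - zT 1 * X ^ d) * geo d = 1 := by
  have := one_sub_mul_zGeom 1 1 hd
  simp only [map_one, one_mul] at this
  rw [geo]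
  linear_combination this

theorem zc_geo {d : ℕ} (hd : 0 < d) :
    (∀ k < 0, zc k (geo d) = 0) ∧ ∀ n : ℕ, zc n (geo d) = X ^ (d * n) := by
  have h : ∀ k, zc k (geo d) = X ^ d * zc (k - 1) (geo d) + if k = 0 then 1 else 0 := fun k => by
    have := congrArg (zc k) (one_sub_mul_geo hd)
    rw [sub_mul, one_mul, map_sub, mul_assoc, zc_zT_mul, zc_X_pow_mul, zc_one] at this
    linear_combination this
  have hneg : ∀ j : ℕ, ∀ k < 0, X ^ j ∣ zc k (geo d) := fun j => by
    induction j with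
    | zero => simp
    | succ j ih =>
      intro k hk
      rw [h, if_neg hk.ne, add_zero, pow_succ']
      exact mul_dvd_mul (dvd_pow_self X hd.ne') (ih _ (by omega))
  have hneg' : ∀ k < 0, zc k (geo d) = 0 := fun k hk =>
    eq_zero_of_forall_X_pow_dvd fun j => hneg j k hk
  refine ⟨hneg', fun n => ?_⟩
  induction n with
  | zero => rw [Nat.cast_zero, h, hneg' _ (by norm_num)]; simp
  | succ n ih =>
    rw [h, if_neg (by omega)]
    push_cast
    rw [add_sub_cancel_right, ih]
    ring

/-- `g` is a series in nonnegative powers of `z q` and `g'` is obtained from it by the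
substitution of `z q ^ s` for `z`. -/
def Scaled (s : ℕ) (g g' : BiSeries) : Prop :=
  (∀ k < 0, zc k g = 0 ∧ zc k g' = 0) ∧ ∀ n : ℕ, X ^ n ∣ zc n g ∧ zc n g' = X ^ (s * n) * zc n g

theorem Scaled.mul {s : ℕ} {g g' h h' : BiSeries} (hg : Scaled s g g') (hh : Scaled s h h') :
    Scaled s (g * h) (g' * h') := by
  refine ⟨fun k hk => ?_, fun n => ⟨?_, ?_⟩⟩
  · have : ∀ a b : BiSeries, (∀ k < 0, zc k a = 0) → (∀ k < 0, zc k b = 0) →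
        zc k (a * b) = 0 := fun a b ha hb => by
      ext i
      rw [zc_mul, act, coeff_fsum, map_zero]
      refine finsum_eq_zero_of_forall_eq_zero fun j => ?_
      rcases lt_or_ge j 0 with hj | hj
      · rw [ha j hj]; simp
      · rw [hb (k - j) (by omega)]; simp
    exact ⟨this g h (fun k hk => (hg.1 k hk).1) (fun k hk => (hh.1 k hk).1),
      this g' h' (fun k hk => (hg.1 k hk).2) (fun k hk => (hh.1 k hk).2)⟩
  · rw [zc_mul, X_pow_dvd_iff]
    intro i hi
    rw [act, coeff_fsum]
    refine finsum_eq_zero_of_forall_eq_zero fun j => ?_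
    have hd : X ^ n ∣ zc j g * zc (n - j) h := by
      rcases lt_or_ge j 0 with hj | hj
      · rw [(hg.1 j hj).1]; simp
      rcases lt_or_ge ((n : ℤ) - j) 0 with hj' | hj'
      · rw [(hh.1 _ hj').1]; simp
      obtain ⟨a, rfl⟩ := Int.eq_ofNat_of_zero_le hj
      obtain ⟨b, hb⟩ := Int.eq_ofNat_of_zero_le hj'
      rw [hb, show n = a + b by omega, pow_add]
      exact mul_dvd_mul (hg.2 a).1 (hh.2 b).1
    exact X_pow_dvd_iff.1 hd i hi
  · rw [zc_mul, zc_mul, act, act, ← fsum_const_mul (locFin_act (fun j => zc j g) h n)]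
    congr 1
    funext j
    rcases lt_or_ge j 0 with hj | hj
    · rw [(hg.1 j hj).1, (hg.1 j hj).2]; simp
    rcases lt_or_ge ((n : ℤ) - j) 0 with hj' | hj'
    · rw [(hh.1 _ hj').1, (hh.1 _ hj').2]; simp
    obtain ⟨a, rfl⟩ := Int.eq_ofNat_of_zero_le hj
    obtain ⟨b, hb⟩ := Int.eq_ofNat_of_zero_le hj'
    rw [hb, show n = a + b by omega, (hg.2 a).2, (hh.2 b).2]
    ring

theorem Scaled.one (s : ℕ) : Scaled s 1 1 := by
  refine ⟨fun k hk => by simp [zc_one, hk.ne], fun n => ?_⟩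
  rcases n with _ | n
  · simp
  · simp [zc_one, show ((n : ℤ) + 1) ≠ 0 by omega]

theorem Scaled.kK (s : ℕ) (a : QSer) :
    Scaled s (OverpartitionMoments.kK a) (OverpartitionMoments.kK a) := by
  refine ⟨fun k hk => by simp [zc_kK, hk.ne], fun n => ?_⟩
  rcases n with _ | n
  · simp
  · simp [zc_kK, show ((n : ℤ) + 1) ≠ 0 by omega]

theorem Scaled.prod {s N : ℕ} {g g' : ℕ → BiSeries} (h : ∀ i, Scaled s (g i) (g' i)) :
    Scaled s (∏ i ∈ Finset.range N, g i) (∏ i ∈ Finset.range N, g' i) := by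
  induction N with
  | zero => simpa using Scaled.one s
  | succ N ih => rw [Finset.prod_range_succ, Finset.prod_range_succ]; exact ih.mul (h N)

theorem Scaled.one_add (s : ℕ) {i j : ℕ} (hi : 0 < i) (hj : j = i + s) :
    Scaled s (1 + zT 1 * X ^ i) (1 + zT 1 * X ^ j) := by
  subst hj
  have h : ∀ (k : ℤ) (i : ℕ), zc k (1 + zT 1 * X ^ i) =
      (if k = 0 then 1 else 0) + if k = 1 then X ^ i else 0 := fun k i => by
    rw [map_add, zc_one, mul_comm, zc_X_pow_mul, zc_zT]
    simp
  refine ⟨fun k hk => ?_, fun n => ?_⟩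
  · rw [h, h, if_neg hk.ne, if_neg (by omega), if_neg (by omega)]; simp
  · rw [h, h]
    rcases n with _ | _ | n
    · simp
    · simp [pow_add, dvd_pow_self X hi.ne', mul_comm]
    · rw [if_neg (by omega), if_neg (by omega), if_neg (by omega)]; simp

theorem Scaled.geo (s : ℕ) {i j : ℕ} (hi : 0 < i) (hj : j = i + s) :
    Scaled s (geo i) (geo j) := by
  subst hj
  obtain ⟨h1, h2⟩ := zc_geo hi
  obtain ⟨h3, h4⟩ := zc_geo (show 0 < i + s by omega)
  refine ⟨fun k hk => ⟨h1 k hk, h3 k hk⟩, fun n => ?_⟩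
  rw [h2, h4]
  exact ⟨pow_dvd_pow _ (Nat.le_mul_of_pos_left n hi), by rw [← pow_add]; ring_nf⟩

/-! ### Sums over the size of the largest part -/

/-- The sum of z^(-l) h_l does not converge as a whole, but for fixed m its coefficient of z^m does:
the coefficient of z^(m+l) in h_l is divisible by q^(m+l). -/
theorem exists_convTo_zc_sum {h : ℕ → BiSeries} (hh : ∀ l, Scaled 0 (h l) (h l)) :
    ∃ U : ℤ → QSer, ∀ m, ConvTo (fun N => zc m (∑ l ∈ Finset.range N, zT (-l) * h l)) (U m) := by
  have : ∀ m, ∃ f, ConvTo (fun N => zc m (∑ l ∈ Finset.range N, zT (-l) * h l)) f := fun m => by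
    refine exists_convTo fun M => ?_
    filter_upwards [eventually_ge_atTop (M + m.natAbs)] with N hN
    rw [Finset.sum_range_succ, map_add, add_sub_cancel_left, zc_zT_mul]
    obtain ⟨k, hk⟩ := Int.eq_ofNat_of_zero_le (by omega : 0 ≤ m - -(N : ℤ))
    rw [hk]
    exact (pow_dvd_pow X (by omega)).trans ((hh N).2 k).1
  choose U hU using this
  exact ⟨U, hU⟩

/-- The boundary term of a telescoping sum disappears coefficient by coefficient in z. -/
theorem convTo_zc_boundary {B : ℕ → BiSeries} (hB : ∀ l, Scaled 0 (B l) (B l)) (m : ℤ) (c : ℤ) :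
    ConvTo (fun N => zc m (zT (-(N + c)) * B N)) 0 := by
  refine convTo_zero_of_dvd fun M => ?_
  filter_upwards [eventually_ge_atTop (M + m.natAbs + c.natAbs)] with N hN
  rw [zc_zT_mul]
  obtain ⟨k, hk⟩ := Int.eq_ofNat_of_zero_le (by omega : 0 ≤ m - -((N : ℤ) + c))
  rw [hk]
  exact (pow_dvd_pow X (by omega)).trans ((hB N).2 k).1

/-- In f = ∑ z^(-l) q^(sl+1) g_l(z), replacing z by z q^s cancels q^(sl) and gives q ∑ z^(-l) g_l(z
q^s) = fh. Hence the two coefficient sequences differ by q^(sm), stated without negative exponents.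
-/
theorem exists_convTo_scaled {s : ℕ} (hs : 0 < s) {g gh : ℕ → BiSeries}
    (hg : ∀ l, Scaled s (g l) (gh l)) : ∃ f fh : ℤ → QSer,
    (∀ m, ConvTo (fun N => zc m (∑ l ∈ Finset.range N, zT (-l) * (X ^ (s * l + 1) * g l))) (f m)) ∧
    (∀ m, ConvTo (fun N => zc m (X * ∑ l ∈ Finset.range N, zT (-l) * gh l)) (fh m)) ∧
    (∀ m : ℕ, fh m = X ^ (s * m) * f m) ∧ (∀ M : ℕ, f (-M) = X ^ (s * M) * fh (-M)) := by
  have e : ∀ (m : ℤ) (N : ℕ), zc m (∑ l ∈ Finset.range N, zT (-l) * (X ^ (s * l + 1) * g l)) =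
      ∑ l ∈ Finset.range N, X ^ (s * l + 1) * zc (m + l) (g l) := fun m N => by
    rw [map_sum]
    refine Finset.sum_congr rfl fun l _ => ?_
    rw [zc_zT_mul, zc_X_pow_mul, sub_neg_eq_add]
  have eh : ∀ (m : ℤ) (N : ℕ), zc m (X * ∑ l ∈ Finset.range N, zT (-l) * gh l) =
      ∑ l ∈ Finset.range N, X * zc (m + l) (gh l) := fun m N => by
    have := zc_X_pow_mul m 1 (∑ l ∈ Finset.range N, zT (-l) * gh l)
    rw [pow_one, pow_one] at this
    rw [this, map_sum, Finset.mul_sum]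
    refine Finset.sum_congr rfl fun l _ => ?_
    rw [zc_zT_mul, sub_neg_eq_add]
  have hf : ∀ m, ∃ f, ConvTo (fun N =>
      zc m (∑ l ∈ Finset.range N, zT (-l) * (X ^ (s * l + 1) * g l))) f := fun m => by
    refine exists_convTo fun M => ?_
    filter_upwards [eventually_ge_atTop M] with N hN
    rw [e, e, Finset.sum_range_succ, add_sub_cancel_left]
    exact Dvd.dvd.mul_right (pow_dvd_pow X (by nlinarith)) _
  have hfh : ∀ m, ∃ f, ConvTo (fun N => zc m (X * ∑ l ∈ Finset.range N, zT (-l) * gh l)) f :=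
    fun m => by
      refine exists_convTo fun M => ?_
      filter_upwards [eventually_ge_atTop (M + m.natAbs)] with N hN
      rw [eh, eh, Finset.sum_range_succ, add_sub_cancel_left]
      obtain ⟨k, hk⟩ := Int.eq_ofNat_of_zero_le (by omega : 0 ≤ m + (N : ℤ))
      rw [hk, ((hg N).2 k).2]
      exact Dvd.dvd.mul_left (Dvd.dvd.mul_right (pow_dvd_pow X (by
        have : k ≤ s * k := Nat.le_mul_of_pos_left k hs
        omega)) _) _
  choose f hf using hf
  choose fh hfh using hfh
  refine ⟨f, fh, hf, hfh, fun m => ?_, fun M => ?_⟩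
  · refine ConvTo.unique (hfh m) ?_
    have : ∀ N, zc m (X * ∑ l ∈ Finset.range N, zT (-l) * gh l) =
        X ^ (s * m) * zc m (∑ l ∈ Finset.range N, zT (-l) * (X ^ (s * l + 1) * g l)) := fun N => by
      rw [e, eh, Finset.mul_sum]
      refine Finset.sum_congr rfl fun l _ => ?_
      have h1 := ((hg l).2 (m + l)).2
      push_cast at h1
      rw [h1]; ring
    simp only [this]
    exact (ConvTo.const _).mul (hf m)
  · refine ConvTo.unique (hf (-M)) ?_
    have : ∀ N, zc (-M) (∑ l ∈ Finset.range N, zT (-l) * (X ^ (s * l + 1) * g l)) =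
        X ^ (s * M) * zc (-M) (X * ∑ l ∈ Finset.range N, zT (-l) * gh l) := fun N => by
      rw [e, eh, Finset.mul_sum]
      refine Finset.sum_congr rfl fun l _ => ?_
      rcases lt_or_ge (-(M : ℤ) + l) 0 with h | h
      · rw [((hg l).1 _ h).1, ((hg l).1 _ h).2]; simp
      · obtain ⟨k, hk⟩ := Int.eq_ofNat_of_zero_le h
        rw [hk, ((hg l).2 k).2, show l = M + k by omega]; ring
    simp only [this]
    exact (ConvTo.const _).mul (hfh (-M))

theorem zT_mul_zT (a b : ℤ) : zT a * zT b = zT (a + b) := (zT_add a b).symm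

theorem zc_X_mul (k : ℤ) (f : BiSeries) : zc k (X * f) = X * zc k f := by
  simpa using zc_X_pow_mul k 1 f

/-! ### The rank -/

/-- `∏ (1 + z q ^ i) / (1 - z q ^ i)` over `1 ≤ i ≤ l`. -/
noncomputable def rankProd (l : ℕ) : BiSeries :=
  (∏ i ∈ Finset.range l, (1 + zT 1 * X ^ (i + 1))) * ∏ i ∈ Finset.range l, geo (i + 1)

theorem rankProd_succ (l : ℕ) :
    rankProd (l + 1) = (1 + zT 1 * X ^ (l + 1)) * (rankProd l * geo (l + 1)) := by
  rw [rankProd, rankProd, Finset.prod_range_succ, Finset.prod_range_succ]; ring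

/-- With g_l = B_l/(1 - z q^(l+1)) and B_l = `rankProd l`, the summand is 2 z q^(l+1) g_l, so R = 1
+ 2f. Telescoping B_l and comparing g_l(zq) with g_(l+1) give the two equations for f and U = ∑
z^(-l) g_l. -/
theorem rank_pde {R : BiSeries}
    (hR : ConvTo (fun N => 1 + ∑ l ∈ Finset.range N,
      zT (-(l + 1)) * (rankProd (l + 1) - rankProd l)) R) :
    zInv R = R ∧ ∃ u v, v ≠ 0 ∧
      kK v * (heatOp 2 R * thetaProd 1 1 ^ 3) = kK u * (zT 1 * theta (-1) 1) := by
  set g : ℕ → BiSeries := fun l => rankProd l * geo (l + 1) with hg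
  set gh : ℕ → BiSeries := fun l =>
    ((∏ i ∈ Finset.range l, (1 + zT 1 * X ^ (i + 2))) * ∏ i ∈ Finset.range l, geo (i + 2))
      * geo (l + 2) with hgh
  have hsc : ∀ l, Scaled 1 (g l) (gh l) := fun l =>
    (Scaled.mul (Scaled.prod fun i => Scaled.one_add 1 i.succ_pos rfl)
      (Scaled.prod fun i => Scaled.geo 1 i.succ_pos rfl)).mul (Scaled.geo 1 l.succ_pos rfl)
  have hB : ∀ l, Scaled 0 (rankProd l) (rankProd l) := fun l =>
    Scaled.mul (Scaled.prod fun i => Scaled.one_add 0 i.succ_pos rfl)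
      (Scaled.prod fun i => Scaled.geo 0 i.succ_pos rfl)
  have hg0 : ∀ l, Scaled 0 (g l) (g l) := fun l => (hB l).mul (Scaled.geo 0 l.succ_pos rfl)
  obtain ⟨U, hU⟩ := exists_convTo_zc_sum hg0
  obtain ⟨f, fh, hf, hfh, hp, hn⟩ := exists_convTo_scaled one_pos hsc
  have hBg : ∀ l, rankProd l = (1 - zT 1 * X ^ (l + 1)) * g l := fun l => by
    have := one_sub_mul_geo (d := l + 1) (by omega)
    simp only [hg]
    linear_combination -rankProd l * this
  have hBg' : ∀ l, rankProd (l + 1) = (1 + zT 1 * X ^ (l + 1)) * g l := rankProd_succ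
  -- Scaling z by q shifts the index of every factor, so g_l(zq) is g_(l+1) without its factors at i
  -- = 1.
  have hghg : ∀ l, (1 + zT 1 * X) * gh l = (1 - zT 1 * X) * g (l + 1) := fun l => by
    have h1 := one_sub_mul_geo one_pos
    simp only [hg, hgh, rankProd]
    rw [Finset.prod_range_succ', Finset.prod_range_succ']
    simp only [zero_add, pow_one] at h1 ⊢
    linear_combination -(∏ i ∈ Finset.range l, (1 + zT 1 * X ^ (i + 2))) *
      (∏ i ∈ Finset.range l, geo (i + 2)) * (1 + zT 1 * X) * geo (l + 2) * h1
  set fN : ℕ → BiSeries := fun N => ∑ l ∈ Finset.range N, zT (-l) * (X ^ (1 * l + 1) * g l) with hfN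
  set uN : ℕ → BiSeries := fun N => ∑ l ∈ Finset.range N, zT (-l) * g l with huN
  set fhN : ℕ → BiSeries := fun N => X * ∑ l ∈ Finset.range N, zT (-l) * gh l with hfhN
  have hz : ∀ l : ℕ, zT (-((l : ℤ) + 1)) = zT (-l) * zT (-1) := fun l => by
    rw [zT_mul_zT]; congr 1; ring
  have hz1 : zT 1 * zT (-1) = 1 := by rw [zT_mul_zT]; simp
  -- The right side telescopes: B_l and B_(l+1) are both multiples of g_l by linear factors in z.
  have i1 : ∀ N, (1 + zT 1) * fN N + (zT (-1) - 1) * uN N = zT (-(N + 0)) * rankProd N - 1 :=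
    fun N => by
      induction N with
      | zero => simp [hfN, huN, rankProd]
      | succ N ih =>
        have h1 : fN (N + 1) = fN N + zT (-N) * (X ^ (1 * N + 1) * g N) :=
          Finset.sum_range_succ _ _
        have h2 : uN (N + 1) = uN N + zT (-N) * g N := Finset.sum_range_succ _ _
        have a := hBg N
        have b := hBg' N
        have c := hz N
        rw [add_zero] at ih ⊢
        push_cast
        rw [h1, h2, c, b, one_mul]
        linear_combination ih + zT (-N) * a - zT (-N) * g N * X ^ (N + 1) * hz1
  have i2 : ∀ N, (1 + zT 1 * X) * fhN N = X * (zT 1 - zT 2 * X) * uN (N + 1) - X * zT 1 :=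
    fun N => by
      have hz2 : zT 2 = zT 1 * zT 1 := by rw [zT_mul_zT]; norm_num
      have h1 : uN (N + 1) = ∑ l ∈ Finset.range N, zT (-(l + 1 : ℕ)) * g (l + 1) + zT 0 * g 0 := by
        simp only [huN]
        rw [Finset.sum_range_succ']
        simp
      have h2 : (1 - zT 1 * X) * g 0 = 1 := by
        have := one_sub_mul_geo one_pos
        simp only [hg, rankProd]
        simpa using this
      have h3 : (1 + zT 1 * X) * ∑ l ∈ Finset.range N, zT (-l) * gh l =
          zT 1 * (1 - zT 1 * X) * ∑ l ∈ Finset.range N, zT (-(l + 1 : ℕ)) * g (l + 1) := by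
        rw [Finset.mul_sum, Finset.mul_sum]
        refine Finset.sum_congr rfl fun l _ => ?_
        have a := hghg l
        have c := hz l
        push_cast
        rw [c]
        linear_combination zT (-l) * a - (1 - zT 1 * X) * zT (-l) * g (l + 1) * hz1
      rw [h1, hz2, zT_zero]
      simp only [hfhN]
      linear_combination X * h3 - X * zT 1 * h2
  have e1 : ∀ m, f m + f (m - 1) + U (m + 1) - U m = -if m = 0 then 1 else 0 := fun m => by
    have hl : ConvTo (fun N => zc m (fN N) + zc (m - 1) (fN N) + zc (m + 1) (uN N) - zc m (uN N))
        (f m + f (m - 1) + U (m + 1) - U m) :=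
      (((hf m).add (hf (m - 1))).add (hU (m + 1))).sub (hU m)
    have hr := (convTo_zc_boundary hB m 0).sub (ConvTo.const (zc m 1))
    rw [zero_sub, zc_one] at hr
    refine hl.unique ?_
    convert hr using 2 with N
    have := congrArg (zc m) (i1 N)
    simp only [add_mul, sub_mul, one_mul, map_add, map_sub, zc_zT_mul, sub_neg_eq_add, zc_one]
      at this
    simp only [zc_zT_mul, sub_neg_eq_add]
    linear_combination this
  have e2 : ∀ m, fh m + X * fh (m - 1) =
      X * (U (m - 1) - X * U (m - 2) - if m = 1 then 1 else 0) := fun m => by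
    have hl := (hfh m).add ((ConvTo.const X).mul (hfh (m - 1)))
    have hu : ∀ k, ConvTo (fun N => zc k (uN (N + 1))) (U k) := fun k =>
      (hU k).comp_tendsto (tendsto_add_atTop_nat 1)
    have hr := (ConvTo.const X).mul (((hu (m - 1)).sub ((ConvTo.const X).mul (hu (m - 2)))).sub
      (ConvTo.const (if m = 1 then 1 else 0)))
    refine hl.unique ?_
    convert hr using 2 with N
    have := congrArg (zc m) (i2 N)
    rw [show (1 + zT 1 * X) * fhN N = fhN N + zT 1 * (X * fhN N) by ring,
      show X * (zT 1 - zT 2 * X) * uN (N + 1) - X * zT 1 =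
        X * (zT 1 * uN (N + 1) - zT 2 * (X * uN (N + 1)) - zT 1) by ring] at this
    rw [map_add, zc_zT_mul, zc_X_mul (m - 1) (fhN N), zc_X_mul m (_ - _), map_sub, map_sub,
      zc_zT_mul, zc_zT_mul, zc_X_mul (m - 2) (uN (N + 1)), zc_zT] at this
    exact this
  simp only [one_mul] at hp hn
  obtain ⟨S, C, h1, h2, h3⟩ := rank_recursion e1 e2 hp hn
  have hr : ∀ m, zc m R = 2 * f m + if m = 0 then 1 else 0 := fun m => by
    refine (hR.zc m).unique ?_
    have hl := ((ConvTo.const 2).mul (hf m)).add (ConvTo.const (if m = 0 then (1 : QSer) else 0))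
    convert hl using 2 with N
    have h2 := zc_natCast_mul m 2 (fN N)
    push_cast at h2
    rw [← zc_one, ← h2, ← map_add, add_comm (1 : BiSeries)]
    congr 2
    simp only [hfN]
    rw [Finset.mul_sum]
    refine Finset.sum_congr rfl fun l _ => ?_
    rw [hBg', hBg, hz, one_mul]
    linear_combination 2 * zT (-l) * X ^ (l + 1) * g l * hz1
  obtain ⟨k1, k2, k3⟩ := symm_of_recursion (s := 1) (e := 2) (S := S) (C := C)
    (r := fun m => zc m R) rfl
    (fun m hm => by simpa using h1 m hm) (fun M => by simpa using h2 M)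
    (fun m => by rw [h3 m, hr, hr])
  have hinv : zInv R = R := zc_ext fun k => by rw [zc_zInv]; exact k1 k
  exact ⟨hinv, exists_heatOp_mul_eq (s := 1) (e := 2) rfl hinv (fun m => S (-m)) k2 k3⟩

/-! ### The `M2`-rank -/

/-- The series `1 / (1 - q ^ d)`, constant in `z`. -/
noncomputable def geoOne (d : ℕ) : BiSeries := kK (pinv (1 - X ^ d))

theorem one_sub_mul_geoOne {d : ℕ} (hd : 0 < d) : (1 - X ^ d) * geoOne d = 1 := by
  have h : (1 - X ^ d : QSer) * pinv (1 - X ^ d) = 1 := mul_pinv (by simp [hd.ne'])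
  have := congrArg kK h
  rw [geoOne]
  simpa [kK_X] using this

/-- The product of `(1 + z q ^ i)` over `1 ≤ i ≤ 2 r`, of `1 / (1 - z q ^ i)` over even such `i`,
and of `1 / (1 - q ^ i)` over odd such `i`. -/
noncomputable def m2Prod (r : ℕ) : BiSeries :=
  (∏ i ∈ Finset.range r, ((1 + zT 1 * X ^ (2 * i + 1)) * (1 + zT 1 * X ^ (2 * i + 2)))) *
    (∏ i ∈ Finset.range r, geoOne (2 * i + 1)) * ∏ i ∈ Finset.range r, geo (2 * i + 2)

theorem m2Prod_succ (r : ℕ) :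
    m2Prod (r + 1) = (1 + zT 1 * X ^ (2 * r + 1)) * (1 + zT 1 * X ^ (2 * r + 2)) *
      geoOne (2 * r + 1) * geo (2 * r + 2) * m2Prod r := by
  rw [m2Prod, m2Prod, Finset.prod_range_succ, Finset.prod_range_succ, Finset.prod_range_succ]
  ring

theorem scaled_geoOne (s d : ℕ) : Scaled s (geoOne d) (geoOne d) := Scaled.kK s _

/-- The scheme of `rank_pde` with steps of two: one step in r adds the part sizes 2r+1 and 2r+2, and
the relevant scaling is z ↦ zq². -/
theorem m2Rank_pde {R : BiSeries}
    (hR : ConvTo (fun N => 1 + ∑ r ∈ Finset.range N, zT (-(r + 1)) *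
      (2 * (zT 1 * X ^ (2 * r + 1) * geoOne (2 * r + 1) * m2Prod r) +
        (m2Prod (r + 1) - (1 + zT 1 * X ^ (2 * r + 1)) * geoOne (2 * r + 1) * m2Prod r))) R) :
    zInv R = R ∧ ∃ u v, v ≠ 0 ∧
      kK v * (heatOp 1 R * thetaProd 1 2 ^ 3) = kK u * (zT 1 * theta (-1) 1) := by
  -- The factor 1 + q arises when the odd and even contributions are combined: (1 - z q^(2r+2)) + q
  -- (1 + z q^(2r+1)) = 1 + q. Hence again R = 1 + 2f.
  set g : ℕ → BiSeries := fun r => kK (1 + X) *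
    (m2Prod r * geoOne (2 * r + 1) * geo (2 * r + 2)) with hg
  set gh : ℕ → BiSeries := fun r => kK (1 + X) *
    ((∏ i ∈ Finset.range r, ((1 + zT 1 * X ^ (2 * i + 3)) * (1 + zT 1 * X ^ (2 * i + 4)))) *
    (∏ i ∈ Finset.range r, geoOne (2 * i + 1)) * (∏ i ∈ Finset.range r, geo (2 * i + 4)) *
    geoOne (2 * r + 1) * geo (2 * r + 4)) with hgh
  have hK : kK (1 + X) = 1 + X := by simp [kK_X]
  have hsc : ∀ r, Scaled 2 (g r) (gh r) := fun r =>
    (Scaled.kK 2 _).mul (((((Scaled.prod fun i =>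
      (Scaled.one_add 2 (by omega) rfl).mul (Scaled.one_add 2 (by omega) rfl)).mul
      (Scaled.prod fun i => scaled_geoOne 2 _)).mul
      (Scaled.prod fun i => Scaled.geo 2 (by omega) rfl)).mul (scaled_geoOne 2 _)).mul
      (Scaled.geo 2 (by omega) rfl))
  have hB : ∀ r, Scaled 0 (m2Prod r) (m2Prod r) := fun r =>
    ((Scaled.prod fun i =>
      (Scaled.one_add 0 (by omega) rfl).mul (Scaled.one_add 0 (by omega) rfl)).mul
      (Scaled.prod fun i => scaled_geoOne 0 _)).mul
      (Scaled.prod fun i => Scaled.geo 0 (by omega) rfl)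
  have hg0 : ∀ r, Scaled 0 (g r) (g r) := fun r =>
    (Scaled.kK 0 _).mul (((hB r).mul (scaled_geoOne 0 _)).mul (Scaled.geo 0 (by omega) rfl))
  -- The denominators 1 - q^(2i+1) do not move under z ↦ zq², so g_(r+1) has one more of them than
  -- g_r(zq²); this factor compensates.
  set h : ℕ → BiSeries := fun r => kK (1 - X ^ (2 * r + 1)) * g r with hh
  have hh0 : ∀ r, Scaled 0 (h r) (h r) := fun r => (Scaled.kK 0 _).mul (hg0 r)
  have hhg : ∀ r, h r = (1 - X ^ (2 * r + 1)) * g r := fun r => by simp [hh, kK_X]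
  obtain ⟨U, hU⟩ := exists_convTo_zc_sum hh0
  obtain ⟨f, fh, hf, hfh, hp, hn⟩ := exists_convTo_scaled two_pos hsc
  have hBg : ∀ r, (1 + X) * (geoOne (2 * r + 1) * m2Prod r) = (1 - zT 1 * X ^ (2 * r + 2)) * g r :=
    fun r => by
      have := one_sub_mul_geo (d := 2 * r + 2) (by omega)
      simp only [hg, hK]
      linear_combination -(1 + X) * (geoOne (2 * r + 1) * m2Prod r) * this
  have hBg0 : ∀ r, (1 + X) * m2Prod r = (1 - zT 1 * X ^ (2 * r + 2)) * h r := fun r => by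
    have := one_sub_mul_geoOne (d := 2 * r + 1) (by omega)
    rw [hhg]
    linear_combination (1 - X ^ (2 * r + 1)) * hBg r - (1 + X) * m2Prod r * this
  have hBg' : ∀ r, (1 + X) * m2Prod (r + 1) =
      (1 + zT 1 * X ^ (2 * r + 1)) * (1 + zT 1 * X ^ (2 * r + 2)) * g r := fun r => by
    rw [m2Prod_succ]
    simp only [hg, hK]
    ring
  have hghg : ∀ r, (1 + zT 1 * X) * (1 + zT 1 * X ^ 2) * gh r = (1 - zT 1 * X ^ 2) * h (r + 1) :=
    fun r => by
      have h1 := one_sub_mul_geo (d := 2) (by omega)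
      have h2 := one_sub_mul_geoOne (d := 2 * (r + 1) + 1) (by omega)
      rw [hhg]
      simp only [hg, hgh, m2Prod]
      rw [Finset.prod_range_succ', Finset.prod_range_succ _ r, Finset.prod_range_succ' _ r]
      have ex : ∀ i, 2 * (i + 1) + 1 = 2 * i + 3 := fun i => by ring
      have ex' : ∀ i, 2 * (i + 1) + 2 = 2 * i + 4 := fun i => by ring
      simp only [ex, ex', mul_zero, zero_add, pow_one] at h1 h2 ⊢
      set P := ∏ i ∈ Finset.range r, ((1 + zT 1 * X ^ (2 * i + 3)) * (1 + zT 1 * X ^ (2 * i + 4)))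
      set Q := ∏ i ∈ Finset.range r, geoOne (2 * i + 1)
      set W := ∏ i ∈ Finset.range r, geo (2 * i + 4)
      linear_combination -(1 + zT 1 * X) * (1 + zT 1 * X ^ 2) * kK (1 + X) * P * Q * W *
        geoOne (2 * r + 1) * geo (2 * r + 4) *
        (h1 * (1 - X ^ (2 * r + 3)) * geoOne (2 * r + 3) + h2)
  set fN : ℕ → BiSeries := fun N => ∑ r ∈ Finset.range N, zT (-r) * (X ^ (2 * r + 1) * g r) with hfN
  set uN : ℕ → BiSeries := fun N => ∑ r ∈ Finset.range N, zT (-r) * h r with huN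
  set fhN : ℕ → BiSeries := fun N => X * ∑ r ∈ Finset.range N, zT (-r) * gh r with hfhN
  have hz : ∀ r : ℕ, zT (-((r : ℤ) + 1)) = zT (-r) * zT (-1) := fun r => by
    rw [zT_mul_zT]; congr 1; ring
  have hz1 : zT 1 * zT (-1) = 1 := by rw [zT_mul_zT]; simp
  have hz2 : zT 2 = zT 1 * zT 1 := by rw [zT_mul_zT]; norm_num
  have i1 : ∀ N, (1 + zT 1) * (1 + zT 1 * X) * fN N + (1 - zT 1) * uN N =
      (1 + X) * (zT 1 * zT (-N) * m2Prod N - zT 1) :=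
    fun N => by
      induction N with
      | zero => simp [hfN, huN, m2Prod]
      | succ N ih =>
        have h1 : fN (N + 1) = fN N + zT (-N) * (X ^ (2 * N + 1) * g N) :=
          Finset.sum_range_succ _ _
        have h2 : uN (N + 1) = uN N + zT (-N) * h N := Finset.sum_range_succ _ _
        have a := hBg0 N
        have b := hBg' N
        have c := hz N
        push_cast
        rw [h1, h2, c]
        rw [hhg] at a ⊢
        linear_combination ih + zT 1 * zT (-N) * a - zT 1 * zT (-N) * zT (-1) * b -
          zT (-N) * ((1 + zT 1 * X ^ (2 * N + 1)) * (1 + zT 1 * X ^ (2 * N + 2)) * g N) * hz1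
  have i2 : ∀ N, (1 + zT 1 * X) * (1 + zT 1 * X ^ 2) * fhN N =
      X * (zT 1 - zT 2 * X ^ 2) * uN (N + 1) - X * (zT 1 * (1 + X)) :=
    fun N => by
      have h1 : uN (N + 1) = ∑ r ∈ Finset.range N, zT (-(r + 1 : ℕ)) * h (r + 1) + zT 0 * h 0 := by
        simp only [huN]
        rw [Finset.sum_range_succ']
        simp
      have h2 : (1 - zT 1 * X ^ 2) * h 0 = 1 + X := by
        have := hBg0 0
        simpa [m2Prod] using this.symm
      have h3 : (1 + zT 1 * X) * (1 + zT 1 * X ^ 2) * ∑ r ∈ Finset.range N, zT (-r) * gh r =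
          zT 1 * (1 - zT 1 * X ^ 2) * ∑ r ∈ Finset.range N, zT (-(r + 1 : ℕ)) * h (r + 1) := by
        rw [Finset.mul_sum, Finset.mul_sum]
        refine Finset.sum_congr rfl fun r _ => ?_
        have a := hghg r
        have c := hz r
        push_cast
        rw [c]
        linear_combination zT (-r) * a - (1 - zT 1 * X ^ 2) * zT (-r) * h (r + 1) * hz1
      rw [h1, hz2, zT_zero]
      simp only [hfhN]
      linear_combination X * h3 - X * zT 1 * h2
  have e1 : ∀ m, f m + (1 + X) * f (m - 1) + X * f (m - 2) - U (m - 1) + U m =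
      -((1 + X) * if m = 1 then 1 else 0) := fun m => by
    have hl : ConvTo (fun N => zc m (fN N) + (1 + X) * zc (m - 1) (fN N) + X * zc (m - 2) (fN N) -
        zc (m - 1) (uN N) + zc m (uN N))
        (f m + (1 + X) * f (m - 1) + X * f (m - 2) - U (m - 1) + U m) :=
      ((((hf m).add ((ConvTo.const (1 + X)).mul (hf (m - 1)))).add
        ((ConvTo.const X).mul (hf (m - 2)))).sub (hU (m - 1))).add (hU m)
    have hr := (ConvTo.const (1 + X)).mul
      ((convTo_zc_boundary hB m (-1)).sub (ConvTo.const (zc m (zT 1))))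
    rw [zero_sub, mul_neg, zc_zT] at hr
    refine hl.unique ?_
    convert hr using 2 with N
    have := congrArg (zc m) (i1 N)
    have ez : zT (-((N : ℤ) + -1)) = zT 1 * zT (-N) := by rw [zT_mul_zT]; congr 1; ring
    rw [show (1 + zT 1) * (1 + zT 1 * X) * fN N + (1 - zT 1) * uN N =
      fN N + zT 1 * fN N + zT 1 * (X * fN N) + zT 2 * (X * fN N) + uN N - zT 1 * uN N by
        rw [hz2]; ring, ← hK, zc_kK_mul, map_sub, map_sub, map_add, map_add, map_add, map_add,
        zc_zT_mul, zc_zT_mul, zc_zT_mul, zc_zT_mul, zc_X_mul, zc_X_mul, ← ez, zc_zT] at this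
    linear_combination this
  have e2 : ∀ m, fh m + (X + X ^ 2) * fh (m - 1) + X ^ 3 * fh (m - 2) =
      X * (U (m - 1) - X ^ 2 * U (m - 2) - (1 + X) * if m = 1 then 1 else 0) := fun m => by
    have hl : ConvTo (fun N => zc m (fhN N) + (X + X ^ 2) * zc (m - 1) (fhN N) +
        X ^ 3 * zc (m - 2) (fhN N)) (fh m + (X + X ^ 2) * fh (m - 1) + X ^ 3 * fh (m - 2)) :=
      ((hfh m).add ((ConvTo.const (X + X ^ 2)).mul (hfh (m - 1)))).add
        ((ConvTo.const (X ^ 3)).mul (hfh (m - 2)))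
    have hu : ∀ k, ConvTo (fun N => zc k (uN (N + 1))) (U k) := fun k =>
      (hU k).comp_tendsto (tendsto_add_atTop_nat 1)
    have hr := (ConvTo.const X).mul (((hu (m - 1)).sub
      ((ConvTo.const (X ^ 2)).mul (hu (m - 2)))).sub
      (ConvTo.const ((1 + X) * if m = 1 then 1 else 0)))
    refine hl.unique ?_
    convert hr using 2 with N
    have := congrArg (zc m) (i2 N)
    clear_value fhN uN
    rw [show (1 + zT 1 * X) * (1 + zT 1 * X ^ 2) * fhN N =
        fhN N + zT 1 * (X * fhN N) + zT 1 * (X ^ 2 * fhN N) + zT 2 * (X ^ 3 * fhN N) by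
          rw [hz2]; ring,
      show X * (zT 1 - zT 2 * X ^ 2) * uN (N + 1) - X * (zT 1 * (1 + X)) =
        X * (zT 1 * uN (N + 1) - zT 2 * (X ^ 2 * uN (N + 1)) - kK (1 + X) * zT 1) by
          rw [hK]; ring,
      map_add, map_add, map_add, zc_X_mul, map_sub, map_sub, zc_kK_mul, zc_zT] at this
    simp only [zc_zT_mul, zc_X_mul, zc_X_pow_mul] at this
    linear_combination this
  obtain ⟨S, C, h1, h2, h3⟩ := m2Rank_recursion e1 e2 hp hn
  have hr : ∀ m, zc m R = 2 * f m + if m = 0 then 1 else 0 := fun m => by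
    refine (hR.zc m).unique ?_
    have hl := ((ConvTo.const 2).mul (hf m)).add (ConvTo.const (if m = 0 then (1 : QSer) else 0))
    convert hl using 2 with N
    have h2 := zc_natCast_mul m 2 (fN N)
    push_cast at h2
    rw [← zc_one, ← h2, ← map_add, add_comm (1 : BiSeries)]
    congr 2
    simp only [hfN]
    rw [Finset.mul_sum]
    refine Finset.sum_congr rfl fun r _ => ?_
    rw [hz, m2Prod_succ]
    have a := one_sub_mul_geo (d := 2 * r + 2) (by omega)
    simp only [hg, hK]
    linear_combination zT (-r) * zT (-1) * geoOne (2 * r + 1) * m2Prod r *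
      (1 - zT 1 * X ^ (2 * r + 1)) * a +
      2 * zT (-r) * X ^ (2 * r + 1) * (1 + X) * geoOne (2 * r + 1) * m2Prod r *
        geo (2 * r + 2) * hz1
  obtain ⟨k1, k2, k3⟩ := symm_of_recursion (s := 2) (e := 1) (S := S) (C := C)
    (r := fun m => zc m R) rfl
    (fun m hm => by simpa using h1 m hm) (fun M => by simpa using h2 M)
    (fun m => by rw [h3 m, hr, hr])
  have hinv : zInv R = R := zc_ext fun k => by rw [zc_zInv]; exact k1 k
  exact ⟨hinv, exists_heatOp_mul_eq (s := 2) (e := 1) rfl hinv (fun m => S (-m)) k2 k3⟩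

/-! ### Generating functions of partitions and overpartitions -/

section GenFun

variable {R : Type*} [CommRing R]

/-- The factor of `Nat.Partition.genFun f` that accounts for the parts equal to `i`. -/
noncomputable def genFactor (f : ℕ → ℕ → R) (i : ℕ) : R⟦X⟧ :=
  mk fun n => if n = 0 then 1 else if i ∣ n then f i (n / i) else 0

/-- With R discrete, convergence of the infinite product in the coefficient topology means that each
coefficient is eventually constant. -/
theorem convTo_genFun (f : ℕ → ℕ → R) :
    ConvTo (fun L => ∏ i ∈ Finset.range L, genFactor f (i + 1)) (Nat.Partition.genFun f) := by
  let _ : TopologicalSpace R := ⊥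
  have : DiscreteTopology R := ⟨rfl⟩
  let _ : TopologicalSpace R⟦X⟧ := PowerSeries.WithPiTopology.instTopologicalSpace R
  have h := (Nat.Partition.hasProd_genFun f).tendsto_prod_nat
  rw [PowerSeries.WithPiTopology.tendsto_iff_coeff_tendsto] at h
  have e : ∀ i, (1 + ∑' j, f (i + 1) (j + 1) • X ^ ((i + 1) * (j + 1)) : R⟦X⟧) =
      genFactor f (i + 1) := fun i => by
    ext n
    rw [map_add, (Nat.Partition.summable_genFun_term f i).map_tsum _
      (PowerSeries.WithPiTopology.continuous_coeff _ _), genFactor, coeff_mk, coeff_one]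
    simp only [map_smul, coeff_X_pow, smul_eq_mul, mul_ite, mul_one, mul_zero]
    rcases eq_or_ne n 0 with rfl | hn
    · simp
    rw [if_neg hn, if_neg hn, zero_add]
    split_ifs with hd
    · obtain ⟨k, rfl⟩ := hd
      rw [Nat.mul_div_cancel_left k (by omega), tsum_eq_single (k - 1)]
      · obtain ⟨j, rfl⟩ : ∃ j, k = j + 1 := ⟨k - 1, by
          have : k ≠ 0 := fun h => hn (by simp [h])
          omega⟩
        simp
      · intro j hj
        rw [if_neg]
        intro h
        have := Nat.eq_of_mul_eq_mul_left (by omega) h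
        omega
    · rw [tsum_congr (g := fun _ => 0), tsum_zero]
      intro j
      rw [if_neg]
      rintro rfl
      exact hd (dvd_mul_right _ _)
  intro n
  have h' := h n
  rw [nhds_discrete, tendsto_pure] at h'
  simpa only [e] using h'

/-- A part size occurring c + 1 times is weighted by α β^c if its first occurrence is overlined and
by β^(c+1) otherwise, so the factor sums to (1 + α q^i)/(1 - β q^i). -/
theorem genFactor_mul (f : ℕ → ℕ → R) {i : ℕ} (hi : 0 < i) (α β : R)
    (hf : ∀ c, f i (c + 1) = α * β ^ c + β ^ (c + 1)) :
    genFactor f i * (1 - C β * X ^ i) = 1 + C α * X ^ i := by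
  ext n
  rw [mul_sub, mul_one, map_sub, ← mul_assoc, mul_comm (genFactor f i), coeff_mul_X_pow', map_add,
    coeff_mul_X_pow', coeff_one, coeff_C_mul]
  simp only [genFactor, coeff_mk, coeff_C]
  rcases eq_or_ne n 0 with rfl | hn
  · simp [hi.ne']
  rw [if_neg hn, if_neg hn]
  by_cases hd : i ∣ n
  · obtain ⟨k, rfl⟩ := hd
    have hk : k ≠ 0 := fun h => hn (by simp [h])
    obtain ⟨c, rfl⟩ := Nat.exists_eq_succ_of_ne_zero hk
    rw [if_pos (dvd_mul_right _ _), if_pos (Nat.le_mul_of_pos_right i c.succ_pos),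
      if_pos (Nat.le_mul_of_pos_right i c.succ_pos),
      show i * c.succ - i = i * c by rw [Nat.mul_succ, Nat.add_sub_cancel],
      if_pos (dvd_mul_right _ _), Nat.mul_div_cancel_left _ hi, Nat.mul_div_cancel_left _ hi, hf]
    rcases c with _ | c
    · simp
    · rw [if_neg (by positivity), hf, if_neg (by positivity)]
      ring
  · rw [if_neg hd]
    split_ifs with h1 h2 h3
    · exact absurd (by rw [show n = i by omega]) hd
    · exact absurd ((Nat.dvd_sub_iff_left h1 dvd_rfl).1 h3) hd
    · simp
    · simp

/-- The weight of an overpartition: `α i` for each overlined part `i` and `β i` for each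
non-overlined part `i`. -/
def overWeight (α β : ℕ → R) {n : ℕ} (l : Overpartition n) : R :=
  (∏ i ∈ l.overlined, α i) * (l.nonOverlined.map β).prod

/-- The generating function of overpartitions with given weights of the parts. -/
noncomputable def overGF (α β : ℕ → R) : R⟦X⟧ :=
  mk fun n => ∑ l : Overpartition n, overWeight α β l

/-- Expanding the product of the sums over all part sizes amounts to choosing the subset of
overlined sizes. -/
theorem overGF_eq_genFun (α β : ℕ → R) :
    overGF α β = Nat.Partition.genFun fun i c => α i * β i ^ (c - 1) + β i ^ c := by
  ext n
  rw [overGF, coeff_mk, Nat.Partition.coeff_genFun,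
    ← (Overpartition.equivSigma n).symm.sum_comp, Fintype.sum_sigma]
  refine Finset.sum_congr rfl fun p _ => ?_
  rw [Finsupp.prod, Multiset.toFinsupp_support, Finset.prod_add,
    ← Finset.sum_coe_sort p.parts.toFinset.powerset]
  refine Finset.sum_congr rfl fun S _ => ?_
  have hS := Finset.mem_powerset.1 S.2
  rw [overWeight, Finset.prod_mul_distrib, mul_assoc]
  congr 1
  change ((p.parts - S.1.val).map β).prod = _
  have hsub : (p.parts - S.1.val).toFinset ⊆ p.parts.toFinset :=
    Multiset.toFinset_subset.2 (Multiset.subset_of_le (Multiset.sub_le_self _ _))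
  rw [Finset.prod_multiset_map_count, Finset.prod_subset hsub,
    ← Finset.prod_sdiff hS, mul_comm]
  · congr 1
    · refine Finset.prod_congr rfl fun i hi => ?_
      rw [Multiset.count_sub, Multiset.count_eq_one_of_mem S.1.nodup hi, Multiset.toFinsupp_apply]
    · refine Finset.prod_congr rfl fun i hi => ?_
      have : i ∉ S.1.val := (Finset.mem_sdiff.1 hi).2
      rw [Multiset.count_sub, Multiset.count_eq_zero_of_notMem this, Multiset.toFinsupp_apply,
        Nat.sub_zero]
  · intro i _ hi
    rw [Multiset.count_eq_zero_of_notMem (by simpa using hi), pow_zero]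

theorem convTo_overGF (α β : ℕ → R) {V : R⟦X⟧}
    (hV : ConvTo (fun L => ∏ i ∈ Finset.range L, (1 - C (β (i + 1)) * X ^ (i + 1))) V) :
    ConvTo (fun L => ∏ i ∈ Finset.range L, (1 + C (α (i + 1)) * X ^ (i + 1)))
      (overGF α β * V) := by
  rw [overGF_eq_genFun]
  convert (convTo_genFun _).mul hV using 2 with L
  rw [← Finset.prod_mul_distrib]
  refine Finset.prod_congr rfl fun i _ => ?_
  rw [genFactor_mul _ i.succ_pos (α (i + 1)) (β (i + 1))]
  intro c
  simp

/-- The generating function of partitions with given weights of the parts. -/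
noncomputable def partGF (β : ℕ → R) : R⟦X⟧ :=
  mk fun n => ∑ p : n.Partition, (p.parts.map β).prod

theorem partGF_eq_genFun (β : ℕ → R) :
    partGF β = Nat.Partition.genFun fun i c => β i ^ c := by
  ext n
  rw [partGF, coeff_mk, Nat.Partition.coeff_genFun]
  refine Finset.sum_congr rfl fun p _ => ?_
  rw [Finsupp.prod, Multiset.toFinsupp_support, Finset.prod_multiset_map_count]
  rfl

theorem partGF_mul (β : ℕ → R) {V : R⟦X⟧}
    (hV : ConvTo (fun L => ∏ i ∈ Finset.range L, (1 - C (β (i + 1)) * X ^ (i + 1))) V) :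
    partGF β * V = 1 := by
  rw [partGF_eq_genFun]
  refine ((convTo_genFun _).mul hV).unique ?_
  convert ConvTo.const 1 using 2 with L
  rw [← Finset.prod_mul_distrib]
  refine Finset.prod_eq_one fun i _ => ?_
  rw [genFactor_mul _ i.succ_pos 0 (β (i + 1))]
  · simp
  · intro c
    simp

end GenFun

/-! ### Generating functions of the ranks -/

section Cut

variable {R : Type*} [CommRing R]

theorem prod_map_ite_zero (s : Multiset ℕ) (β : ℕ → R) (Q : ℕ → Prop) [DecidablePred Q] :
    (s.map fun i => if Q i then β i else 0).prod = if ∀ i ∈ s, Q i then (s.map β).prod else 0 := by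
  induction s using Multiset.induction with
  | empty => simp
  | cons a s ih =>
    rw [Multiset.map_cons, Multiset.prod_cons, ih, Multiset.map_cons, Multiset.prod_cons]
    simp only [Multiset.mem_cons, forall_eq_or_imp]
    split_ifs <;> simp_all

theorem overWeight_ite (α β : ℕ → R) (P Q : ℕ → Prop) [DecidablePred P] [DecidablePred Q] {n : ℕ}
    (l : Overpartition n) :
    overWeight (fun i => if P i then α i else 0) (fun i => if Q i then β i else 0) l =
      if (∀ i ∈ l.overlined, P i) ∧ ∀ i ∈ l.nonOverlined, Q i then overWeight α β l else 0 := by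
  rw [overWeight, overWeight, prod_map_ite_zero, Finset.prod_ite_zero]
  split_ifs <;> simp_all

theorem ConvTo.of_eventually_eq {s : ℕ → R⟦X⟧} {f : R⟦X⟧} (h : ∀ᶠ N in atTop, s N = f) :
    ConvTo s f := fun n => by
  filter_upwards [h] with N hN
  rw [hN]

theorem convTo_prod_of_eq_one {h : ℕ → R⟦X⟧} {L : ℕ} (hL : ∀ i, L ≤ i → h i = 1) :
    ConvTo (fun N => ∏ i ∈ Finset.range N, h i) (∏ i ∈ Finset.range L, h i) := by
  refine ConvTo.of_eventually_eq ?_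
  filter_upwards [eventually_ge_atTop L] with N hN
  refine (Finset.prod_subset (Finset.range_subset_range.2 hN) fun i _ hi => hL i ?_).symm
  simpa using hi

theorem overGF_mul_of_eq_zero {α β : ℕ → R} {L : ℕ} (hα : ∀ i, L < i → α i = 0)
    (hβ : ∀ i, L < i → β i = 0) :
    overGF α β * ∏ i ∈ Finset.range L, (1 - C (β (i + 1)) * X ^ (i + 1)) =
      ∏ i ∈ Finset.range L, (1 + C (α (i + 1)) * X ^ (i + 1)) := by
  refine (convTo_overGF α β (convTo_prod_of_eq_one fun i hi => ?_)).unique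
    (convTo_prod_of_eq_one fun i hi => ?_)
  · rw [hβ _ (by omega)]; simp
  · rw [hα _ (by omega)]; simp

/-- The difference of indicators is nonzero only at l + 1 = a. This turns generating functions with
bounded largest part into one that weights the largest part a by g a. -/
theorem ite_add_sum_range_ite (g : ℕ → R) (hg : g 0 = 1) (w : R) (a N : ℕ) :
    (if a ≤ 0 then w else 0) + ∑ l ∈ Finset.range N,
      g (l + 1) * ((if a ≤ l + 1 then w else 0) - if a ≤ l then w else 0) =
      if a ≤ N then g a * w else 0 := by
  induction N with
  | zero =>
    rw [Finset.sum_range_zero, add_zero]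
    split_ifs with h
    · rw [Nat.le_zero.1 h, hg, one_mul]
    · rfl
  | succ N ih =>
    rw [Finset.sum_range_succ, ← add_assoc, ih]
    rcases lt_trichotomy a (N + 1) with h | h | h
    · simp [show a ≤ N by omega, show a ≤ N + 1 by omega]
    · subst h; simp
    · simp [show ¬ a ≤ N by omega, show ¬ a ≤ N + 1 by omega]

/-- Step r catches the largest parts 2r+1 and 2r+2, which share ⌈a/2⌉ = r + 1. The second difference
isolates a = 2r+1 not in S, because a ≤ 2r already forces 2r+1 ∉ S; it replaces the weight 1 by z
there, which accounts for χ. -/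
theorem ite_add_sum_range_ite_two (g : ℕ → R) (hg : g 0 = 1) (w z : R) {a : ℕ} {S : Finset ℕ}
    (hS : ∀ i ∈ S, i ≤ a) (N : ℕ) :
    (if a ≤ 0 then w else 0) + ∑ r ∈ Finset.range N,
      g (r + 1) * (((if a ≤ 2 * r + 2 then w else 0) - if a ≤ 2 * r then w else 0) +
        (z - 1) * ((if a ≤ 2 * r + 1 ∧ 2 * r + 1 ∉ S then w else 0) - if a ≤ 2 * r then w else 0)) =
      if a ≤ 2 * N then g ((a + 1) / 2) * (if Odd a ∧ a ∉ S then z else 1) * w else 0 := by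
  induction N with
  | zero =>
    rw [Finset.sum_range_zero, add_zero]
    split_ifs <;> simp_all
  | succ N ih =>
    rw [Finset.sum_range_succ, ← add_assoc, ih]
    rcases lt_trichotomy a (2 * N + 1) with h | h | h
    · have : 2 * N + 1 ∉ S := fun hi => by have := hS _ hi; omega
      simp [show a ≤ 2 * N by omega, show a ≤ 2 * N + 1 by omega, show a ≤ 2 * N + 2 by omega,
        show a ≤ 2 * (N + 1) by omega, this]
    · subst h
      rw [show (2 * N + 1 + 1) / 2 = N + 1 by omega]
      by_cases h : 2 * N + 1 ∈ S
      · simp [h, show 2 * N + 1 ≤ 2 * (N + 1) by omega]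
      · simp [h, show 2 * N + 1 ≤ 2 * (N + 1) by omega]
        ring
    · rcases eq_or_lt_of_le (show 2 * N + 2 ≤ a by omega) with h' | h'
      · subst h'
        have : ¬ Odd (2 * N + 2) := by rw [Nat.not_odd_iff_even]; exact ⟨N + 1, by ring⟩
        rw [show (2 * N + 2 + 1) / 2 = N + 1 by omega]
        simp [show 2 * N + 2 ≤ 2 * (N + 1) by omega, this]
      · simp [show ¬ a ≤ 2 * N by omega, show ¬ a ≤ 2 * N + 1 by omega,
          show ¬ a ≤ 2 * N + 2 by omega, show ¬ a ≤ 2 * (N + 1) by omega]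

end Cut

section Overpartition

variable {n : ℕ} (l : Overpartition n)

theorem mem_parts_iff (i : ℕ) : i ∈ l.parts ↔ i ∈ l.overlined ∨ i ∈ l.nonOverlined := by
  constructor
  · intro h
    by_cases ho : i ∈ l.overlined
    · exact Or.inl ho
    · refine Or.inr ?_
      rw [Overpartition.nonOverlined, ← Multiset.count_pos, Multiset.count_sub,
        Multiset.count_eq_zero_of_notMem ho, Nat.sub_zero]
      exact Multiset.count_pos.2 h
  · rintro (h | h)
    · exact Multiset.mem_toFinset.1 (l.overlined_subset h)
    · exact Multiset.mem_of_le (Multiset.sub_le_self _ _) h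

theorem largest_le_iff (L : ℕ) :
    l.largest ≤ L ↔ (∀ i ∈ l.overlined, i ≤ L) ∧ ∀ i ∈ l.nonOverlined, i ≤ L := by
  rw [Overpartition.largest, Multiset.sup_le]
  simp only [mem_parts_iff, or_imp, forall_and]

theorem largest_le : l.largest ≤ n := by
  rw [Overpartition.largest, Multiset.sup_le]
  intro i hi
  have := Multiset.le_sum_of_mem hi
  rwa [Overpartition.parts, l.toPartition.parts_sum] at this

theorem le_largest_of_mem_overlined {i : ℕ} (hi : i ∈ l.overlined) : i ≤ l.largest :=
  Multiset.le_sup ((mem_parts_iff l i).2 (Or.inl hi))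

theorem card_parts : l.parts.card = l.overlined.card + l.nonOverlined.card := by
  have h : l.overlined.val ≤ l.parts :=
    (Multiset.le_iff_subset l.overlined.nodup).2 fun i hi =>
      Multiset.mem_toFinset.1 (l.overlined_subset hi)
  rw [Overpartition.nonOverlined, Multiset.card_sub h]
  have := Multiset.card_le_card h
  simp only [Finset.card_val] at this ⊢
  omega

theorem overWeight_T :
    overWeight (fun _ => (T 1 : LaurentPolynomial ℚ)) (fun _ => T 1) l = T l.parts.card := by
  rw [overWeight, Finset.prod_const, Multiset.map_const', Multiset.prod_replicate,
    LaurentPolynomial.T_pow, LaurentPolynomial.T_pow, ← T_add, card_parts]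
  push_cast
  ring_nf

theorem overWeight_T_even :
    overWeight (fun _ => (T 1 : LaurentPolynomial ℚ)) (fun i => if Even i then T 1 else 1) l =
      T (l.parts.card - l.oddNonOverlined.card) := by
  have h : ∀ s : Multiset ℕ, (s.map fun i => if Even i then (T 1 : LaurentPolynomial ℚ) else 1).prod
      = T (s.card - (s.filter fun i => Odd i).card) := fun s => by
    induction s using Multiset.induction with
    | empty => simp
    | cons a s ih =>
      rw [Multiset.map_cons, Multiset.prod_cons, ih, Multiset.card_cons]
      rcases Nat.even_or_odd a with ha | ha
      · rw [if_pos ha, Multiset.filter_cons_of_neg _ (by simpa using ha), ← T_add]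
        push_cast
        ring_nf
      · rw [if_neg (by simpa using ha), Multiset.filter_cons_of_pos _ ha, one_mul,
          Multiset.card_cons]
        push_cast
        ring_nf
  rw [overWeight, Finset.prod_const, h, LaurentPolynomial.T_pow, ← T_add, card_parts,
    Overpartition.oddNonOverlined]
  push_cast
  ring_nf

end Overpartition

/-! ### The rank series as sums over the largest part -/

/-- The generating function of the ranks of overpartitions. -/
noncomputable def rankGF : BiSeries := mk fun n => ∑ l : Overpartition n, T (-l.rank)

/-- The generating function of the `M2`-ranks of overpartitions. -/
noncomputable def m2RankGF : BiSeries := mk fun n => ∑ l : Overpartition n, T (-l.m2Rank)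

/-- Setting the weights to zero beyond L removes exactly the overpartitions with a part larger than
L and makes both infinite products finite. -/
theorem coeff_prod_mul_of_mul_eq_one {R : Type*} [CommRing R] (α β : ℕ → R) {L : ℕ} {G : R⟦X⟧}
    (hG : (∏ i ∈ Finset.range L, (1 - C (β (i + 1)) * X ^ (i + 1))) * G = 1) (n : ℕ) :
    coeff n ((∏ i ∈ Finset.range L, (1 + C (α (i + 1)) * X ^ (i + 1))) * G) =
      ∑ l : Overpartition n, if l.largest ≤ L then overWeight α β l else 0 := by
  have h := overGF_mul_of_eq_zero (L := L) (α := fun i => if i ≤ L then α i else 0)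
    (β := fun i => if i ≤ L then β i else 0)
    (fun i hi => if_neg (by omega)) (fun i hi => if_neg (by omega))
  have h1 : ∀ γ : ℕ → R, ∀ i ∈ Finset.range L,
      (if i + 1 ≤ L then γ (i + 1) else 0) = γ (i + 1) :=
    fun γ i hi => if_pos (by have := Finset.mem_range.1 hi; omega)
  have hp : ∏ i ∈ Finset.range L, (1 - C (if i + 1 ≤ L then β (i + 1) else 0) * X ^ (i + 1)) =
      ∏ i ∈ Finset.range L, (1 - C (β (i + 1)) * X ^ (i + 1)) :=
    Finset.prod_congr rfl fun i hi => by rw [h1 β i hi]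
  have hq : ∏ i ∈ Finset.range L, (1 + C (if i + 1 ≤ L then α (i + 1) else 0) * X ^ (i + 1)) =
      ∏ i ∈ Finset.range L, (1 + C (α (i + 1)) * X ^ (i + 1)) :=
    Finset.prod_congr rfl fun i hi => by rw [h1 α i hi]
  rw [hp, hq] at h
  rw [← h, mul_assoc, hG, mul_one, overGF, coeff_mk]
  refine Finset.sum_congr rfl fun l _ => ?_
  rw [overWeight_ite _ _ (fun i => i ≤ L) (fun i => i ≤ L)]
  simp only [largest_le_iff]

theorem coeff_rankProd (L n : ℕ) : coeff n (rankProd L) =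
    ∑ l : Overpartition n, if l.largest ≤ L then T l.parts.card else 0 := by
  have := coeff_prod_mul_of_mul_eq_one (fun _ => (T 1 : LaurentPolynomial ℚ)) (fun _ => T 1)
    (L := L) (G := ∏ i ∈ Finset.range L, geo (i + 1)) (by
      rw [← Finset.prod_mul_distrib]
      exact Finset.prod_eq_one fun i _ => one_sub_mul_geo i.succ_pos) n
  simp only [overWeight_T] at this
  exact this

theorem prod_range_two_mul {M : Type*} [CommMonoid M] (h : ℕ → M) (r : ℕ) :
    ∏ i ∈ Finset.range (2 * r), h i = ∏ i ∈ Finset.range r, (h (2 * i) * h (2 * i + 1)) := by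
  induction r with
  | zero => simp
  | succ r ih => rw [Finset.prod_range_succ, ← ih, mul_add_one, Finset.prod_range_succ,
      Finset.prod_range_succ, mul_assoc]

theorem one_sub_even_mul_geo (i : ℕ) :
    (1 - C (if Even (i + 1) then (T 1 : LaurentPolynomial ℚ) else 1) * X ^ (i + 1)) *
      (if Even (i + 1) then geo (i + 1) else geoOne (i + 1)) = 1 := by
  split_ifs
  · exact one_sub_mul_geo i.succ_pos
  · rw [map_one, one_mul]
    exact one_sub_mul_geoOne i.succ_pos

theorem m2Prod_eq (r : ℕ) : (∏ i ∈ Finset.range (2 * r), (1 + zT 1 * X ^ (i + 1))) *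
    ∏ i ∈ Finset.range (2 * r), (if Even (i + 1) then geo (i + 1) else geoOne (i + 1)) =
      m2Prod r := by
  rw [prod_range_two_mul (M := BiSeries), prod_range_two_mul (M := BiSeries), m2Prod, mul_assoc,
    ← Finset.prod_mul_distrib (s := Finset.range r) (f := fun i => geoOne (2 * i + 1))]
  congr 1
  refine Finset.prod_congr rfl fun i _ => ?_
  rw [if_neg (by simp), if_pos ⟨i + 1, by ring⟩]

theorem coeff_m2Prod (r n : ℕ) : coeff n (m2Prod r) =
    ∑ l : Overpartition n,
      if l.largest ≤ 2 * r then T (l.parts.card - l.oddNonOverlined.card) else 0 := by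
  have := coeff_prod_mul_of_mul_eq_one (fun _ => (T 1 : LaurentPolynomial ℚ))
    (fun i => if Even i then T 1 else 1) (L := 2 * r)
    (G := ∏ i ∈ Finset.range (2 * r), (if Even (i + 1) then geo (i + 1) else geoOne (i + 1))) (by
      rw [← Finset.prod_mul_distrib]
      exact Finset.prod_eq_one fun i _ => one_sub_even_mul_geo i) n
  simp only [overWeight_T_even] at this
  rw [← m2Prod_eq]
  exact this

/-- The weight of an overlined 2r+1 is set to zero, so of the two factors belonging to that size
only the denominator remains. -/
theorem coeff_geoOne_mul_m2Prod (r n : ℕ) : coeff n (geoOne (2 * r + 1) * m2Prod r) =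
    ∑ l : Overpartition n, if l.largest ≤ 2 * r + 1 ∧ 2 * r + 1 ∉ l.overlined then
      T (l.parts.card - l.oddNonOverlined.card) else 0 := by
  have := coeff_prod_mul_of_mul_eq_one
    (fun i => if i ≠ 2 * r + 1 then (T 1 : LaurentPolynomial ℚ) else 0)
    (fun i => if True then (if Even i then T 1 else 1) else 0) (L := 2 * r + 1)
    (G := ∏ i ∈ Finset.range (2 * r + 1), (if Even (i + 1) then geo (i + 1) else geoOne (i + 1)))
    (by
      rw [← Finset.prod_mul_distrib]
      refine Finset.prod_eq_one fun i _ => ?_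
      rw [if_pos trivial]
      exact one_sub_even_mul_geo i) n
  simp only [overWeight_ite _ _ (fun i => i ≠ 2 * r + 1) (fun _ => True), overWeight_T_even] at this
  rw [Finset.prod_range_succ, Finset.prod_range_succ, if_neg (by simp), if_neg (by simp),
    Finset.prod_congr rfl (g := fun i => 1 + zT 1 * X ^ (i + 1)) (fun i hi => by
      have := Finset.mem_range.1 hi
      rw [if_pos (by omega), zT])] at this
  rw [← m2Prod_eq, mul_comm, mul_assoc]
  convert this using 2
  · simp
  · rename_i l _
    rw [← ite_and]
    congr 1
    simp only [eq_iff_iff, and_congr_right_iff]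
    intro _
    constructor
    · intro h
      exact ⟨fun i hi hir => h (hir ▸ hi), by simp⟩
    · intro h hr
      exact h.1 _ hr rfl

theorem coeff_zT_mul (m : ℤ) (n : ℕ) (f : BiSeries) : coeff n (zT m * f) = T m * coeff n f := by
  rw [zT, coeff_C_mul]

theorem convTo_rankGF : ConvTo (fun N => 1 + ∑ l ∈ Finset.range N,
    zT (-(l + 1)) * (rankProd (l + 1) - rankProd l)) rankGF := by
  intro n
  filter_upwards [eventually_ge_atTop n] with N hN
  have h0 : (1 : BiSeries) = rankProd 0 := by simp [rankProd]
  rw [h0, rankGF, coeff_mk, map_add, map_sum]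
  simp only [coeff_zT_mul, map_sub, coeff_rankProd]
  simp only [← Finset.sum_sub_distrib, Finset.mul_sum]
  rw [Finset.sum_comm, ← Finset.sum_add_distrib]
  refine Finset.sum_congr rfl fun l _ => ?_
  have := ite_add_sum_range_ite (fun a => (T (-(a : ℤ)) : LaurentPolynomial ℚ)) (by simp)
    (T l.parts.card) l.largest N
  rw [if_pos ((largest_le l).trans hN), ← T_add] at this
  push_cast at this
  rw [this, Overpartition.rank]
  congr 1
  ring

theorem ceil_half (a : ℕ) : ⌈(a : ℚ) / 2⌉ = ((a + 1) / 2 : ℕ) := by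
  have h : 2 * ((a + 1) / 2) = a ∨ 2 * ((a + 1) / 2) = a + 1 := by omega
  generalize (a + 1) / 2 = b at h ⊢
  rw [Int.ceil_eq_iff]
  rcases h with h | h <;>
  · have h' := congrArg (Nat.cast : ℕ → ℚ) h
    push_cast at h' ⊢
    constructor <;> linarith

theorem convTo_m2RankGF : ConvTo (fun N => 1 + ∑ r ∈ Finset.range N, zT (-(r + 1)) *
    (2 * (zT 1 * X ^ (2 * r + 1) * geoOne (2 * r + 1) * m2Prod r) +
      (m2Prod (r + 1) - (1 + zT 1 * X ^ (2 * r + 1)) * geoOne (2 * r + 1) * m2Prod r)))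
    m2RankGF := by
  -- Rearranged into the pattern of `ite_add_sum_range_ite_two`: all new overpartitions with weight
  -- 1, plus z - 1 times those whose largest part is a non-overlined 2r+1.
  have hterm : ∀ r, 2 * (zT 1 * X ^ (2 * r + 1) * geoOne (2 * r + 1) * m2Prod r) +
      (m2Prod (r + 1) - (1 + zT 1 * X ^ (2 * r + 1)) * geoOne (2 * r + 1) * m2Prod r) =
      (m2Prod (r + 1) - m2Prod r) + (zT 1 * (geoOne (2 * r + 1) * m2Prod r - m2Prod r) -
        (geoOne (2 * r + 1) * m2Prod r - m2Prod r)) := fun r => by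
    have := one_sub_mul_geoOne (d := 2 * r + 1) (by omega)
    linear_combination -zT 1 * m2Prod r * this
  intro n
  filter_upwards [eventually_ge_atTop n] with N hN
  have h0 : (1 : BiSeries) = m2Prod 0 := by simp [m2Prod]
  rw [Finset.sum_congr rfl fun r _ => by rw [hterm r], h0, m2RankGF, coeff_mk, map_add, map_sum]
  simp only [coeff_zT_mul, map_sub, map_add, coeff_m2Prod, coeff_geoOne_mul_m2Prod]
  simp only [← Finset.sum_sub_distrib, Finset.mul_sum, ← Finset.sum_add_distrib]
  rw [Finset.sum_comm, ← Finset.sum_add_distrib]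
  refine Finset.sum_congr rfl fun l _ => ?_
  have := ite_add_sum_range_ite_two (fun a => (T (-(a : ℤ)) : LaurentPolynomial ℚ)) (by simp)
    (T (l.parts.card - l.oddNonOverlined.card)) (T 1) (fun i => le_largest_of_mem_overlined l) N
  rw [if_pos (show l.largest ≤ 2 * N by have := largest_le l; omega)] at this
  push_cast at this
  simp only [sub_one_mul] at this
  rw [Overpartition.m2Rank, ceil_half, Overpartition.chi]
  refine (Eq.trans ?_ this).trans ?_
  · rfl
  · split_ifs
    · rw [← T_add, ← T_add]
      congr 1
      push_cast
      ring
    · rw [mul_one, ← T_add]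
      congr 1
      push_cast
      ring

/-! ### The `q`-binomial theorem -/

section QBinomial

variable {R : Type*} [CommRing R]

theorem exists_convTo_prod_one_sub {t : R⟦X⟧} :
    ∃ V, ConvTo (fun L => ∏ i ∈ Finset.range L, (1 - t * X ^ i)) V :=
  exists_convTo fun M => by
    filter_upwards [eventually_ge_atTop M] with N hN
    rw [Finset.prod_range_succ]
    obtain ⟨k, rfl⟩ := Nat.exists_eq_add_of_le hN
    exact ⟨-(∏ i ∈ Finset.range (M + k), (1 - t * X ^ i)) * t * X ^ k, by ring⟩

theorem exists_convTo_sum_mul_pow {t : R⟦X⟧} (ht : X ∣ t) (c : ℕ → R⟦X⟧) :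
    ∃ F, ConvTo (fun N => ∑ n ∈ Finset.range N, c n * t ^ n) F :=
  exists_convTo fun M => by
    filter_upwards [eventually_ge_atTop M] with N hN
    rw [Finset.sum_range_succ, add_sub_cancel_left]
    exact Dvd.dvd.mul_left ((pow_dvd_pow X hN).trans (pow_dvd_pow_of_dvd ht N)) _

/-- The classical argument: F(t) = ∑ c_n t^n satisfies (1-t) F(t) = (1-at) F(tq), and F(t q^k) tends
to 1. The values F(t q^k) are constructed as separate limits G k, so no substitution into series is
needed. -/
theorem mul_eq_of_qBinomial {a t : R⟦X⟧} (ht : X ∣ t) {c : ℕ → R⟦X⟧} (h0 : c 0 = 1)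
    (hc : ∀ n, (1 - X ^ (n + 1)) * c (n + 1) = (1 - a * X ^ n) * c n) {F V W : R⟦X⟧}
    (hF : ConvTo (fun N => ∑ n ∈ Finset.range N, c n * t ^ n) F)
    (hV : ConvTo (fun L => ∏ i ∈ Finset.range L, (1 - t * X ^ i)) V)
    (hW : ConvTo (fun L => ∏ i ∈ Finset.range L, (1 - a * t * X ^ i)) W) : F * V = W := by
  have hk : ∀ k : ℕ, X ∣ t * X ^ k := fun k => Dvd.dvd.mul_right ht _
  choose G hG using fun k : ℕ => exists_convTo_sum_mul_pow (hk k) c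
  have hG0 : G 0 = F := by
    refine (hG 0).unique ?_
    simpa using hF
  have hstep : ∀ k N, (1 - t * X ^ k) * (∑ n ∈ Finset.range (N + 1), c n * (t * X ^ k) ^ n) -
      (1 - a * t * X ^ k) * (∑ n ∈ Finset.range (N + 1), c n * (t * X ^ (k + 1)) ^ n) =
      -((1 - a * X ^ N) * c N * (t * X ^ k) ^ (N + 1)) := fun k N => by
    induction N with
    | zero => simp [h0]; ring
    | succ N ih =>
      rw [Finset.sum_range_succ, Finset.sum_range_succ _ (N + 1)]
      have e : (t * X ^ (k + 1)) ^ (N + 1) = (t * X ^ k) ^ (N + 1) * X ^ (N + 1) := by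
        rw [← mul_pow]; ring
      rw [e, pow_succ (t * X ^ k) (N + 1)]
      linear_combination ih + (t * X ^ k) ^ (N + 1) * hc N
  have hrec : ∀ k, (1 - t * X ^ k) * G k = (1 - a * t * X ^ k) * G (k + 1) := fun k => by
    have h1 := ((ConvTo.const (1 - t * X ^ k)).mul (hG k)).sub
      ((ConvTo.const (1 - a * t * X ^ k)).mul (hG (k + 1)))
    have h2 : ConvTo (fun N => (1 - t * X ^ k) * (∑ n ∈ Finset.range (N + 1), c n * (t * X ^ k) ^ n)
        - (1 - a * t * X ^ k) * (∑ n ∈ Finset.range (N + 1), c n * (t * X ^ (k + 1)) ^ n)) 0 := by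
      refine convTo_zero_of_dvd fun M => ?_
      filter_upwards [eventually_ge_atTop M] with N hN
      rw [hstep, dvd_neg]
      exact Dvd.dvd.mul_left ((pow_dvd_pow X (by omega)).trans (pow_dvd_pow_of_dvd (hk k) _)) _
    exact sub_eq_zero.1 ((h1.comp_tendsto (tendsto_add_atTop_nat 1)).unique h2)
  have hprod : ∀ L, F * ∏ i ∈ Finset.range L, (1 - t * X ^ i) =
      (∏ i ∈ Finset.range L, (1 - a * t * X ^ i)) * G L := fun L => by
    induction L with
    | zero => simp [hG0]
    | succ L ih =>
      rw [Finset.prod_range_succ, Finset.prod_range_succ, mul_assoc, ← hrec]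
      linear_combination (1 - t * X ^ L) * ih
  have hlim : ConvTo G 1 := by
    have : ConvTo (fun L => G L - 1) 0 := by
      refine convTo_zero_of_dvd fun M => ?_
      filter_upwards [eventually_ge_atTop M] with L hL
      refine (((hG L).comp_tendsto (tendsto_add_atTop_nat 1)).sub (ConvTo.const 1)).dvd fun N => ?_
      rw [Finset.sum_range_succ', h0, pow_zero, mul_one, add_sub_cancel_right]
      refine Finset.dvd_sum fun n _ => Dvd.dvd.mul_left ?_ _
      exact ((pow_dvd_pow X hL).trans (dvd_mul_left _ t)).trans (dvd_pow_self _ n.succ_ne_zero)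
    simpa using this.add (ConvTo.const 1)
  have h1 := (ConvTo.const F).mul hV
  simp only [hprod] at h1
  simpa using h1.unique (hW.mul hlim)

end QBinomial

/-! ### The crank of a partition -/

/-- The monomial `z ^ crank`, with the usual modification at the partition `1`. -/
noncomputable def crankPoly (s : Multiset ℕ) : LaurentPolynomial ℚ :=
  if s = {1} then T 1 + T (-1) - 1 else T (Overpartition.crank s)

/-- The generating function of the crank. -/
noncomputable def crankGF : BiSeries := mk fun n => ∑ p : n.Partition, crankPoly p.parts

/-- The generating function of partitions without ones and with largest part at most `l`. -/
noncomputable def noOnes (l : ℕ) : BiSeries :=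
  partGF fun i => if i ≠ 1 ∧ i ≤ l then 1 else 0

/-- The generating function of partitions without ones by the number of parts larger than `k`. -/
noncomputable def noOnesLarge (k : ℕ) : BiSeries :=
  partGF fun i => if i ≠ 1 then (if k < i then T 1 else 1) else 0

theorem noOnes_zero : noOnes 0 = 1 := by
  have := partGF_mul (R := LaurentPolynomial ℚ) (V := 1)
    (fun i => if i ≠ 1 ∧ i ≤ 0 then 1 else 0) (by
      convert ConvTo.const 1 using 2 with L
      refine Finset.prod_eq_one fun i _ => ?_
      rw [if_neg (by omega)]
      simp)
  rwa [mul_one] at this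

theorem noOnes_succ (l : ℕ) :
    noOnes (l + 1) = (1 - X) * ∏ i ∈ Finset.range (l + 1), geoOne (i + 1) := by
  have h := partGF_mul (R := LaurentPolynomial ℚ)
    (fun i => if i ≠ 1 ∧ i ≤ l + 1 then 1 else 0)
    (convTo_prod_of_eq_one (L := l + 1) fun i hi => by
      rw [if_neg (by omega)]
      simp)
  change noOnes (l + 1) * _ = 1 at h
  rw [Finset.prod_range_succ'] at h
  rw [if_neg (by omega), map_zero, zero_mul, sub_zero, mul_one] at h
  have h1 : ∏ i ∈ Finset.range l,
      (1 - C (if i + 1 + 1 ≠ 1 ∧ i + 1 + 1 ≤ l + 1 then (1 : LaurentPolynomial ℚ) else 0) *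
        X ^ (i + 1 + 1)) = ∏ i ∈ Finset.range l, (1 - X ^ (i + 1 + 1)) :=
    Finset.prod_congr rfl fun i hi => by
      have := Finset.mem_range.1 hi
      rw [if_pos (by omega)]
      simp
  rw [h1] at h
  have h2 : (∏ i ∈ Finset.range (l + 1), (1 - X ^ (i + 1) : BiSeries)) *
      ∏ i ∈ Finset.range (l + 1), geoOne (i + 1) = 1 := by
    rw [← Finset.prod_mul_distrib]
    exact Finset.prod_eq_one fun i _ => one_sub_mul_geoOne i.succ_pos
  rw [Finset.prod_range_succ' (fun i => (1 - X ^ (i + 1) : BiSeries)), zero_add, pow_one] at h2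
  linear_combination -noOnes (l + 1) * h2 +
    (1 - X) * (∏ i ∈ Finset.range (l + 1), geoOne (i + 1)) * h

/-- The coefficients `(z q; q) _ n / (q; q) _ n`. -/
noncomputable def crankCoeff (n : ℕ) : BiSeries :=
  (∏ i ∈ Finset.range n, (1 - zT 1 * X ^ (i + 1))) * ∏ i ∈ Finset.range n, geoOne (i + 1)

/-- Parts from 2 to k+1 contribute (1-q) ∏ 1/(1-q^i) over i ≤ k+1, and larger parts contribute 1/(1
- z q^i); multiplying by W cancels the latter and leaves the first k+1 factors of W. -/
theorem noOnesLarge_mul {W : BiSeries}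
    (hW : ConvTo (fun L => ∏ i ∈ Finset.range L, (1 - zT 1 * X ^ (i + 1))) W) (k : ℕ) :
    noOnesLarge (k + 1) * W = (1 - X) * crankCoeff (k + 1) := by
  set γ : ℕ → LaurentPolynomial ℚ := fun i => if i ≠ 1 then (if k + 1 < i then T 1 else 1) else 0
    with hγ
  have hN : noOnesLarge (k + 1) = partGF γ := rfl
  have hγ0 : γ (0 + 1) = 0 := by simp [hγ]
  have hγ1 : ∀ i, i < k → γ (i + 1 + 1) = 1 := fun i hi => by
    simp only [hγ]
    rw [if_pos (by omega), if_neg (by omega)]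
  have hγ2 : ∀ d, γ (k + 1 + d + 1) = T 1 := fun d => by
    simp only [hγ]
    rw [if_pos (by omega), if_pos (by omega)]
  clear_value γ
  have hzT : (C (T 1) : BiSeries) = zT 1 := rfl
  have h2 : (∏ i ∈ Finset.range (k + 1), (1 - X ^ (i + 1) : BiSeries)) *
      ∏ i ∈ Finset.range (k + 1), geoOne (i + 1) = 1 := by
    rw [← Finset.prod_mul_distrib]
    exact Finset.prod_eq_one fun i _ => one_sub_mul_geoOne i.succ_pos
  have h3 : (∏ i ∈ Finset.range (k + 1), (1 - zT 1 * X ^ (i + 1) : BiSeries)) *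
      ∏ i ∈ Finset.range (k + 1), geo (i + 1) = 1 := by
    rw [← Finset.prod_mul_distrib]
    exact Finset.prod_eq_one fun i _ => one_sub_mul_geo i.succ_pos
  have h4 : (1 - X : BiSeries) * geoOne 1 = 1 := by simpa using one_sub_mul_geoOne one_pos
  have hv : ∀ d, (1 - X) * (∏ i ∈ Finset.range (k + 1 + d), (1 - C (γ (i + 1)) * X ^ (i + 1))) *
      ∏ i ∈ Finset.range (k + 1), (1 - zT 1 * X ^ (i + 1)) =
      (∏ i ∈ Finset.range (k + 1), (1 - X ^ (i + 1) : BiSeries)) *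
        ∏ i ∈ Finset.range (k + 1 + d), (1 - zT 1 * X ^ (i + 1)) := fun d => by
    induction d with
    | zero =>
      have e : ∏ i ∈ Finset.range k, (1 - C (γ (i + 1 + 1)) * X ^ (i + 1 + 1)) =
          ∏ i ∈ Finset.range k, (1 - X ^ (i + 1 + 1) : BiSeries) :=
        Finset.prod_congr rfl fun i hi => by
          rw [hγ1 i (Finset.mem_range.1 hi), map_one, one_mul]
      rw [add_zero, Finset.prod_range_succ' (fun i => 1 - C (γ (i + 1)) * X ^ (i + 1)),
        Finset.prod_range_succ' (fun i => (1 - X ^ (i + 1) : BiSeries)),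
        hγ0, map_zero, zero_mul, sub_zero, mul_one, e, zero_add, pow_one,
        mul_comm (1 - X : BiSeries)]
    | succ d ih =>
      rw [← add_assoc, Finset.prod_range_succ, Finset.prod_range_succ _ (k + 1 + d), hγ2, hzT]
      rw [← mul_assoc (1 - X), mul_right_comm, ih, mul_assoc]
  have hV : ConvTo (fun L => ∏ i ∈ Finset.range L, (1 - C (γ (i + 1)) * X ^ (i + 1)))
      (geoOne 1 * (∏ i ∈ Finset.range (k + 1), (1 - X ^ (i + 1) : BiSeries)) *
        (∏ i ∈ Finset.range (k + 1), geo (i + 1)) * W) := by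
    intro n
    have := ((ConvTo.const (geoOne 1 * (∏ i ∈ Finset.range (k + 1), (1 - X ^ (i + 1) : BiSeries)) *
      (∏ i ∈ Finset.range (k + 1), geo (i + 1)))).mul hW) n
    filter_upwards [this, eventually_ge_atTop (k + 1)] with L hL hk
    rw [← hL]
    obtain ⟨d, rfl⟩ := Nat.exists_eq_add_of_le hk
    congr 1
    have e := hv d
    linear_combination
      geoOne 1 * (∏ i ∈ Finset.range (k + 1), geo (i + 1)) * e -
      (∏ i ∈ Finset.range (k + 1 + d), (1 - C (γ (i + 1)) * X ^ (i + 1))) *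
        (h4 * (∏ i ∈ Finset.range (k + 1), (1 - zT 1 * X ^ (i + 1))) *
          (∏ i ∈ Finset.range (k + 1), geo (i + 1)) + h3)
  have h := partGF_mul γ hV
  rw [crankCoeff, hN]
  linear_combination (1 - X) * (∏ i ∈ Finset.range (k + 1), (1 - zT 1 * X ^ (i + 1))) *
    (∏ i ∈ Finset.range (k + 1), geoOne (i + 1)) * h - partGF γ * W *
    (h4 * (∏ i ∈ Finset.range (k + 1), (1 - X ^ (i + 1))) *
      (∏ i ∈ Finset.range (k + 1), geoOne (i + 1)) *
      (∏ i ∈ Finset.range (k + 1), (1 - zT 1 * X ^ (i + 1))) *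
      (∏ i ∈ Finset.range (k + 1), geo (i + 1)) +
      h2 * (∏ i ∈ Finset.range (k + 1), (1 - zT 1 * X ^ (i + 1))) *
      (∏ i ∈ Finset.range (k + 1), geo (i + 1)) + h3)

theorem prod_map_ite_T (s : Multiset ℕ) (k : ℕ) :
    (s.map fun i => if k < i then (T 1 : LaurentPolynomial ℚ) else 1).prod =
      T (s.filter fun i => k < i).card := by
  induction s using Multiset.induction with
  | empty => simp
  | cons a s ih =>
    rw [Multiset.map_cons, Multiset.prod_cons, ih]
    split_ifs with h
    · rw [Multiset.filter_cons_of_pos _ h, Multiset.card_cons, ← T_add]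
      push_cast
      ring_nf
    · rw [Multiset.filter_cons_of_neg _ h, one_mul]

/-- The weights of a partition by the number of its parts larger than `k`, with an extra factor
`u c` if `1` occurs `c > 0` times. -/
noncomputable def oneWeight (k : ℕ) (u : ℕ → LaurentPolynomial ℚ) (i c : ℕ) :
    LaurentPolynomial ℚ :=
  (if i = 1 then u c else 1) * (if k < i then T 1 else 1) ^ c

theorem coeff_genFun_oneWeight (k : ℕ) (u : ℕ → LaurentPolynomial ℚ) (n : ℕ) :
    coeff n (Nat.Partition.genFun (oneWeight k u)) = ∑ p : n.Partition,
      (if 1 ∈ p.parts then u (p.parts.count 1) else 1) *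
        T (p.parts.filter fun i => k < i).card := by
  rw [Nat.Partition.coeff_genFun]
  refine Finset.sum_congr rfl fun p _ => ?_
  rw [Finsupp.prod, Multiset.toFinsupp_support]
  simp only [oneWeight, Multiset.toFinsupp_apply]
  rw [Finset.prod_mul_distrib, Finset.prod_ite_eq' p.parts.toFinset 1
    (fun i => u (p.parts.count i)), ← prod_map_ite_T, Finset.prod_multiset_map_count]
  simp only [Multiset.mem_toFinset]

theorem genFun_oneWeight_zero (k : ℕ) :
    Nat.Partition.genFun (oneWeight k 0) = noOnesLarge k := by
  ext1 n
  rw [coeff_genFun_oneWeight, noOnesLarge, partGF, coeff_mk]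
  refine Finset.sum_congr rfl fun p _ => ?_
  rw [prod_map_ite_zero _ _ (fun i => i ≠ 1), prod_map_ite_T]
  by_cases h : 1 ∈ p.parts
  · rw [if_pos h, if_neg fun h' => h' 1 h rfl]
    simp
  · rw [if_neg h, if_pos fun i hi (h1 : i = 1) => h (h1 ▸ hi), one_mul]

theorem genFun_oneWeight {k : ℕ} (hk : 0 < k) (y : LaurentPolynomial ℚ) :
    Nat.Partition.genFun (oneWeight k fun c => if c = k then y else 0) =
      (1 + C y * X ^ k) * noOnesLarge k := by
  rw [← genFun_oneWeight_zero]
  have h1 : genFactor (oneWeight k fun c => if c = k then y else 0) 1 = 1 + C y * X ^ k := by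
    ext1 n
    rw [genFactor, coeff_mk, map_add, coeff_one, coeff_C_mul, coeff_X_pow]
    simp only [oneWeight, isUnit_one, IsUnit.dvd, if_true, Nat.div_one,
      if_neg (show ¬ k < 1 by omega),
      one_pow, mul_one, mul_ite, mul_zero]
    split_ifs <;> first | omega | simp
  have h0 : genFactor (oneWeight k 0) 1 = 1 := by
    ext1 n
    rw [genFactor, coeff_mk, coeff_one]
    simp [oneWeight]
  have hs : ∀ u : ℕ → LaurentPolynomial ℚ, ∀ i, genFactor (oneWeight k u) (i + 1 + 1) =
      genFactor (oneWeight k 0) (i + 1 + 1) := fun u i => by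
    ext1 n
    simp [genFactor, oneWeight]
  have a := (convTo_genFun (oneWeight k fun c => if c = k then y else 0)).comp_tendsto
    (tendsto_add_atTop_nat 1)
  have b := (ConvTo.const (1 + C y * X ^ k)).mul ((convTo_genFun (oneWeight k 0)).comp_tendsto
    (tendsto_add_atTop_nat 1))
  simp only [Finset.prod_range_succ', zero_add, h1, h0, hs, mul_one] at a b
  refine a.unique ?_
  simpa only [mul_comm] using b

/-- A generating product always gives weight 1 to zero occurrences of a part. Partitions with
exactly k ones are therefore obtained as a difference, subtracting the partitions without ones. -/
theorem coeff_ones {k : ℕ} (hk : 0 < k) (n : ℕ) :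
    coeff n (zT (-k) * (X ^ k * noOnesLarge k)) = ∑ p : n.Partition,
      if p.parts.count 1 = k then T ((p.parts.filter fun i => k < i).card - k) else 0 := by
  have h : zT (-k) * (X ^ k * noOnesLarge k) =
      Nat.Partition.genFun (oneWeight k fun c => if c = k then T (-k) else 0) -
        Nat.Partition.genFun (oneWeight k 0) := by
    rw [genFun_oneWeight hk, genFun_oneWeight_zero, zT]
    ring
  rw [h, map_sub, coeff_genFun_oneWeight, coeff_genFun_oneWeight, ← Finset.sum_sub_distrib]
  refine Finset.sum_congr rfl fun p _ => ?_
  rw [← sub_mul]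
  by_cases h : 1 ∈ p.parts
  · rw [if_pos h, if_pos h]
    split_ifs
    · rw [Pi.zero_apply, sub_zero, ← T_add]
      ring_nf
    · simp
  · rw [if_neg h, if_neg h, Multiset.count_eq_zero_of_notMem h, if_neg hk.ne]
    simp

theorem coeff_noOnes (l n : ℕ) : coeff n (noOnes l) = ∑ p : n.Partition,
    if p.parts.sup ≤ l then (if p.parts.count 1 = 0 then 1 else 0) else 0 := by
  rw [noOnes, partGF, coeff_mk]
  refine Finset.sum_congr rfl fun p _ => ?_
  rw [prod_map_ite_zero p.parts (fun _ => 1) (fun i => i ≠ 1 ∧ i ≤ l), ← ite_and]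
  simp only [Multiset.map_const', Multiset.prod_replicate, one_pow, Multiset.sup_le,
    Multiset.count_eq_zero]
  congr 1
  simp only [eq_iff_iff]
  constructor
  · exact fun h => ⟨fun i hi => (h i hi).2, fun h1 => (h 1 h1).1 rfl⟩
  · exact fun h i hi => ⟨fun h1 => h.2 (h1 ▸ hi), h.1 i hi⟩

theorem sum_ite_parts_eq (n : ℕ) (y : LaurentPolynomial ℚ) :
    ∑ p : n.Partition, (if p.parts = {1} then y else 0) = if n = 1 then y else 0 := by
  split_ifs with h
  · subst h
    rw [Finset.sum_eq_single (Nat.Partition.indiscrete 1)]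
    · simp
    · intro b _ hb
      exact absurd (Subsingleton.elim b _) hb
    · exact fun h => absurd (Finset.mem_univ _) h
  · refine Finset.sum_eq_zero fun p _ => if_neg fun hp => h ?_
    rw [← p.parts_sum, hp]
    simp

/-- Partitions without ones are sorted by largest part, the others by their number k + 1 of ones.
The term (z - 1) q implements the modification at the partition 1, whose unmodified crank is -1. -/
theorem convTo_crankGF : ConvTo (fun N => noOnes 0 + (∑ l ∈ Finset.range N,
    zT (l + 1) * (noOnes (l + 1) - noOnes l)) +
    (∑ k ∈ Finset.range N, zT (-(k + 1)) * (X ^ (k + 1) * noOnesLarge (k + 1))) +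
    (zT 1 * X - X)) crankGF := by
  intro n
  filter_upwards [eventually_ge_atTop n] with N hN
  have hX : coeff n (zT 1 * X - X : BiSeries) = ∑ p : n.Partition,
      if p.parts = {1} then T 1 - 1 else 0 := by
    rw [sum_ite_parts_eq, map_sub, coeff_zT_mul, coeff_X]
    split_ifs <;> simp
  have hk : ∀ k : ℕ, coeff n (zT (-((k : ℤ) + 1)) * (X ^ (k + 1) * noOnesLarge (k + 1))) =
      ∑ p : n.Partition, if p.parts.count 1 = k + 1 then
        T ((p.parts.filter fun i => k + 1 < i).card - (k + 1)) else 0 := fun k => by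
    have := coeff_ones k.succ_pos n
    push_cast at this
    exact this
  rw [map_add, map_add, map_add, map_sum, map_sum, hX, crankGF, coeff_mk]
  simp only [hk, coeff_zT_mul, map_sub, coeff_noOnes]
  simp only [← Finset.sum_sub_distrib, Finset.mul_sum]
  rw [Finset.sum_comm, Finset.sum_comm (s := Finset.range N), ← Finset.sum_add_distrib,
    ← Finset.sum_add_distrib, ← Finset.sum_add_distrib]
  refine Finset.sum_congr rfl fun p _ => ?_
  have hle : ∀ i ∈ p.parts, i ≤ n := fun i hi => by
    have := Multiset.le_sum_of_mem hi
    rwa [p.parts_sum] at this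
  have h1 := ite_add_sum_range_ite (fun a => (T (a : ℤ) : LaurentPolynomial ℚ)) (by simp)
    (if p.parts.count 1 = 0 then 1 else 0) p.parts.sup N
  rw [if_pos (show p.parts.sup ≤ N from (Multiset.sup_le.2 hle).trans hN)] at h1
  push_cast at h1
  have hcount : p.parts.count 1 ≤ n := by
    have h := p.parts_sum
    have h' : (Multiset.replicate (p.parts.count 1) 1).sum ≤ p.parts.sum := by
      obtain ⟨t, ht⟩ := Multiset.le_iff_exists_add.1
        (Multiset.le_count_iff_replicate_le.1 (le_refl (p.parts.count 1)))
      rw [congrArg Multiset.sum ht, Multiset.sum_add]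
      exact Nat.le_add_right _ _
    simpa [h] using h'
  have h2 : ∑ k ∈ Finset.range N, (if p.parts.count 1 = k + 1 then
      (T ((p.parts.filter fun i => k + 1 < i).card - (k + 1)) : LaurentPolynomial ℚ) else 0) =
      if p.parts.count 1 = 0 then 0 else
        T ((p.parts.filter fun i => p.parts.count 1 < i).card - p.parts.count 1) := by
    split_ifs with h
    · refine Finset.sum_eq_zero fun k _ => if_neg (by omega)
    · obtain ⟨c, hc⟩ := Nat.exists_eq_succ_of_ne_zero h
      rw [hc] at hcount ⊢
      rw [Finset.sum_eq_single c]
      · simp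
      · intro b _ hb
        exact if_neg (by omega)
      · intro hb
        rw [Finset.mem_range] at hb
        omega
  rw [h1, h2, crankPoly]
  by_cases hp : p.parts = {1}
  · rw [if_pos hp, if_pos hp, hp]
    simp [Multiset.filter_singleton]
    ring
  · rw [if_neg hp, if_neg hp, add_zero, Overpartition.crank]
    split_ifs <;> simp

/-- The product is W V with W in powers of z and V in powers of 1/z. The q-binomial theorem with a =
0 sums the contribution without ones to a multiple of 1/W; with a = zq and t = q/z it sums the
remaining contribution, and there a t = q² is free of z. -/
theorem exists_crankGF_mul : ∃ e : QSer, crankGF * thetaProd 1 1 = kK e := by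
  obtain ⟨W, hW⟩ := exists_convTo_prod_one_sub (t := zT 1 * X)
  obtain ⟨V, hV⟩ := exists_convTo_prod_one_sub (t := zT (-1) * X)
  obtain ⟨e, he⟩ := exists_convTo_prod_one_sub (t := (X ^ 2 : QSer))
  have hW' : ConvTo (fun L => ∏ i ∈ Finset.range L, (1 - zT 1 * X ^ (i + 1))) W := by
    simpa only [mul_assoc, ← pow_succ'] using hW
  have hV' : ConvTo (fun L => ∏ i ∈ Finset.range L, (1 - zT (-1) * X ^ (i + 1))) V := by
    simpa only [mul_assoc, ← pow_succ'] using hV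
  have hθ : thetaProd 1 1 = W * V := by
    refine (convTo_thetaProd 1 one_pos).unique ?_
    convert hW'.mul hV' using 2 with N
    rw [thetaPartial, ← Finset.prod_mul_distrib]
    simp
  have hz1 : zT 1 * zT (-1) = 1 := by rw [← zT_add]; simp
  have hzX : X ∣ zT 1 * (X : BiSeries) := dvd_mul_left _ _
  have hzX' : X ∣ zT (-1) * (X : BiSeries) := dvd_mul_left _ _
  set d : ℕ → BiSeries := fun n => ∏ i ∈ Finset.range n, geoOne (i + 1) with hd
  obtain ⟨E, hE⟩ := exists_convTo_sum_mul_pow hzX d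
  obtain ⟨F, hF⟩ := exists_convTo_sum_mul_pow hzX' crankCoeff
  have hEW : E * W = 1 := by
    refine mul_eq_of_qBinomial (a := 0) hzX (by simp [hd]) (fun n => ?_) hE hW ?_
    · simp only [hd]
      rw [Finset.prod_range_succ]
      linear_combination (∏ i ∈ Finset.range n, geoOne (i + 1)) *
        one_sub_mul_geoOne (d := n + 1) (by omega)
    · simpa using ConvTo.const (1 : BiSeries)
  have hFV : F * V = kK e := by
    refine mul_eq_of_qBinomial (a := zT 1 * X) hzX' (by simp [crankCoeff]) (fun n => ?_) hF hV ?_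
    · rw [crankCoeff, crankCoeff, Finset.prod_range_succ, Finset.prod_range_succ]
      linear_combination (∏ i ∈ Finset.range n, (1 - zT 1 * X ^ (i + 1))) *
        (∏ i ∈ Finset.range n, geoOne (i + 1)) * (1 - zT 1 * X ^ (n + 1)) *
        one_sub_mul_geoOne (d := n + 1) (by omega)
    · have hm := he.map LaurentPolynomial.C
      change ConvTo (fun N => kK _) (kK e) at hm
      convert hm using 2 with L
      rw [map_prod]
      refine Finset.prod_congr rfl fun i _ => ?_
      simp only [map_sub, map_one, map_mul, map_pow, kK_X]
      linear_combination -X ^ 2 * X ^ i * hz1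
  have hlim : ConvTo (fun N => ((1 - X) * ∑ n ∈ Finset.range (N + 2), d n * (zT 1 * X) ^ n) * W +
      (X - zT 1 * X) * W +
      (1 - X) * (∑ n ∈ Finset.range (N + 2), crankCoeff n * (zT (-1) * X) ^ n - 1) +
      (zT 1 * X - X) * W) (((1 - X) * E) * W + (X - zT 1 * X) * W + (1 - X) * (F - 1) +
        (zT 1 * X - X) * W) :=
    ((((((ConvTo.const _).mul (hE.comp_tendsto (tendsto_add_atTop_nat 2))).mul
      (ConvTo.const _)).add (ConvTo.const _)).add ((ConvTo.const _).mul
      ((hF.comp_tendsto (tendsto_add_atTop_nat 2)).sub (ConvTo.const _))))).add (ConvTo.const _)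
  -- The terms n = 0 and n = 1 are exceptional, since no partition without ones has largest part 1.
  -- Their correction q - zq cancels the modification at the partition 1.
  have hsum : ∀ N : ℕ, noOnes 0 + (∑ l ∈ Finset.range (N + 1),
      zT (l + 1) * (noOnes (l + 1) - noOnes l)) =
      (1 - X) * (∑ n ∈ Finset.range (N + 2), d n * (zT 1 * X) ^ n) + (X - zT 1 * X) := fun N => by
    induction N with
    | zero =>
      have h4 : (1 - X : BiSeries) * geoOne 1 = 1 := by simpa using one_sub_mul_geoOne one_pos
      rw [Finset.sum_range_one, noOnes_succ, noOnes_zero, Finset.sum_range_succ,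
        Finset.sum_range_one]
      simp only [hd, zero_add, Finset.prod_range_one, Finset.range_zero, Finset.prod_empty, h4]
      linear_combination -zT 1 * X * h4
    | succ N ih =>
      have h4 := one_sub_mul_geoOne (d := N + 1 + 1) (by omega)
      have hz : zT (((N + 1 : ℕ) : ℤ) + 1) = zT 1 ^ (N + 1 + 1) := by
        rw [zT, zT, ← map_pow, LaurentPolynomial.T_pow]
        push_cast
        ring_nf
      rw [Finset.sum_range_succ, ← add_assoc, ih, Finset.sum_range_succ _ (N + 2), noOnes_succ,
        noOnes_succ, hz]
      simp only [hd]
      rw [Finset.prod_range_succ _ (N + 1)]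
      linear_combination zT 1 ^ (N + 2) * (1 - X) *
        (∏ i ∈ Finset.range (N + 1), geoOne (i + 1)) * h4
  have hsum' : ∀ N : ℕ, (∑ k ∈ Finset.range (N + 1), zT (-(k + 1)) *
      (X ^ (k + 1) * noOnesLarge (k + 1))) * W =
      (1 - X) * (∑ n ∈ Finset.range (N + 2), crankCoeff n * (zT (-1) * X) ^ n - 1) := fun N => by
    rw [Finset.sum_range_succ' _ (N + 1), Finset.sum_mul,
      show crankCoeff 0 = 1 by simp [crankCoeff],
      pow_zero, mul_one, add_sub_cancel_right, Finset.mul_sum]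
    refine Finset.sum_congr rfl fun k _ => ?_
    have hz : zT (-((k : ℤ) + 1)) = zT (-1) ^ (k + 1) := by
      rw [zT, zT, ← map_pow, LaurentPolynomial.T_pow]
      push_cast
      ring_nf
    rw [hz]
    linear_combination zT (-1) ^ (k + 1) * X ^ (k + 1) * noOnesLarge_mul hW' k
  -- The contribution (1-q) E W = 1 - q of partitions without ones supplies the missing initial term
  -- of F.
  have hC : crankGF * W = (1 - X) * F := by
    have h := (convTo_crankGF.comp_tendsto (tendsto_add_atTop_nat 1)).mul (ConvTo.const W)
    have := h.unique (g := _) (by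
      convert hlim using 2 with N
      rw [hsum, add_mul, add_mul, add_mul, hsum'])
    linear_combination this + (1 - X) * hEW
  refine ⟨(1 - X) * e, ?_⟩
  rw [hθ, ← mul_assoc, hC, mul_assoc, hFV]
  simp [kK_X]

/-! ### Residual cranks -/

theorem exists_convTo_prod {R : Type*} [CommRing R] {f : ℕ → R⟦X⟧} (hf : ∀ i, X ^ i ∣ f i - 1) :
    ∃ V, ConvTo (fun L => ∏ i ∈ Finset.range L, f i) V :=
  exists_convTo fun M => by
    filter_upwards [eventually_ge_atTop M] with N hN
    rw [Finset.prod_range_succ, ← mul_sub_one]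
    exact Dvd.dvd.mul_left ((pow_dvd_pow X hN).trans (hf N)) _

theorem ConvTo.expand {R : Type*} [CommRing R] {s : ℕ → R⟦X⟧} {f : R⟦X⟧} (hf : ConvTo s f)
    {p : ℕ} (hp : p ≠ 0) :
    ConvTo (fun N => PowerSeries.expand p hp (s N)) (PowerSeries.expand p hp f) := fun n => by
  filter_upwards [hf (n / p)] with N hN
  rw [coeff_expand, coeff_expand, hN]

/-- The algebra of formal combinations of multisets of parts. -/
abbrev PartAlg := AddMonoidAlgebra ℚ (Multiset ℕ)

theorem prod_map_single (s : Multiset ℕ) :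
    (s.map fun i => (AddMonoidAlgebra.single {i} 1 : PartAlg)).prod =
      AddMonoidAlgebra.single s 1 := by
  induction s using Multiset.induction with
  | empty => rfl
  | cons a s ih =>
    rw [Multiset.map_cons, Multiset.prod_cons, ih, AddMonoidAlgebra.single_mul_single, one_mul,
      Multiset.singleton_add]

/-- The linear extension of `crankPoly`. -/
noncomputable def crankLin : PartAlg →ₗ[ℚ] LaurentPolynomial ℚ :=
  Finsupp.linearCombination ℚ crankPoly ∘ₗ (AddMonoidAlgebra.coeffLinearEquiv ℚ).toLinearMap

theorem crankLin_single (s : Multiset ℕ) :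
    crankLin (AddMonoidAlgebra.single s 1) = crankPoly s := by
  simp [crankLin]

/-- The coefficientwise application of `crankLin`. -/
noncomputable def crankMap (F : PartAlg⟦X⟧) : BiSeries := mk fun n => crankLin (coeff n F)

theorem crankMap_mul (e : QSer) (F : PartAlg⟦X⟧) :
    crankMap (PowerSeries.map (algebraMap ℚ PartAlg) e * F) = kK e * crankMap F := by
  ext1 n
  rw [crankMap, coeff_mk, coeff_mul, coeff_mul, map_sum]
  refine Finset.sum_congr rfl fun p _ => ?_
  rw [coeff_map, ← Algebra.smul_def, map_smul, crankMap, coeff_mk, kK, coeff_map,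
    ← LaurentPolynomial.smul_eq_C_mul]

theorem crankMap_expand (F : PartAlg⟦X⟧) :
    crankMap (PowerSeries.expand 2 two_ne_zero F) =
      PowerSeries.expand 2 two_ne_zero (crankMap F) := by
  ext1 n
  rw [crankMap, coeff_mk, coeff_expand, coeff_expand]
  split_ifs
  · rw [crankMap, coeff_mk]
  · rw [map_zero]

/-- The generating function of the first residual crank. -/
noncomputable def firstCrankGF : BiSeries :=
  mk fun n => ∑ l : Overpartition n, crankPoly l.nonOverlined

/-- The generating function of the second residual crank. -/
noncomputable def secondCrankGF : BiSeries :=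
  mk fun n => ∑ l : Overpartition n, crankPoly l.halvedEvenNonOverlined

theorem crankMap_partGF :
    crankMap (partGF fun i => AddMonoidAlgebra.single {i} 1) = crankGF := by
  ext1 n
  rw [crankMap, crankGF, partGF, coeff_mk, coeff_mk, coeff_mk, map_sum]
  simp only [prod_map_single, crankLin_single]

theorem crankMap_overGF_first :
    crankMap (overGF (fun _ => 1) fun i => AddMonoidAlgebra.single {i} 1) = firstCrankGF := by
  ext1 n
  rw [crankMap, firstCrankGF, overGF, coeff_mk, coeff_mk, coeff_mk, map_sum]
  simp only [overWeight, Finset.prod_const_one, one_mul, prod_map_single, crankLin_single]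

theorem crankMap_overGF_second :
    crankMap (overGF (fun _ => 1) fun i => if Even i then AddMonoidAlgebra.single {i / 2} 1 else 1)
      = secondCrankGF := by
  ext1 n
  rw [crankMap, secondCrankGF, overGF, coeff_mk, coeff_mk, coeff_mk, map_sum]
  refine Finset.sum_congr rfl fun l _ => ?_
  have h : ∀ s : Multiset ℕ, (s.map fun i => if Even i then
      (AddMonoidAlgebra.single {i / 2} 1 : PartAlg) else 1).prod =
      (((s.filter fun i => Even i).map fun i => i / 2).map fun i =>
        AddMonoidAlgebra.single {i} 1).prod := fun s => by
    induction s using Multiset.induction with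
    | empty => simp
    | cons a s ih =>
      rw [Multiset.map_cons, Multiset.prod_cons, ih]
      split_ifs with ha
      · rw [Multiset.filter_cons_of_pos _ ha, Multiset.map_cons, Multiset.map_cons,
          Multiset.prod_cons]
      · rw [Multiset.filter_cons_of_neg _ ha, one_mul]
  rw [overWeight, Finset.prod_const_one, one_mul, h, prod_map_single, crankLin_single]
  rfl

theorem eq_mul_mul_of_mul_eq {B : Type*} [CommRing B] {Φ V E P O O' : B} (h : Φ * (O * V) = E)
    (hP : P * V = 1) (hO : O * O' = 1) : Φ = E * O' * P := by
  rw [← h]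
  linear_combination -Φ * hO - Φ * O * O' * hP

/-- The crank is not multiplicative in the parts, so the products are formed with coefficients in
the algebra of multisets of parts and the crank is applied linearly afterwards. Overlined parts give
the factor ∏ (1 + q^i) and odd non-overlined parts give ∏ 1/(1 - q^(2i+1)); neither affects the
crank. The even non-overlined parts are all partitions, with q replaced by q². -/
theorem exists_residualCrank : (∃ a : QSer, firstCrankGF = kK a * crankGF) ∧
    ∃ b : QSer, secondCrankGF = kK b * PowerSeries.expand 2 two_ne_zero crankGF := by
  set β : ℕ → PartAlg := fun i => AddMonoidAlgebra.single {i} 1 with hβ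
  set β' : ℕ → PartAlg := fun i => if Even i then AddMonoidAlgebra.single {i / 2} 1 else 1 with hβ'
  have c1 : crankMap (partGF β) = crankGF := crankMap_partGF
  have c2 : crankMap (overGF (fun _ => 1) β) = firstCrankGF := crankMap_overGF_first
  have c3 : crankMap (overGF (fun _ => 1) β') = secondCrankGF := crankMap_overGF_second
  have e1 : ∀ i, β' (2 * i + 1) = 1 := fun i => if_neg (by simp)
  have e2 : ∀ i, β' (2 * i + 1 + 1) = β (i + 1) := fun i => by
    simp only [hβ, hβ']
    rw [if_pos ⟨i + 1, by ring⟩, show (2 * i + 1 + 1) / 2 = i + 1 by omega]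
  clear_value β β'
  have hd : ∀ {R : Type} [CommRing R] (a : R⟦X⟧) (i : ℕ), X ^ i ∣ (1 + a * X ^ (i + 1)) - 1 :=
    fun a i => by
      rw [add_sub_cancel_left, pow_succ]
      exact ⟨a * X, by ring⟩
  have hd' : ∀ (a : PartAlg) (i : ℕ), X ^ i ∣ (1 - C a * X ^ (i + 1)) - 1 := fun a i => by
    have := hd (C (-a)) i
    rwa [map_neg, neg_mul, ← sub_eq_add_neg] at this
  obtain ⟨V, hV⟩ := exists_convTo_prod (f := fun i => 1 - C (β (i + 1)) * X ^ (i + 1))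
    fun i => hd' _ i
  obtain ⟨V', hV'⟩ := exists_convTo_prod (f := fun i => 1 - C (β' (i + 1)) * X ^ (i + 1))
    fun i => hd' _ i
  obtain ⟨E, hE⟩ := exists_convTo_prod (f := fun i => (1 + 1 * X ^ (i + 1) : QSer)) fun i => hd _ i
  obtain ⟨O, hO⟩ := exists_convTo_prod (f := fun i => (1 + (-X ^ i) * X ^ (i + 1) : QSer))
    fun i => hd _ i
  have hO0 : constantCoeff O = 1 := by
    have h := hO 0
    obtain ⟨N, hN⟩ := h.exists
    rw [← coeff_zero_eq_constantCoeff_apply, ← hN, coeff_zero_eq_constantCoeff_apply, map_prod]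
    exact Finset.prod_eq_one fun i _ => by simp
  have hP : partGF β * V = 1 := partGF_mul β hV
  have hα : ConvTo (fun L => ∏ i ∈ Finset.range L, (1 + C (1 : PartAlg) * X ^ (i + 1)))
      (PowerSeries.map (algebraMap ℚ PartAlg) E) := by
    simpa using hE.map (algebraMap ℚ PartAlg)
  have hΦ : overGF (fun _ => 1) β * V = PowerSeries.map (algebraMap ℚ PartAlg) E :=
    (convTo_overGF (fun _ => 1) β hV).unique hα
  have hΦ' : overGF (fun _ => 1) β' * V' = PowerSeries.map (algebraMap ℚ PartAlg) E :=
    (convTo_overGF (fun _ => 1) β' hV').unique hα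
  have hVV : V' =
      PowerSeries.map (algebraMap ℚ PartAlg) O * PowerSeries.expand 2 two_ne_zero V := by
    have h2 : Tendsto (fun L : ℕ => 2 * L) atTop atTop :=
      tendsto_id.const_mul_atTop' two_pos
    refine (hV'.comp_tendsto h2).unique ?_
    convert (hO.map (algebraMap ℚ PartAlg)).mul (hV.expand two_ne_zero) using 2 with L
    rw [prod_range_two_mul (M := PartAlg⟦X⟧), map_prod, map_prod, ← Finset.prod_mul_distrib]
    refine Finset.prod_congr rfl fun i _ => ?_
    rw [e1, e2]
    simp only [map_add, map_sub, map_mul, map_pow, map_neg, map_one, map_X, expand_X, expand_C]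
    ring
  constructor
  · refine ⟨E, ?_⟩
    rw [← c1, ← c2, ← crankMap_mul, ← hΦ, mul_assoc, mul_comm V, hP, mul_one]
  · refine ⟨E * pinv O, ?_⟩
    have h1 := congrArg (PowerSeries.expand 2 two_ne_zero) hP
    have h2 := congrArg (PowerSeries.map (algebraMap ℚ PartAlg)) (mul_pinv hO0)
    rw [map_mul, map_one] at h1 h2
    rw [hVV] at hΦ'
    rw [← c1, ← c3, ← crankMap_expand, ← crankMap_mul, map_mul, eq_mul_mul_of_mul_eq hΦ' h1 h2]

theorem expand_thetaProd :
    PowerSeries.expand 2 two_ne_zero (thetaProd 1 1) = thetaProd 1 2 := by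
  refine ((convTo_thetaProd 1 one_pos).expand two_ne_zero).unique ?_
  convert convTo_thetaProd 1 two_pos using 2 with N
  rw [thetaPartial, thetaPartial, map_prod]
  refine Finset.prod_congr rfl fun i _ => ?_
  simp only [map_one, one_mul, map_mul, map_sub, map_pow, expand_X, zT, expand_C]
  rw [pow_mul]

theorem expand_kK (a : QSer) : PowerSeries.expand 2 two_ne_zero (kK a) =
    kK (PowerSeries.expand 2 two_ne_zero a) := by
  rw [kK, map_expand]

theorem exists_firstCrankGF_mul : ∃ e : QSer, firstCrankGF * thetaProd 1 1 = kK e := by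
  obtain ⟨⟨a, ha⟩, -⟩ := exists_residualCrank
  obtain ⟨e, he⟩ := exists_crankGF_mul
  exact ⟨a * e, by rw [ha, mul_assoc, he, map_mul]⟩

theorem exists_secondCrankGF_mul : ∃ e : QSer, secondCrankGF * thetaProd 1 2 = kK e := by
  obtain ⟨-, b, hb⟩ := exists_residualCrank
  obtain ⟨e, he⟩ := exists_crankGF_mul
  refine ⟨b * PowerSeries.expand 2 two_ne_zero e, ?_⟩
  rw [hb, mul_assoc, ← expand_thetaProd, ← map_mul, he, expand_kK, map_mul]

/-! ### Moments of the counting functions -/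

/-- As the product with the theta product is killed by z∂z, the logarithmic derivative of M is the
negative of the known one, and its moments determine those of M. -/
theorem mom_of_mul_thetaProd {M : BiSeries} {s : ℕ} (hs : 0 < s)
    (h : ∃ e : QSer, M * thetaProd 1 s = kK e) {j : ℕ} (hj : j ≤ 6) :
    mom j M = ev M * expMom (lambert 1 s 1) (lambert 1 s 3) (lambert 1 s 5) j := by
  obtain ⟨e, he⟩ := h
  obtain ⟨Λ, hΛ, hm⟩ := exists_zD_thetaProd 1 hs
  have hW : thetaProd 1 s ≠ 0 := fun h0 => ev_thetaProd_ne_zero 1 hs (by rw [h0, map_zero])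
  have hD : zD M = M * -Λ := by
    have := congrArg zD he
    rw [zD_kK, Derivation.leibniz, hΛ, smul_eq_mul, smul_eq_mul] at this
    apply mul_left_cancel₀ hW
    linear_combination this
  have hm' : ∀ j, mom j (-Λ) = (1 - (-1) ^ j) * lambert 1 s j := fun j => by
    rw [mom_neg, hm]; ring
  obtain ⟨h1, h3, h5, h2, h4, h6⟩ := mom_of_zD_eq_mul hD (by simp [hm']) (by simp [hm'])
    (by rw [hm']; norm_num)
  rw [hm'] at h2
  rw [hm', hm'] at h4
  rw [hm', hm', hm'] at h6
  interval_cases j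
  · simp [mom_zero, expMom]
  · simp [h1, expMom]
  · rw [h2, expMom]; ring
  · simp [h3, expMom]
  · rw [h4, expMom]; ring
  · simp [h5, expMom]
  · rw [h6, expMom]; ring

theorem eval_one_eq_sum (p : LaurentPolynomial ℚ) :
    LaurentPolynomial.eval₂ (RingHom.id ℚ) 1 p = p.coeff.sum fun _ a => a := by
  induction p using LaurentPolynomial.induction_on' with
  | add p q hp hq =>
    rw [map_add, hp, hq, AddMonoidAlgebra.coeff_add,
      Finsupp.sum_add_index' (fun _ => rfl) fun _ _ _ => rfl]
  | C_mul_T n a =>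
    rw [← LaurentPolynomial.single_eq_C_mul_T, AddMonoidAlgebra.coeff_single,
      Finsupp.sum_single_index rfl, LaurentPolynomial.single_eq_C_mul_T]
    simp

theorem coeff_iterate_zD (k n : ℕ) (F : BiSeries) (m : ℤ) :
    (coeff n (zD^[k] F)).coeff m = (m : ℚ) ^ k * (coeff n F).coeff m := by
  induction k with
  | zero => simp
  | succ k ih => rw [Function.iterate_succ_apply', coeff_zD, coeff_lauD, ih]; ring

theorem coeff_mom (k n : ℕ) {F : BiSeries} {c : ℤ → ℤ}
    (hc : ∀ m, (coeff n F).coeff m = c m) :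
    coeff n (mom k F) = (Overpartition.moment c k : ℚ) := by
  have hs : Function.support (fun m : ℤ => m ^ k * c m) ⊆ (coeff n F).coeff.support := by
    intro m hm
    rw [Finset.mem_coe, Finsupp.mem_support_iff, hc]
    exact_mod_cast right_ne_zero_of_mul hm
  have hs' : (coeff n (zD^[k] F)).coeff.support ⊆ (coeff n F).coeff.support := by
    intro m hm
    rw [Finsupp.mem_support_iff, coeff_iterate_zD] at hm
    exact Finsupp.mem_support_iff.2 (right_ne_zero_of_mul hm)
  rw [Overpartition.moment, finsum_eq_sum_of_support_subset _ hs, mom, ev, coeff_map,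
    eval_one_eq_sum, Finsupp.sum_of_support_subset _ hs' _ fun _ _ => rfl]
  push_cast
  refine Finset.sum_congr rfl fun m _ => ?_
  rw [coeff_iterate_zD, hc]

theorem coeff_sum_T {ι : Type*} [Fintype ι] (r : ι → ℤ) (m : ℤ) :
    (∑ l, (T (r l) : LaurentPolynomial ℚ)).coeff m =
      ((Finset.univ.filter fun l => r l = m).card : ℚ) := by
  rw [AddMonoidAlgebra.coeff_sum, Finset.sum_apply', Finset.card_filter]
  push_cast
  exact Finset.sum_congr rfl fun l _ => LaurentPolynomial.T_apply _ _

/-- The series was set up with z^(-rank), so its coefficient of z^m counts rank -m; the symmetry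
exchanges the two. -/
theorem coeff_rankGF (hR : zInv rankGF = rankGF) (n : ℕ) (m : ℤ) :
    (coeff n rankGF).coeff m = ((Overpartition.rankCount m n : ℤ) : ℚ) := by
  rw [← coeff_zc, ← hR, zc_zInv, coeff_zc, rankGF, coeff_mk, coeff_sum_T, Overpartition.rankCount]
  simp

theorem coeff_m2RankGF (hR : zInv m2RankGF = m2RankGF) (n : ℕ) (m : ℤ) :
    (coeff n m2RankGF).coeff m = ((Overpartition.m2RankCount m n : ℤ) : ℚ) := by
  rw [← coeff_zc, ← hR, zc_zInv, coeff_zc, m2RankGF, coeff_mk, coeff_sum_T,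
    Overpartition.m2RankCount]
  simp

theorem coeff_crankPoly (s : Multiset ℕ) (m : ℤ) :
    (crankPoly s).coeff m = (Overpartition.crankWeight s m : ℚ) := by
  rw [crankPoly, Overpartition.crankWeight]
  by_cases h : s = {1}
  · rw [if_pos h, if_pos h, AddMonoidAlgebra.coeff_sub, AddMonoidAlgebra.coeff_add,
      ← LaurentPolynomial.T_zero]
    simp only [Finsupp.sub_apply, Finsupp.add_apply, LaurentPolynomial.T_apply]
    split_ifs <;> first | omega | norm_num
  · rw [if_neg h, if_neg h, LaurentPolynomial.T_apply]
    split_ifs <;> simp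

theorem coeff_firstCrankGF (n : ℕ) (m : ℤ) :
    (coeff n firstCrankGF).coeff m = (Overpartition.firstCrankCount m n : ℚ) := by
  rw [firstCrankGF, coeff_mk, AddMonoidAlgebra.coeff_sum, Finset.sum_apply',
    Overpartition.firstCrankCount]
  push_cast
  exact Finset.sum_congr rfl fun l _ => coeff_crankPoly _ _

theorem coeff_secondCrankGF (n : ℕ) (m : ℤ) :
    (coeff n secondCrankGF).coeff m = (Overpartition.secondCrankCount m n : ℚ) := by
  rw [secondCrankGF, coeff_mk, AddMonoidAlgebra.coeff_sum, Finset.sum_apply',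
    Overpartition.secondCrankCount]
  push_cast
  exact Finset.sum_congr rfl fun l _ => coeff_crankPoly _ _

theorem eval_crankPoly (s : Multiset ℕ) :
    LaurentPolynomial.eval₂ (RingHom.id ℚ) 1 (crankPoly s) = 1 := by
  rw [crankPoly]
  split_ifs <;> simp

theorem ev_rankGF : ev rankGF = mk fun n => (Fintype.card (Overpartition n) : ℚ) := by
  ext n
  rw [ev, coeff_map, rankGF, coeff_mk, coeff_mk, map_sum]
  simp

/-- At z = 1 each overpartition has weight 1. The same holds for the two crank series, because z +
1/z - 1 is also 1 at z = 1, so all four moments share the prefactor P. -/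
theorem ev_m2RankGF : ev m2RankGF = ev rankGF := by
  ext n
  rw [ev_rankGF, ev, coeff_map, m2RankGF, coeff_mk, coeff_mk, map_sum]
  simp

theorem ev_firstCrankGF : ev firstCrankGF = ev rankGF := by
  ext n
  rw [ev_rankGF, ev, coeff_map, firstCrankGF, coeff_mk, coeff_mk, map_sum]
  simp [eval_crankPoly]

theorem ev_secondCrankGF : ev secondCrankGF = ev rankGF := by
  ext n
  rw [ev_rankGF, ev, coeff_map, secondCrankGF, coeff_mk, coeff_mk, map_sum]
  simp [eval_crankPoly]

end OverpartitionMoments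

/-! ### Conclusion: from generating functions to moments -/

theorem corollary3p2 (n : ℕ) :
    ((Overpartition.rankMoment 6 n : ℚ) =
        (3 + 20 * (n : ℚ) + 48 * (n : ℚ) ^ 2) * (Overpartition.rankMoment 2 n : ℚ)
        + (2192796 / 274505 + 123276 / 7595 * (n : ℚ) + (-5185344) / 1921535 * (n : ℚ) ^ 2)
          * (Overpartition.firstCrankMoment 2 n : ℚ)
        + ((-445728) / 54901 + (-5730048) / 384307 * (n : ℚ))
          * (Overpartition.firstCrankMoment 4 n : ℚ)
        + 5376 / 3565 * (Overpartition.firstCrankMoment 6 n : ℚ)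
        + ((-386988) / 39215 + (-54556468) / 1921535 * (n : ℚ)
            + (-30679392) / 1921535 * (n : ℚ) ^ 2)
          * (Overpartition.secondCrankMoment 2 n : ℚ)
        + (96204 / 7843 + 1412352 / 54901 * (n : ℚ))
          * (Overpartition.secondCrankMoment 4 n : ℚ)
        + (-9056) / 3565 * (Overpartition.secondCrankMoment 6 n : ℚ)) ∧
    ((Overpartition.m2RankMoment 6 n : ℚ) =
        (3 + 5 * (n : ℚ) + 3 * (n : ℚ) ^ 2) * (Overpartition.m2RankMoment 2 n : ℚ)
        + (249003 / 274505 + 36273 / 83545 * (n : ℚ) + (-162042) / 1921535 * (n : ℚ) ^ 2)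
          * (Overpartition.firstCrankMoment 2 n : ℚ)
        + ((-46014) / 54901 + (-179064) / 384307 * (n : ℚ))
          * (Overpartition.firstCrankMoment 4 n : ℚ)
        + 168 / 3565 * (Overpartition.firstCrankMoment 6 n : ℚ)
        + ((-765123) / 274505 + 6826601 / 1921535 * (n : ℚ)
            + 4805874 / 1921535 * (n : ℚ) ^ 2)
          * (Overpartition.secondCrankMoment 2 n : ℚ)
        + (39102 / 7843 + 44136 / 54901 * (n : ℚ))
          * (Overpartition.secondCrankMoment 4 n : ℚ)
        + (-3848) / 3565 * (Overpartition.secondCrankMoment 6 n : ℚ)) := by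
  obtain ⟨hR, hRe⟩ := OverpartitionMoments.rank_pde OverpartitionMoments.convTo_rankGF
  obtain ⟨hS, hSe⟩ := OverpartitionMoments.m2Rank_pde OverpartitionMoments.convTo_m2RankGF
  have h1 := fun j hj => OverpartitionMoments.mom_of_mul_thetaProd one_pos
    OverpartitionMoments.exists_firstCrankGF_mul (j := j) hj
  have h2 := fun j hj => OverpartitionMoments.mom_of_mul_thetaProd two_pos
    OverpartitionMoments.exists_secondCrankGF_mul (j := j) hj
  rw [OverpartitionMoments.ev_firstCrankGF] at h1
  rw [OverpartitionMoments.ev_secondCrankGF] at h2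
  have r1 := OverpartitionMoments.rank_mom_six hR h1 h2 hRe n
  -- The crank moments are re-expressed with the prefactor of the M2-rank series, which is the same
  -- power series.
  rw [← OverpartitionMoments.ev_m2RankGF] at h1 h2
  have r2 := OverpartitionMoments.m2Rank_mom_six hS h1 h2 hSe n
  have a := fun k => OverpartitionMoments.coeff_mom k n (OverpartitionMoments.coeff_rankGF hR n)
  have b := fun k => OverpartitionMoments.coeff_mom k n (OverpartitionMoments.coeff_m2RankGF hS n)
  have c := fun k => OverpartitionMoments.coeff_mom k n
    (OverpartitionMoments.coeff_firstCrankGF n)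
  have d := fun k => OverpartitionMoments.coeff_mom k n
    (OverpartitionMoments.coeff_secondCrankGF n)
  rw [a, a, c, c, c, d, d, d] at r1
  rw [b, b, c, c, c, d, d, d] at r2
  exact ⟨r1, r2⟩
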